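/- Let $L$ be a lattice (for instance $\mathbb{Z}^d$; only its set of sites matters) and $I=\{+,z,-\}$, with conjugation $\overline{+}=-$, $\overline{z}=z$, $\overline{-}=+$. For finitely supported multi-indices $\alpha\in\mathbb{N}^{I\times L}$ write $|\alpha|=\sum_{x,i}\alpha_i(x)$, $|\alpha(x)|=\sum_i\alpha_i(x)$, $\overline{\alpha}_i(x)=\alpha_{\bar i}(x)$. Let $V(t,\alpha)\in\mathbb{C}$ ($t\in\mathbb{R}$) be an interaction potential such that $t\mapsto V(t,\alpha)$ is continuous for each $\alpha$, $\overline{V(t,\alpha)}=V(t,\overline{\alpha})$, and $$\|V\|:=\sum_{n\in\mathbb{N}}\ \sup_{x\in L,\,t\in\mathbb{R}}\ \sum_{|\alpha|=n}|\alpha(x)|\,|V(t,\alpha)|\,e^n<\infty$$ (time-independent potentials are a special case). *Classical system.* For finite $\Lambda\subset L$ let $\Xi_\Lambda=\prod_{x\in\Lambda}\overline{B_1(0)}$ with $\overline{B_1(0)}\subset\mathbb{R}^3$, with coordinates $M_\pm(x)=(M_1(x)\pm iM_2(x))/\sqrt2$, $M_z(x)=M_3(x)$; let $\mathfrak{P}_\Lambda=\mathbb{C}[\{M_i(x):i\in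 I,x\in\Lambda\}]$, and $\|A\|_\infty=\sup_{M\in\Xi_\Lambda}|A(M)|$. For $\Lambda_0\subset\Lambda$ regard $\mathfrak{P}_{\Lambda_0}\subset\mathfrak{P}_\Lambda$. Let $\tilde\epsilon_{\pm\mp z}=\pm1$, $\tilde\epsilon_{\pm z\pm}=\mp1$, $\tilde\epsilon_{z\pm\pm}=\pm1$, and $\tilde\epsilon_{ijk}=0$ otherwise. The Hamilton function $H_\Lambda(t)=\sum_{\alpha\in\mathbb{N}^{I\times\Lambda}}V(t,\alpha)M^\alpha$ and the Poisson bracket $\{M_i(x),M_j(y)\}=i\,\tilde\epsilon_{ijk}\,\delta(x,y)M_k(x)$ give the equations of motion $$\frac{d}{dt}M_i(t,x)=\sum_{\alpha\in\mathbb{N}^{I\times\Lambda}}V(t,\alpha)\sum_{j,k\in I}i\,\tilde\epsilon_{jik}\,\alpha_j(x)\,M^{\alpha-\delta_j(x)+\delta_k(x)}(t).$$ Let $\phi^t_\Lambda$ be the map $M(0)\mapsto M(t)$ on $\Xi_\Lambda$ and $\alpha^t_\Lambda A=A\circ\phi^t_\Lambda$. *Quantum system.* For $s\in\{\tfrac12,1,\tfrac32,\dots\}$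 let $\mathscr{H}_\Lambda=\bigotimes_{x\in\Lambda}\mathbb{C}^{2s+1}$, let $\hat S_k(x)$, $k=1,2,3$, be the generators of the spin-$s$ representation of $su(2)$ at site $x$ divided by $s$, and $\hat S_\pm(x)=(\hat S_1(x)\pm i\hat S_2(x))/\sqrt2$, $\hat S_z(x)=\hat S_3(x)$. The quantization $A\mapsto\hat A$ is the linear map that sends $M_{i_1}(x_1)\cdots M_{i_p}(x_p)$ to the product of $\hat S_{i_1}(x_1),\dots,\hat S_{i_p}(x_p)$ in normal order (all $+$ to the left of all $z$, all $z$ to the left of all $-$). Let $\hat H_\Lambda(t)=\sum_{\alpha\in\mathbb{N}^{I\times\Lambda}}V(t,\alpha)\,\widehat{M^\alpha}$, let $U_s(t)$ solve $\frac{d}{dt}U_s(t)=-is\hat H_\Lambda(t)U_s(t)$, $U_s(0)=1$ (so $U_s(t)=e^{-ist\hat H_\Lambda}$ if $V$ is time-independent), and $\hat\alpha^t_\Lambda\mathcal{A}=U_s(t)^*\mathcal{A}\,U_s(t)$. **Theorem.** The dynamics are well defined: for every finite $\Lambda\subset L$ and every $M_0\in\Xi_\Lambda$ the equations of motion have exactly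 one solution $M:\mathbb{R}\to\Xi_\Lambda$ with $M(0)=M_0$, and for every $s$ the propagator $U_s$ exists and is unique. Moreover, let $\Lambda_0\subset L$ be finite, $A\in\mathfrak{P}_{\Lambda_0}$ and $\epsilon>0$. Then there are constants $C(\epsilon,t,A)$, $t\in\mathbb{R}$ (which may depend on $V$, but not on $\Lambda$ or $s$), such that for every finite $\Lambda\subset L$ with $\Lambda_0\subset\Lambda$ there is a family $A(t)\in\mathfrak{P}_\Lambda$, $t\in\mathbb{R}$, independent of $s$, with $$\sup_{t\in\mathbb{R}}\|\alpha^t_\Lambda A-A(t)\|_\infty\le\epsilon$$ and, for all $t\in\mathbb{R}$ and all $s\in\{\tfrac12,1,\tfrac32,\dots\}$, $$\big\|\hat\alpha^t_\Lambda\hat A-\widehat{A(t)}\big\|\le\epsilon+\frac{C(\epsilon,t,A)}{s}.$$ -/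

import Mathlib

namespace SpinEgorov

noncomputable section

/-- The index set `I = {+, z, -}`. -/
inductive Idx : Type
  | plus
  | z
  | minus
  deriving DecidableEq

instance : Fintype Idx where
  elems := {Idx.plus, Idx.z, Idx.minus}
  complete := by
    intro i
    cases i <;> simp

/-- The conjugation `(+, z, -) ↦ (-, z, +)`. -/
def Idx.bar : Idx → Idx
  | Idx.plus => Idx.minus
  | Idx.z => Idx.z
  | Idx.minus => Idx.plus

/-- The structure constants `ε̃_{ijk}`. -/
def eps : Idx → Idx → Idx → ℤ
  | Idx.plus, Idx.minus, Idx.z => 1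
  | Idx.minus, Idx.plus, Idx.z => -1
  | Idx.plus, Idx.z, Idx.plus => -1
  | Idx.minus, Idx.z, Idx.minus => 1
  | Idx.z, Idx.plus, Idx.plus => 1
  | Idx.z, Idx.minus, Idx.minus => -1
  | _, _, _ => 0

/-- Finite multi-indices `α ∈ ℕ^{I × X}`, `|α| < ∞`, over a set `X` of sites. -/
abbrev MultiIndex (X : Type*) := (Idx × X) →₀ ℕ

/-- `|α(x)| = ∑_i α_i(x)`. -/
def siteDegree {X : Type*} (α : MultiIndex X) (x : X) : ℕ := ∑ i : Idx, α (i, x)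

/-- The conjugate multi-index, `ᾱ_i(x) = α_{ī}(x)`. -/
def conjIndex {X : Type*} (α : MultiIndex X) : MultiIndex X :=
  α.mapDomain (Prod.map Idx.bar id)

/-- The embedding `ℕ^{I × Λ} ⊂ ℕ^{I × L}` by adjoining zeroes. -/
def extendIndex {L : Type*} (Λ : Finset L) (α : MultiIndex Λ) : MultiIndex L :=
  α.mapDomain (Prod.map id Subtype.val)

/-- `∑_n sup_{x, t} ∑_{|α| = n} |α(x)| |V(t, α)| e^n`, as an extended nonnegative number. -/
def potentialNorm {L : Type*} (V : ℝ → MultiIndex L → ℂ) : ENNReal :=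
  ∑' n : ℕ, ⨆ (x : L) (t : ℝ), ∑' α : {α : MultiIndex L // α.degree = n},
    (siteDegree α.1 x : ENNReal) * ‖V t α.1‖ₑ * ENNReal.ofReal (Real.exp n)

/-! ### Classical spins -/

/-- Classical spin configurations `x ↦ M(x) ∈ ℝ³` on `Λ`. -/
abbrev Config {L : Type*} (Λ : Finset L) := Λ → EuclideanSpace ℝ (Fin 3)

/-- The phase space `Ξ_Λ`, the product of closed unit balls of `ℝ³`. -/
def phaseSpace {L : Type*} (Λ : Finset L) : Set (Config Λ) := {M | ∀ x, ‖M x‖ ≤ 1}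

/-- The coordinates `M_± = (M_1 ± i M_2) / √2`, `M_z = M_3`. -/
def ladder {L : Type*} {Λ : Finset L} (M : Config Λ) : Idx × Λ → ℂ
  | (Idx.plus, x) => ((M x 0 : ℂ) + Complex.I * (M x 1 : ℂ)) / (√2 : ℝ)
  | (Idx.z, x) => (M x 2 : ℂ)
  | (Idx.minus, x) => ((M x 0 : ℂ) - Complex.I * (M x 1 : ℂ)) / (√2 : ℝ)

/-- The polynomial algebra `𝔓_Λ` in the coordinates `M_i(x)`. -/
abbrev Poly {L : Type*} (Λ : Finset L) := MvPolynomial (Idx × Λ) ℂ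

/-- The value of a polynomial observable at a configuration. -/
def Poly.value {L : Type*} {Λ : Finset L} (A : Poly Λ) (M : Config Λ) : ℂ :=
  MvPolynomial.eval (ladder M) A

/-- The inclusion `𝔓_{Λ₀} ⊂ 𝔓_Λ` for `Λ₀ ⊆ Λ`. -/
def Poly.extend {L : Type*} {Λ₀ Λ : Finset L} (h : Λ₀ ⊆ Λ) (A : Poly Λ₀) : Poly Λ :=
  MvPolynomial.rename (Prod.map id fun x : Λ₀ => (⟨x.1, h x.2⟩ : Λ)) A

/-- The monomial `M^α`. -/
def monomialValue {L : Type*} {Λ : Finset L} (α : MultiIndex Λ) (M : Config Λ) : ℂ :=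
  α.prod fun p k => ladder M p ^ k

/-- The `(i, x)` component `{H_Λ(t), M_i(x)}` of the Hamiltonian vector field of
`H_Λ(t) = ∑_α V(t, α) M^α`, i.e.
`∑_α V(t, α) ∑_{j, k} i ε̃_{jik} α_j(x) M^{α - δ_j(x) + δ_k(x)}`. -/
def hamiltonianField {L : Type*} [DecidableEq L] (V : ℝ → MultiIndex L → ℂ) (Λ : Finset L)
    (t : ℝ) (M : Config Λ) (i : Idx) (x : Λ) : ℂ :=
  ∑' α : MultiIndex Λ, V t (extendIndex Λ α) * ∑ j : Idx, ∑ k : Idx,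
    Complex.I * (eps j i k : ℂ) * (α (j, x) : ℂ) *
      monomialValue (α - Finsupp.single (j, x) 1 + Finsupp.single (k, x) 1) M

/-- `M` is a global solution in `Ξ_Λ` of the Hamiltonian equations of motion with `M(0) = M₀`. -/
structure IsClassicalSolution {L : Type*} [DecidableEq L] (V : ℝ → MultiIndex L → ℂ)
    (Λ : Finset L) (M₀ : Config Λ) (M : ℝ → Config Λ) : Prop where
  initial : M 0 = M₀
  mem_phaseSpace : ∀ t, M t ∈ phaseSpace Λ
  hasDerivAt : ∀ (t : ℝ) (i : Idx) (x : Λ),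
    HasDerivAt (fun r => ladder (M r) (i, x)) (hamiltonianField V Λ t (M t) i x) t

open Classical in
/-- The flow `φ^t_Λ` : `M₀ ↦ M(t)`, where `M` is the solution starting at `M₀`. -/
def classicalFlow {L : Type*} [DecidableEq L] (V : ℝ → MultiIndex L → ℂ) (Λ : Finset L)
    (t : ℝ) (M₀ : Config Λ) : Config Λ :=
  if h : ∃ M, IsClassicalSolution V Λ M₀ M then h.choose t else M₀

/-- The classical time evolution `α^t_Λ A = A ∘ φ^t_Λ`. -/
def classicalEvolution {L : Type*} [DecidableEq L] (V : ℝ → MultiIndex L → ℂ) (Λ : Finset L)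
    (t : ℝ) (A : Config Λ → ℂ) : Config Λ → ℂ :=
  fun M₀ => A (classicalFlow V Λ t M₀)

/-! ### Quantum spins of magnitude `s = n / 2` -/

/-- `⨂_{x ∈ Λ} ℂ^{n+1}`, written in the product basis. -/
abbrev SpinSpace {L : Type*} (Λ : Finset L) (n : ℕ) := EuclideanSpace ℂ (Λ → Fin (n + 1))

/-- The algebra of operators on the spin space, with the operator norm. -/
abbrev SpinOp {L : Type*} (Λ : Finset L) (n : ℕ) := SpinSpace Λ n →L[ℂ] SpinSpace Λ n

/-- The raising operator of the spin-`n/2` representation of `su(2)` in the orthonormal basis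
`|m⟩`, `m = s, s-1, …, -s` (the basis vector of index `a` has `m = s - a`):
`|m⟩ ↦ √(s(s+1) - m(m+1)) |m+1⟩`, with `s(s+1) - m(m+1) = b (n+1-b)` for `m = s - b`. -/
def raising (n : ℕ) : Matrix (Fin (n + 1)) (Fin (n + 1)) ℂ :=
  fun a b => if (a : ℕ) + 1 = (b : ℕ) then ((√((b : ℝ) * ((n : ℝ) + 1 - (b : ℝ))) : ℝ) : ℂ) else 0

/-- The three generators of the spin-`n/2` representation of `su(2)` on `ℂ^{n+1}`. -/
def generator (n : ℕ) : Fin 3 → Matrix (Fin (n + 1)) (Fin (n + 1)) ℂ :=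
  ![(1 / 2 : ℂ) • (raising n + (raising n).conjTranspose),
    (1 / (2 * Complex.I) : ℂ) • (raising n - (raising n).conjTranspose),
    Matrix.diagonal fun a => ((n : ℂ) / 2 - (a : ℕ))]

/-- The generators rescaled by `s⁻¹`. -/
def rescaledSpin (n : ℕ) (k : Fin 3) : Matrix (Fin (n + 1)) (Fin (n + 1)) ℂ :=
  ((n : ℂ) / 2)⁻¹ • generator n k

/-- `S_± = (S_1 ± i S_2) / √2`, `S_z = S_3` on a single site. -/
def spinMatrix (n : ℕ) : Idx → Matrix (Fin (n + 1)) (Fin (n + 1)) ℂ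
  | Idx.plus => ((√2 : ℝ) : ℂ)⁻¹ • (rescaledSpin n 0 + Complex.I • rescaledSpin n 1)
  | Idx.z => rescaledSpin n 2
  | Idx.minus => ((√2 : ℝ) : ℂ)⁻¹ • (rescaledSpin n 0 - Complex.I • rescaledSpin n 1)

/-- The matrix of `T` acting on the tensor factor at `x` (identity on the other factors). -/
def siteMatrix {X : Type*} [Fintype X] [DecidableEq X] {n : ℕ} (x : X)
    (T : Matrix (Fin (n + 1)) (Fin (n + 1)) ℂ) :
    Matrix (X → Fin (n + 1)) (X → Fin (n + 1)) ℂ :=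
  fun σ τ => if ∀ y, y ≠ x → σ y = τ y then T (σ x) (τ x) else 0

/-- The spin operator `Ŝ_i(x)` on the spin space of `Λ`. -/
def spinOp {L : Type*} [DecidableEq L] (Λ : Finset L) (n : ℕ) (p : Idx × Λ) : SpinOp Λ n :=
  Matrix.toEuclideanCLM (𝕜 := ℂ) (n := Λ → Fin (n + 1)) (siteMatrix p.2 (spinMatrix n p.1))

theorem siteMatrix_mul_apply {X : Type*} [Fintype X] [DecidableEq X] {n : ℕ} {x y : X}
    (hxy : x ≠ y) (S T : Matrix (Fin (n + 1)) (Fin (n + 1)) ℂ) (σ τ : X → Fin (n + 1)) :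
    (siteMatrix x S * siteMatrix y T) σ τ =
      if ∀ w, w ≠ x → w ≠ y → σ w = τ w then S (σ x) (τ x) * T (σ y) (τ y) else 0 := by
  rw [Matrix.mul_apply, Finset.sum_eq_single (Function.update σ x (τ x))]
  · have h1 : ∀ w, w ≠ x → σ w = Function.update σ x (τ x) w := by
      intro w hw
      rw [Function.update_of_ne hw]
    have h2 : (∀ w, w ≠ y → Function.update σ x (τ x) w = τ w) ↔
        ∀ w, w ≠ x → w ≠ y → σ w = τ w := by
      constructor
      · intro h w hx hy
        have := h w hy
        rwa [Function.update_of_ne hx] at this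
      · intro h w hy
        by_cases hx : w = x
        · subst hx
          simp
        · rw [Function.update_of_ne hx]
          exact h w hx hy
    simp only [siteMatrix]
    rw [if_pos h1]
    simp only [h2, Function.update_self, Function.update_of_ne hxy.symm]
    split_ifs <;> simp
  · intro ρ _ hρ
    simp only [siteMatrix]
    split_ifs with h1 h2
    · exfalso
      apply hρ
      funext w
      by_cases hw : w = x
      · subst hw
        simp [h2 w hxy]
      · rw [Function.update_of_ne hw]
        exact (h1 w hw).symm
    all_goals simp
  · simp

theorem spinOp_commute {L : Type*} [DecidableEq L] (Λ : Finset L) (n : ℕ) {p q : Idx × Λ}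
    (h : p.1 = q.1) : Commute (spinOp Λ n p) (spinOp Λ n q) := by
  obtain ⟨i, x⟩ := p
  obtain ⟨j, y⟩ := q
  obtain rfl : i = j := h
  by_cases hxy : x = y
  · subst hxy
    exact Commute.refl _
  · simp only [Commute, SemiconjBy, spinOp, ← map_mul]
    congr 1
    ext σ τ
    rw [siteMatrix_mul_apply hxy, siteMatrix_mul_apply (Ne.symm hxy)]
    congr 1
    · exact propext ⟨fun h w a b => h w b a, fun h w a b => h w b a⟩
    · exact mul_comm _ _

/-- The rearrangement of a word of spin variables in which all indices `+` stand to the left of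
all indices `z`, and these to the left of all indices `-`. -/
def normalOrder {X : Type*} (w : List (Idx × X)) : List (Idx × X) :=
  w.filter (fun p => p.1 = Idx.plus) ++ w.filter (fun p => p.1 = Idx.z) ++
    w.filter (fun p => p.1 = Idx.minus)

/-- The normal-ordered product `:Ŝ_{i_1}(x_1) ⋯ Ŝ_{i_p}(x_p):`. -/
def wick {L : Type*} [DecidableEq L] (Λ : Finset L) (n : ℕ) (w : List (Idx × Λ)) : SpinOp Λ n :=
  ((normalOrder w).map (spinOp Λ n)).prod

theorem wick_perm {L : Type*} [DecidableEq L] (Λ : Finset L) (n : ℕ) {w w' : List (Idx × Λ)}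
    (h : w.Perm w') : wick Λ n w = wick Λ n w' := by
  have key : ∀ i : Idx, ((w.filter (fun p => p.1 = i)).map (spinOp Λ n)).prod =
      ((w'.filter (fun p => p.1 = i)).map (spinOp Λ n)).prod := by
    intro i
    apply List.Perm.prod_eq' ((h.filter _).map _)
    rw [List.pairwise_map]
    apply List.pairwise_of_forall_mem_list
    intro p hp q hq
    simp only [List.mem_filter, decide_eq_true_eq] at hp hq
    exact spinOp_commute Λ n (hp.2.trans hq.2.symm)
  simp only [wick, normalOrder, List.map_append, List.prod_append, key]

/-- The quantization of `M^α`: the normal-ordered product of the word of its factors, which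
does not depend on the order in which the factors are listed. -/
def quantMonomial {L : Type*} [DecidableEq L] (Λ : Finset L) (n : ℕ) (α : MultiIndex Λ) :
    SpinOp Λ n :=
  Quot.lift (wick Λ n) (fun _ _ h => wick_perm Λ n h) (Finsupp.toMultiset α)

/-- The quantization `Â` of a polynomial `A`, linear in `A`. -/
def quantize {L : Type*} [DecidableEq L] {Λ : Finset L} (n : ℕ) (A : Poly Λ) : SpinOp Λ n :=
  ∑ α ∈ A.support, A.coeff α • quantMonomial Λ n α

/-- The quantum Hamiltonian `Ĥ_Λ(t)`: term by term quantization of `∑_α V(t, α) M^α`. -/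
def quantumHamiltonian {L : Type*} [DecidableEq L] (V : ℝ → MultiIndex L → ℂ) (Λ : Finset L)
    (n : ℕ) (t : ℝ) : SpinOp Λ n :=
  ∑' α : MultiIndex Λ, V t (extendIndex Λ α) • quantMonomial Λ n α

/-- `U` solves `U'(t) = -i s Ĥ_Λ(t) U(t)`, `U(0) = 1`, with `s = n / 2`. -/
structure IsPropagator {L : Type*} [DecidableEq L] (V : ℝ → MultiIndex L → ℂ) (Λ : Finset L)
    (n : ℕ) (U : ℝ → SpinOp Λ n) : Prop where
  initial : U 0 = 1
  hasDerivAt : ∀ t : ℝ,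
    HasDerivAt U (-(Complex.I * ((n : ℂ) / 2)) • (quantumHamiltonian V Λ n t * U t)) t

open Classical in
/-- The propagator `U_s(t; Ĥ_Λ)`. -/
def propagator {L : Type*} [DecidableEq L] (V : ℝ → MultiIndex L → ℂ) (Λ : Finset L)
    (n : ℕ) : ℝ → SpinOp Λ n :=
  if h : ∃ U, IsPropagator V Λ n U then h.choose else fun _ => 1

/-- The Heisenberg evolution `U_s(t; Ĥ_Λ)* 𝒜 U_s(t; Ĥ_Λ)`. -/
def quantumEvolution {L : Type*} [DecidableEq L] (V : ℝ → MultiIndex L → ℂ) (Λ : Finset L)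
    (n : ℕ) (t : ℝ) (A : SpinOp Λ n) : SpinOp Λ n :=
  star (propagator V Λ n t) * A * propagator V Λ n t

end

end SpinEgorov

/-! Classical and quantum evolution are two instances of one structure. Let `m t γ` denote the
evolved monomial `M^γ`: its value along a classical trajectory, or its normal-ordered quantization
conjugated by the propagator. Both families satisfy the Liouville equation in which `m t α` has
derivative `∑_β V(t, β) {M^β, M^α}`, the bracket being expressed through `m t`. The classical family
satisfies it exactly, the quantum family up to `O(1/s)` in each bracket; this is `IsApproxFlow`. A
polynomial built from the brackets alone therefore approximates both evolutions and cannot depend on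
`s`.

Such a polynomial comes from solving the Liouville equation for the coefficients, truncated to
degree at most `D`, from time `t` back to time `0`. Along this solution the pairing `∑_γ b_γ m_γ` is
almost constant: its derivative contains only the bracket error and the monomials of degree above
`D` (`exists_short_time_approx`).

Uniformity in the volume comes from the weighted norms `∑_γ |b_γ| z^|γ|`. The coefficients of `{M^β,
M^α}` sum to at most `∑_x |β(x)| |α(x)|`, and summing over `β` with the potential norm gives `|α|`
times that norm, without a factor `|Λ|`. The Liouville operator thus costs one derivative in `z`. As
in Cauchy-Kovalevskaya arguments, this loss is absorbed by letting `z` decrease with time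
(`weighted_norm_le`). On a short segment `z` stays between `e` and `5/2`; the result has controlled
degree and coefficients, so the weight can be reset to `e` and the step repeated until time `0` is
reached (`exists_iterated_approx`).

The weights `3/2 < 2 < 5/2 < e` have separate tasks. Monomials have size at most `(3/2)^|γ|`, since
rescaled spins have norm at most `√2`; the gap from `3/2` to `2` makes the truncation tail and the
reordering errors small, the gap from `2` to `5/2` pays for a factor `|α|`, and the gap from `5/2`
to `e` is spent on the decreasing weight.

The quantum error is found with words. The Leibniz rule expands the bracket of two words into one
formal sum, `wordBracket`; in commuting variables it is the Poisson bracket, in spin operators it is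
`i s` times the commutator. The two readings differ only by reordering letters, and each
transposition costs `O(1/s)` (`norm_commutator_sub_bracket_le`). -/

namespace SpinEgorov

open Set Filter Topology Metric
open scoped NNReal

/-! ### Global solutions of ordinary differential equations -/

section ODE

variable {E : Type*} [NormedAddCommGroup E] [NormedSpace ℝ E]

/-- The radial retraction onto the closed ball of radius `R`. -/
noncomputable def retract (R : ℝ) (x : E) : E := (R / max R ‖x‖) • x

theorem retract_of_norm_le {R : ℝ} (hR : 0 < R) {x : E} (hx : ‖x‖ ≤ R) : retract R x = x := by
  rw [retract, max_eq_left hx, div_self hR.ne', one_smul]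

theorem norm_retract_le {R : ℝ} (hR : 0 < R) (x : E) : ‖retract R x‖ ≤ R := by
  have h : 0 < max R ‖x‖ := lt_max_of_lt_left hR
  rw [retract, norm_smul, Real.norm_of_nonneg (by positivity), div_mul_eq_mul_div,
    div_le_iff₀ h]
  exact mul_le_mul_of_nonneg_left (le_max_right _ _) hR.le

theorem norm_retract_le_norm {R : ℝ} (hR : 0 < R) (x : E) : ‖retract R x‖ ≤ ‖x‖ := by
  have h : 0 < max R ‖x‖ := lt_max_of_lt_left hR
  rw [retract, norm_smul, Real.norm_of_nonneg (by positivity)]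
  exact mul_le_of_le_one_left (norm_nonneg _) ((div_le_one h).2 (le_max_left _ _))

theorem lipschitzWith_retract {R : ℝ} (hR : 0 < R) : LipschitzWith 2 (retract R : E → E) := by
  refine LipschitzWith.of_dist_le_mul fun x y => ?_
  rw [dist_eq_norm, dist_eq_norm]
  have ha : 0 < max R ‖x‖ := lt_max_of_lt_left hR
  have hb : 0 < max R ‖y‖ := lt_max_of_lt_left hR
  have hab : |max R ‖y‖ - max R ‖x‖| ≤ ‖x - y‖ := by
    have h1 := abs_max_sub_max_le_abs ‖y‖ ‖x‖ R
    have h2 := abs_norm_sub_norm_le y x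
    rw [max_comm R ‖y‖, max_comm R ‖x‖, norm_sub_rev x y]
    exact h1.trans h2
  -- The change of the point and the change of the scaling factor are separated; each contributes at
  -- most `‖x - y‖`, whence the constant 2.
  have key : retract R x - retract R y =
      (R / max R ‖x‖) • (x - y) + (R / max R ‖x‖ * ((max R ‖y‖ - max R ‖x‖) / max R ‖y‖)) • y := by
    have : R / max R ‖x‖ * ((max R ‖y‖ - max R ‖x‖) / max R ‖y‖) =
        R / max R ‖x‖ - R / max R ‖y‖ := by
      field_simp
    rw [this, retract, retract, smul_sub, sub_smul]
    abel
  rw [key]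
  have h1 : R / max R ‖x‖ ≤ 1 := (div_le_one ha).2 (le_max_left _ _)
  have h0 : 0 ≤ R / max R ‖x‖ := by positivity
  refine (norm_add_le _ _).trans ?_
  rw [norm_smul, norm_smul, norm_mul, Real.norm_of_nonneg h0, norm_div,
    Real.norm_of_nonneg hb.le, Real.norm_eq_abs]
  have h2 : |max R ‖y‖ - max R ‖x‖| / max R ‖y‖ * ‖y‖ ≤ ‖x - y‖ := by
    rw [div_mul_eq_mul_div, div_le_iff₀ hb]
    exact mul_le_mul hab (le_max_right _ _) (norm_nonneg _) (norm_nonneg _)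
  have h3 : R / max R ‖x‖ * ‖x - y‖ ≤ 1 * ‖x - y‖ :=
    mul_le_mul_of_nonneg_right h1 (norm_nonneg _)
  have h4 : R / max R ‖x‖ * (|max R ‖y‖ - max R ‖x‖| / max R ‖y‖ * ‖y‖) ≤ 1 * ‖x - y‖ :=
    mul_le_mul h1 h2 (by positivity) zero_le_one
  push_cast
  rw [mul_assoc]
  linarith

theorem norm_le_gronwallBound_of_hasDerivWithinAt_Icc {x : ℝ → E} {x' : ℝ → E} {T K C : ℝ}
    (hK : 0 ≤ K) (hC : 0 ≤ C)
    (hx : ∀ t ∈ Icc (-T) T, HasDerivWithinAt x (x' t) (Icc (-T) T) t)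
    (hb : ∀ t ∈ Icc (-T) T, ‖x' t‖ ≤ K * ‖x t‖ + C) {t : ℝ} (ht : t ∈ Icc (-T) T) :
    ‖x t‖ ≤ gronwallBound ‖x 0‖ K C T := by
  have hT : 0 ≤ T := by linarith [ht.1, ht.2]
  have forward : ∀ (y y' : ℝ → E),
      (∀ t ∈ Icc (-T) T, HasDerivWithinAt y (y' t) (Icc (-T) T) t) →
      (∀ t ∈ Icc (-T) T, ‖y' t‖ ≤ K * ‖y t‖ + C) → ∀ t ∈ Icc 0 T,
      ‖y t‖ ≤ gronwallBound ‖y 0‖ K C T := by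
    intro y y' hy hyb t ht
    have hsub : Icc 0 T ⊆ Icc (-T) T := Icc_subset_Icc_left (by linarith)
    have := norm_le_gronwallBound_of_norm_deriv_right_le (f := y) (f' := y') (δ := ‖y 0‖)
      (K := K) (ε := C) (a := 0) (b := T)
      (fun s hs => ((hy s (hsub hs)).continuousWithinAt).mono hsub)
      (fun s hs => by
        have hs' : s ∈ Icc (-T) T := hsub (Ico_subset_Icc_self hs)
        refine (hy s hs').mono_of_mem_nhdsWithin ?_
        exact mem_of_superset (Icc_mem_nhdsGE hs.2) (Icc_subset_Icc_left hs'.1))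
      le_rfl (fun s hs => hyb s (hsub (Ico_subset_Icc_self hs))) t ht
    refine this.trans ?_
    rw [sub_zero]
    exact gronwallBound_mono (norm_nonneg _) hC hK ht.2
  rcases le_total 0 t with h | h
  · exact forward x x' hx hb t ⟨h, ht.2⟩
  -- Negative times reduce to the forward estimate by time reversal.
  · have hneg : ∀ s ∈ Icc (-T) T, -s ∈ Icc (-T) T := fun s hs =>
      ⟨by linarith [hs.2], by linarith [hs.1]⟩
    have := forward (fun s => x (-s)) (fun s => -x' (-s)) (fun s hs => by
      have h1 := (hx (-s) (hneg s hs)).scomp s (h := fun s => -s) (h' := -1)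
        ((hasDerivAt_neg s).hasDerivWithinAt (s := Icc (-T) T)) (fun u hu => hneg u hu)
      simpa [Function.comp_def] using h1)
      (fun s hs => by simpa using hb (-s) (hneg s hs)) (-t) ⟨by linarith, by linarith [ht.1]⟩
    simpa using this

variable [CompleteSpace E]

/-- Picard-Lindelöf on a prescribed interval needs a bounded field. The field is cut off by the
retraction onto a ball so large that, by Grönwall, the solution never leaves it. -/
theorem exists_solution_Icc {f : ℝ → E → E} (hcont : ∀ x, Continuous fun t => f t x)
    {T : ℝ} (hT : 0 ≤ T) {K : ℝ≥0} (hlip : ∀ t ∈ Icc (-T) T, LipschitzWith K (f t)) (x₀ : E) :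
    ∃ x : ℝ → E, x 0 = x₀ ∧
      ∀ t ∈ Icc (-T) T, HasDerivWithinAt x (f t (x t)) (Icc (-T) T) t := by
  obtain ⟨C, hC⟩ : ∃ C, ∀ t ∈ Icc (-T) T, ‖f t 0‖ ≤ C :=
    isCompact_Icc.exists_bound_of_continuousOn (hcont 0).continuousOn
  have h0mem : (0 : ℝ) ∈ Icc (-T) T := ⟨by linarith, hT⟩
  have hC0 : 0 ≤ C := (norm_nonneg _).trans (hC 0 h0mem)
  have hgrow : ∀ t ∈ Icc (-T) T, ∀ x, ‖f t x‖ ≤ K * ‖x‖ + C := by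
    intro t ht x
    have h1 := (hlip t ht).dist_le_mul x 0
    rw [dist_eq_norm, dist_eq_norm, sub_zero] at h1
    have h2 := norm_sub_norm_le (f t x) (f t 0)
    linarith [hC t ht]
  -- The a priori bound is computed from the linear growth of `f`, which the cut-off field shares;
  -- the maximum with 1 only ensures positivity.
  set R : ℝ := max 1 (gronwallBound ‖x₀‖ K C T) with hRdef
  have hR : 0 < R := lt_of_lt_of_le one_pos (le_max_left _ _)
  set L : ℝ≥0 := ⟨K * R + C, by positivity⟩ with hL
  have hPL : IsPicardLindelof (fun t x => f t (retract R x)) (⟨0, h0mem⟩ : Icc (-T) T) x₀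
      (L * ⟨T, hT⟩) 0 L (K * 2) :=
    { lipschitzOnWith := fun t ht => ((hlip t ht).comp (lipschitzWith_retract hR)).lipschitzOnWith
      continuousOn := fun x _ => (hcont _).continuousOn
      norm_le := fun t ht x _ => by
        refine (hgrow t ht _).trans ?_
        have := mul_le_mul_of_nonneg_left (norm_retract_le hR x) K.coe_nonneg
        show _ ≤ (K : ℝ) * R + C
        linarith
      mul_max_le := by
        simp only [sub_zero, zero_sub, neg_neg, max_self, NNReal.coe_zero]
        exact le_of_eq rfl }
  obtain ⟨x, hx0, hx⟩ := hPL.exists_eq_forall_mem_Icc_hasDerivWithinAt₀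
  refine ⟨x, hx0, fun t ht => ?_⟩
  have hbound := norm_le_gronwallBound_of_hasDerivWithinAt_Icc K.coe_nonneg hC0 hx
    (fun s hs => (hgrow s hs _).trans (by
      have := mul_le_mul_of_nonneg_left (norm_retract_le_norm hR (x s)) K.coe_nonneg
      linarith)) ht
  have hx0' : x 0 = x₀ := hx0
  rw [hx0'] at hbound
  have := hx t ht
  rwa [retract_of_norm_le hR (hbound.trans (le_max_right _ _))] at this

/-- A vector field that is continuous in time and Lipschitz in space, locally uniformly in time,
has a global integral curve through every point. -/
theorem exists_global_solution {f : ℝ → E → E} (hcont : ∀ x, Continuous fun t => f t x)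
    (hlip : ∀ T : ℝ, ∃ K : ℝ≥0, ∀ t ∈ Icc (-T) T, LipschitzWith K (f t)) (x₀ : E) :
    ∃ x : ℝ → E, x 0 = x₀ ∧ ∀ t, HasDerivAt x (f t (x t)) t := by
  have hex : ∀ n : ℕ, ∃ x : ℝ → E, x 0 = x₀ ∧
      ∀ t ∈ Icc (-((n : ℝ) + 1)) ((n : ℝ) + 1),
        HasDerivWithinAt x (f t (x t)) (Icc (-((n : ℝ) + 1)) ((n : ℝ) + 1)) t := by
    intro n
    obtain ⟨K, hK⟩ := hlip ((n : ℝ) + 1)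
    exact exists_solution_Icc hcont (by positivity) hK x₀
  choose α hα0 hα using hex
  have hderiv : ∀ (n : ℕ) (t : ℝ), t ∈ Ioo (-((n : ℝ) + 1)) ((n : ℝ) + 1) →
      HasDerivAt (α n) (f t (α n t)) t := fun n t ht =>
    (hα n t (Ioo_subset_Icc_self ht)).hasDerivAt (Icc_mem_nhds ht.1 ht.2)
  have hagree : ∀ m n : ℕ, m ≤ n → EqOn (α m) (α n) (Ioo (-((m : ℝ) + 1)) ((m : ℝ) + 1)) := by
    intro m n hmn
    obtain ⟨K, hK⟩ := hlip ((m : ℝ) + 1)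
    have hmn' : (m : ℝ) ≤ n := by exact_mod_cast hmn
    have hm : (0 : ℝ) ≤ m := by positivity
    refine ODE_solution_unique_of_mem_Ioo (v := f) (s := fun _ => univ) (K := K) (t₀ := 0)
      (fun t ht => (hK t (Ioo_subset_Icc_self ht)).lipschitzOnWith)
      ⟨by linarith, by linarith⟩ (fun t ht => ⟨hderiv m t ht, mem_univ _⟩)
      (fun t ht => ⟨hderiv n t ⟨by linarith [ht.1], by linarith [ht.2]⟩, mem_univ _⟩) ?_
    rw [hα0, hα0]
  have hmem : ∀ t : ℝ, t ∈ Ioo (-((⌈|t|⌉₊ : ℝ) + 1)) ((⌈|t|⌉₊ : ℝ) + 1) := by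
    intro t
    have := Nat.le_ceil |t|
    have h1 := abs_le.1 this
    constructor <;> linarith [h1.1, h1.2]
  -- The index jumps with `t`, but near `t` it is at most `⌈|t|⌉₊ + 1`, so locally the glued curve
  -- coincides with that single solution.
  refine ⟨fun t => α ⌈|t|⌉₊ t, by simp [hα0], fun t => ?_⟩
  have hev : (fun s => α ⌈|s|⌉₊ s) =ᶠ[𝓝 t] α (⌈|t|⌉₊ + 1) := by
    filter_upwards [Ioo_mem_nhds (hmem t).1 (hmem t).2] with s hs
    have hs' : ⌈|s|⌉₊ ≤ ⌈|t|⌉₊ + 1 := by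
      refine Nat.ceil_le.2 (abs_le.2 ?_)
      push_cast
      exact ⟨hs.1.le, hs.2.le⟩
    exact hagree _ _ hs' (hmem s)
  have h := hderiv (⌈|t|⌉₊ + 1) t (by
    have := hmem t
    push_cast
    exact ⟨by linarith [this.1], by linarith [this.2]⟩)
  rw [← hev.eq_of_nhds] at h
  exact h.congr_of_eventuallyEq hev

end ODE

end SpinEgorov

namespace SpinEgorov

open Set Filter Topology

/-! ### Summability of interaction potentials -/

section Potential

theorem degree_eq_sum_siteDegree {X : Type*} [Fintype X] (α : MultiIndex X) :
    α.degree = ∑ x, siteDegree α x := by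
  rw [Finsupp.degree_eq_sum, Fintype.sum_prod_type_right]
  rfl

theorem siteDegree_le_degree {X : Type*} [Fintype X] (α : MultiIndex X) (x : X) :
    siteDegree α x ≤ α.degree := by
  rw [degree_eq_sum_siteDegree]
  exact Finset.single_le_sum (f := fun y => siteDegree α y) (fun _ _ => Nat.zero_le _)
    (Finset.mem_univ x)

/-- `W` is a potential on the finite set `X` of sites with
`sup_{x,t} ∑_{|β| = n} |β(x)| |W(t, β)| e^n ≤ v n` and `∑ v n < ∞`. -/
structure IsBoundedPotential {X : Type*} (W : ℝ → MultiIndex X → ℂ) (v : ℕ → ℝ) : Prop where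
  continuous : ∀ β, Continuous fun t => W t β
  nonneg : ∀ n, 0 ≤ v n
  summable : Summable v
  sum_le : ∀ (n : ℕ) (x : X) (t : ℝ) (s : Finset (MultiIndex X)), (∀ β ∈ s, β.degree = n) →
    ∑ β ∈ s, (siteDegree β x : ℝ) * ‖W t β‖ * Real.exp n ≤ v n

theorem extendIndex_injective {L : Type*} (Λ : Finset L) :
    Function.Injective (extendIndex Λ) :=
  Finsupp.mapDomain_injective
    (Function.Injective.prodMap Function.injective_id Subtype.val_injective)

theorem degree_extendIndex {L : Type*} (Λ : Finset L) (α : MultiIndex Λ) :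
    (extendIndex Λ α).degree = α.degree :=
  Finsupp.degree_mapDomain _ _

theorem siteDegree_extendIndex {L : Type*} (Λ : Finset L) (α : MultiIndex Λ) (x : Λ) :
    siteDegree (extendIndex Λ α) x.1 = siteDegree α x := by
  refine Finset.sum_congr rfl fun i _ => ?_
  exact Finsupp.mapDomain_apply
    (Function.Injective.prodMap Function.injective_id Subtype.val_injective) α (i, x)

/-- A potential of finite norm restricts to bounded potentials, uniformly in the volume. -/
theorem exists_isBoundedPotential {L : Type*} {V : ℝ → MultiIndex L → ℂ}
    (hnorm : potentialNorm V < ⊤) (hcont : ∀ α, Continuous fun t => V t α) :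
    ∃ v : ℕ → ℝ, ∀ Λ : Finset L,
      IsBoundedPotential (fun t (β : MultiIndex Λ) => V t (extendIndex Λ β)) v := by
  -- The bound is read off on all of `L`; every finite volume sees only a part of these sums, so one
  -- `v` serves all of them.
  set w : ℕ → ENNReal := fun n => ⨆ (x : L) (t : ℝ), ∑' α : {α : MultiIndex L // α.degree = n},
    (siteDegree α.1 x : ENNReal) * ‖V t α.1‖ₑ * ENNReal.ofReal (Real.exp n) with hw
  have hsum : ∑' n, w n ≠ ⊤ := hnorm.ne
  have hfin : ∀ n, w n ≠ ⊤ := ENNReal.ne_top_of_tsum_ne_top hsum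
  refine ⟨fun n => (w n).toReal, fun Λ => ⟨fun β => hcont _, fun n => ENNReal.toReal_nonneg,
    ENNReal.summable_toReal hsum, fun n x t s hs => ?_⟩⟩
  rw [← ENNReal.ofReal_le_iff_le_toReal (hfin n), ENNReal.ofReal_sum_of_nonneg
    (fun β _ => by positivity)]
  have hterm : ∀ β ∈ s, ENNReal.ofReal ((siteDegree β x : ℝ) * ‖V t (extendIndex Λ β)‖ *
      Real.exp n) = (siteDegree (extendIndex Λ β) x.1 : ENNReal) * ‖V t (extendIndex Λ β)‖ₑ *
        ENNReal.ofReal (Real.exp n) := by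
    intro β _
    rw [ENNReal.ofReal_mul (by positivity), ENNReal.ofReal_mul (by positivity),
      ENNReal.ofReal_natCast, ofReal_norm, siteDegree_extendIndex]
  rw [Finset.sum_congr rfl hterm]
  have hle : ∑' α : {α : MultiIndex L // α.degree = n},
      (siteDegree α.1 x.1 : ENNReal) * ‖V t α.1‖ₑ * ENNReal.ofReal (Real.exp n) ≤ w n :=
    le_iSup₂_of_le x.1 t le_rfl
  refine le_trans ?_ hle
  rw [← Finset.sum_attach]
  let g : {β // β ∈ s} → {α : MultiIndex L // α.degree = n} := fun β =>
    ⟨extendIndex Λ β.1, by rw [degree_extendIndex]; exact hs _ β.2⟩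
  have hg : Function.Injective g := fun a b hab =>
    Subtype.ext (extendIndex_injective Λ (congrArg Subtype.val hab))
  have h1 : ∑ β ∈ s.attach, (siteDegree (extendIndex Λ β.1) x.1 : ENNReal) *
      ‖V t (extendIndex Λ β.1)‖ₑ * ENNReal.ofReal (Real.exp n) =
      ∑ α ∈ s.attach.map ⟨g, hg⟩,
        (siteDegree α.1 x.1 : ENNReal) * ‖V t α.1‖ₑ * ENNReal.ofReal (Real.exp n) := by
    rw [Finset.sum_map]
    rfl
  rw [h1]
  exact ENNReal.sum_le_tsum _

namespace IsBoundedPotential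

variable {X : Type*} {W : ℝ → MultiIndex X → ℂ} {v : ℕ → ℝ}

theorem sum_le_tsum (hW : IsBoundedPotential W v) (x : X) (t : ℝ) (s : Finset (MultiIndex X)) :
    ∑ β ∈ s, (siteDegree β x : ℝ) * ‖W t β‖ * Real.exp β.degree ≤ ∑' n, v n := by
  classical
  rw [← Finset.sum_fiberwise_of_maps_to (t := s.image Finsupp.degree) (g := Finsupp.degree)
    (fun β hβ => Finset.mem_image_of_mem _ hβ)]
  refine le_trans (Finset.sum_le_sum (g := v) fun n _ => ?_)
    (hW.summable.sum_le_tsum _ fun n _ => hW.nonneg n)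
  have := hW.sum_le n x t (s.filter fun β => β.degree = n) fun β hβ => (Finset.mem_filter.1 hβ).2
  refine le_trans (le_of_eq (Finset.sum_congr rfl fun β hβ => ?_)) this
  rw [(Finset.mem_filter.1 hβ).2]

theorem tsum_nonneg (hW : IsBoundedPotential W v) : 0 ≤ ∑' n, v n := _root_.tsum_nonneg hW.nonneg

theorem summable_site (hW : IsBoundedPotential W v) (x : X) (t : ℝ) :
    Summable fun β => (siteDegree β x : ℝ) * ‖W t β‖ * Real.exp β.degree :=
  summable_of_sum_le (fun _ => by positivity) (hW.sum_le_tsum x t)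

theorem tsum_site_le (hW : IsBoundedPotential W v) (x : X) (t : ℝ) :
    ∑' β, (siteDegree β x : ℝ) * ‖W t β‖ * Real.exp β.degree ≤ ∑' n, v n :=
  (hW.summable_site x t).tsum_le_of_sum_le (hW.sum_le_tsum x t)

variable [Fintype X]

/-- For `n ≥ 1` the site degrees add up to at least 1, so summing the one-site bounds over all sites
controls the unweighted sum. The resulting factor `|X|` is harmless: it enters only convergence and
continuity, never the final constants. -/
theorem sum_norm_le_of_degree (hW : IsBoundedPotential W v) {n : ℕ} (hn : n ≠ 0) (t : ℝ)
    (s : Finset (MultiIndex X)) (hs : ∀ β ∈ s, β.degree = n) :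
    ∑ β ∈ s, ‖W t β‖ * Real.exp n ≤ Fintype.card X * v n := by
  have h1 : ∀ β ∈ s, ‖W t β‖ * Real.exp n ≤
      ∑ x, (siteDegree β x : ℝ) * ‖W t β‖ * Real.exp n := by
    intro β hβ
    rw [← Finset.sum_mul, ← Finset.sum_mul, ← Nat.cast_sum, ← degree_eq_sum_siteDegree, hs β hβ,
      mul_assoc]
    refine le_mul_of_one_le_left (by positivity) ?_
    exact_mod_cast Nat.one_le_iff_ne_zero.2 hn
  refine (Finset.sum_le_sum h1).trans ?_
  rw [Finset.sum_comm]
  refine (Finset.sum_le_sum fun x _ => hW.sum_le n x t s hs).trans ?_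
  simp

theorem sum_norm_le (hW : IsBoundedPotential W v) (t : ℝ) (s : Finset (MultiIndex X))
    (hs : 0 ∉ s) :
    ∑ β ∈ s, ‖W t β‖ * Real.exp β.degree ≤ Fintype.card X * ∑' n, v n := by
  classical
  rw [← Finset.sum_fiberwise_of_maps_to (t := s.image Finsupp.degree) (g := Finsupp.degree)
    (fun β hβ => Finset.mem_image_of_mem _ hβ), ← tsum_mul_left]
  refine le_trans (Finset.sum_le_sum (g := fun n => Fintype.card X * v n) fun n hn => ?_)
    ((hW.summable.mul_left _).sum_le_tsum _ fun n _ => mul_nonneg (by positivity) (hW.nonneg n))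
  have hn0 : n ≠ 0 := by
    rintro rfl
    obtain ⟨β, hβ, h0⟩ := Finset.mem_image.1 hn
    exact hs ((Finsupp.degree_eq_zero_iff β).1 h0 ▸ hβ)
  have := hW.sum_norm_le_of_degree hn0 t (s.filter fun β => β.degree = n)
    fun β hβ => (Finset.mem_filter.1 hβ).2
  refine le_trans (le_of_eq (Finset.sum_congr rfl fun β hβ => ?_)) this
  rw [(Finset.mem_filter.1 hβ).2]

theorem summable_norm_exp (hW : IsBoundedPotential W v) (t : ℝ) :
    Summable fun β => ‖W t β‖ * Real.exp β.degree := by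
  classical
  refine summable_of_sum_le (c := ‖W t 0‖ + Fintype.card X * ∑' n, v n)
    (fun _ => by positivity) fun s => ?_
  have h1 : ∑ β ∈ s, ‖W t β‖ * Real.exp β.degree ≤
      ∑ β ∈ insert 0 (s.erase 0), ‖W t β‖ * Real.exp β.degree := by
    refine Finset.sum_le_sum_of_subset_of_nonneg (fun β hβ => ?_) fun _ _ _ => by positivity
    by_cases h : β = 0 <;> simp [h, hβ]
  refine h1.trans ?_
  rw [Finset.sum_insert (Finset.notMem_erase 0 s)]
  have := hW.sum_norm_le t (s.erase 0) (Finset.notMem_erase 0 s)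
  simpa using this

variable {E : Type*} [NormedAddCommGroup E] [NormedSpace ℂ E] {c : MultiIndex X → E} {κ : ℝ}

theorem summable_norm_smul (hW : IsBoundedPotential W v)
    (hc : ∀ β, ‖c β‖ ≤ κ * Real.exp β.degree) (t : ℝ) :
    Summable fun β => ‖W t β • c β‖ := by
  refine Summable.of_nonneg_of_le (fun _ => norm_nonneg _) (fun β => ?_)
    ((hW.summable_norm_exp t).mul_left κ)
  rw [norm_smul]
  calc ‖W t β‖ * ‖c β‖ ≤ ‖W t β‖ * (κ * Real.exp β.degree) :=
        mul_le_mul_of_nonneg_left (hc β) (norm_nonneg _)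
    _ = _ := by ring

variable [CompleteSpace E]

theorem summable_smul (hW : IsBoundedPotential W v)
    (hc : ∀ β, ‖c β‖ ≤ κ * Real.exp β.degree) (t : ℝ) :
    Summable fun β => W t β • c β :=
  (hW.summable_norm_smul hc t).of_norm

/-- After grouping by degree each block is a finite continuous sum, and the blocks are dominated
uniformly in `t` because the supremum over time stands inside the sum over degrees. This is the
Weierstrass test. -/
theorem continuous_tsum_smul_of_zero (hW : IsBoundedPotential W v) (hκ : 0 ≤ κ)
    (hc : ∀ β, ‖c β‖ ≤ κ * Real.exp β.degree) (h0 : c 0 = 0) :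
    Continuous fun t => ∑' β, W t β • c β := by
  have hfib : ∀ t, ∑' β, W t β • c β =
      ∑' n : ℕ, ∑' β : (Finsupp.degree : MultiIndex X → ℕ) ⁻¹' {n}, W t β.1 • c β.1 := fun t =>
    ((hW.summable_smul hc t).hasSum.tsum_fiberwise Finsupp.degree).tsum_eq.symm
  simp_rw [hfib]
  have hfin : ∀ n : ℕ, Finite ((Finsupp.degree : MultiIndex X → ℕ) ⁻¹' {n}) := fun n =>
    (Finsupp.finite_of_degree_eq n).to_subtype
  have := fun n => Fintype.ofFinite ((Finsupp.degree : MultiIndex X → ℕ) ⁻¹' {n})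
  simp_rw [tsum_fintype]
  refine continuous_tsum (u := fun n => κ * (Fintype.card X * v n))
    (fun n => continuous_finsetSum _ fun β _ => (hW.continuous _).smul continuous_const)
    ((hW.summable.mul_left _).mul_left _) fun n t => ?_
  rcases eq_or_ne n 0 with rfl | hn
  · rw [Finset.sum_eq_zero, norm_zero]
    · exact mul_nonneg hκ (mul_nonneg (by positivity) (hW.nonneg 0))
    · rintro ⟨β, hβ⟩ -
      have : β = 0 := (Finsupp.degree_eq_zero_iff β).1 hβ
      simp [this, h0]
  · have h1 := hW.sum_norm_le_of_degree hn t
      (Finset.univ.map ⟨Subtype.val, Subtype.val_injective (p := (· ∈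
        (Finsupp.degree : MultiIndex X → ℕ) ⁻¹' {n}))⟩) (by
        intro β hβ
        obtain ⟨γ, -, rfl⟩ := Finset.mem_map.1 hβ
        exact γ.2)
    rw [Finset.sum_map] at h1
    refine (norm_sum_le _ _).trans (le_trans ?_ (mul_le_mul_of_nonneg_left h1 hκ))
    rw [Finset.mul_sum]
    refine Finset.sum_le_sum fun β _ => ?_
    have hβ : β.1.degree = n := β.2
    have h2 := hc β.1
    rw [hβ] at h2
    rw [norm_smul]
    calc ‖W t β.1‖ * ‖c β.1‖ ≤ ‖W t β.1‖ * (κ * Real.exp n) :=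
          mul_le_mul_of_nonneg_left h2 (norm_nonneg _)
      _ = _ := by simp only [Function.Embedding.coeFn_mk]; ring

/-- Sums `∑_β W(t, β) c_β` with `c_β = O(e^{|β|})` are continuous in `t`. -/
theorem continuous_tsum_smul (hW : IsBoundedPotential W v)
    (hc : ∀ β, ‖c β‖ ≤ κ * Real.exp β.degree) :
    Continuous fun t => ∑' β, W t β • c β := by
  classical
  have hκ : 0 ≤ κ := by
    have := (norm_nonneg _).trans (hc 0)
    simpa using this
  -- The constant term has site degree 0 everywhere, so the norm does not see it; its continuity
  -- comes from the hypothesis on single coefficients.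
  have hsplit : ∀ t, ∑' β, W t β • c β =
      W t 0 • c 0 + ∑' β, W t β • (if β = 0 then 0 else c β) := by
    intro t
    rw [(hW.summable_smul hc t).tsum_eq_add_tsum_ite 0]
    congr 1
    refine tsum_congr fun β => ?_
    split_ifs <;> simp
  simp_rw [hsplit]
  refine ((hW.continuous 0).smul continuous_const).add
    (hW.continuous_tsum_smul_of_zero hκ (fun β => ?_) (by simp))
  split_ifs
  · simpa using mul_nonneg hκ (Real.exp_pos _).le
  · exact hc β

end IsBoundedPotential

end Potential

end SpinEgorov

namespace SpinEgorov

open MvPolynomial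

/-! ### Linear functionals and the coefficient norm on polynomials -/

section Observe

variable {σ : Type*} {E : Type*} [NormedAddCommGroup E] [NormedSpace ℂ E]

/-- The linear map with prescribed values on the monomials. -/
noncomputable def observe (m : (σ →₀ ℕ) → E) : MvPolynomial σ ℂ →ₗ[ℂ] E :=
  (basisMonomials σ ℂ).constr ℂ m

theorem observe_monomial (m : (σ →₀ ℕ) → E) (γ : σ →₀ ℕ) (c : ℂ) :
    observe m (monomial γ c) = c • m γ := by
  have h : monomial γ c = c • (basisMonomials σ ℂ) γ := by
    rw [coe_basisMonomials, smul_monomial, smul_eq_mul, mul_one]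
  rw [h, map_smul, observe, Module.Basis.constr_basis]

theorem observe_apply (m : (σ →₀ ℕ) → E) (A : MvPolynomial σ ℂ) :
    observe m A = ∑ γ ∈ A.support, A.coeff γ • m γ := by
  conv_lhs => rw [A.as_sum, map_sum]
  exact Finset.sum_congr rfl fun γ _ => observe_monomial m γ _

theorem observe_eq_sum_of_subset (m : (σ →₀ ℕ) → E) (A : MvPolynomial σ ℂ)
    {s : Finset (σ →₀ ℕ)} (hs : A.support ⊆ s) : observe m A = ∑ γ ∈ s, A.coeff γ • m γ := by
  rw [observe_apply]
  refine Finset.sum_subset hs fun γ _ hγ => ?_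
  rw [notMem_support_iff.1 hγ, zero_smul]

/-- The sum of the absolute values of the coefficients. -/
noncomputable def coeffNorm (A : MvPolynomial σ ℂ) : ℝ := ∑ γ ∈ A.support, ‖A.coeff γ‖

theorem coeffNorm_eq_sum_of_subset {A : MvPolynomial σ ℂ} {s : Finset (σ →₀ ℕ)}
    (hs : A.support ⊆ s) : coeffNorm A = ∑ γ ∈ s, ‖A.coeff γ‖ := by
  refine Finset.sum_subset hs fun γ _ hγ => ?_
  rw [notMem_support_iff.1 hγ, norm_zero]

theorem coeffNorm_add_le (A B : MvPolynomial σ ℂ) :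
    coeffNorm (A + B) ≤ coeffNorm A + coeffNorm B := by
  classical
  rw [coeffNorm_eq_sum_of_subset (s := A.support ∪ B.support) support_add,
    coeffNorm_eq_sum_of_subset (A := A) (s := A.support ∪ B.support) Finset.subset_union_left,
    coeffNorm_eq_sum_of_subset (A := B) (s := A.support ∪ B.support) Finset.subset_union_right,
    ← Finset.sum_add_distrib]
  refine Finset.sum_le_sum fun γ _ => ?_
  rw [coeff_add]
  exact norm_add_le _ _

theorem coeffNorm_monomial_le (γ : σ →₀ ℕ) (c : ℂ) : coeffNorm (monomial γ c) ≤ ‖c‖ := by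
  classical
  rw [coeffNorm_eq_sum_of_subset (s := {γ}) support_monomial_subset]
  simp

theorem norm_coeff_le_coeffNorm (A : MvPolynomial σ ℂ) (γ : σ →₀ ℕ) :
    ‖A.coeff γ‖ ≤ coeffNorm A := by
  by_cases h : γ ∈ A.support
  · exact Finset.single_le_sum (f := fun γ => ‖A.coeff γ‖) (fun _ _ => norm_nonneg _) h
  · rw [notMem_support_iff.1 h, norm_zero]
    exact Finset.sum_nonneg fun _ _ => norm_nonneg _

theorem coeffNorm_nonneg (A : MvPolynomial σ ℂ) : 0 ≤ coeffNorm A :=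
  Finset.sum_nonneg fun _ _ => norm_nonneg _

end Observe

/-! ### Words and formal expansions -/

section Words

variable {X : Type*}

theorem coe_toMultiset_degree {σ : Type*} (α : σ →₀ ℕ) : α.toMultiset.card = α.degree := by
  rw [Finsupp.card_toMultiset, Finsupp.degree_apply]
  rfl

theorem sum_map_toMultiset {σ M : Type*} [AddCommMonoid M] (α : σ →₀ ℕ) (f : σ → M) :
    (α.toMultiset.map f).sum = α.sum fun a k => k • f a := by
  classical
  induction α using Finsupp.induction_linear with
  | zero => simp
  | add a b ha hb =>
    rw [map_add, Multiset.map_add, Multiset.sum_add, ha, hb, Finsupp.sum_add_index']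
    · simp
    · intro a b c
      exact add_smul _ _ _
  | single a k =>
    rw [Finsupp.toMultiset_single, Multiset.map_nsmul, Multiset.sum_nsmul]
    simp

theorem prod_map_toMultiset {σ M : Type*} [CommMonoid M] (α : σ →₀ ℕ) (f : σ → M) :
    (α.toMultiset.map f).prod = α.prod fun a k => f a ^ k := by
  classical
  induction α using Finsupp.induction_linear with
  | zero => simp
  | add a b ha hb =>
    rw [map_add, Multiset.map_add, Multiset.prod_add, ha, hb, Finsupp.prod_add_index']
    · simp
    · intro a b c
      exact pow_add _ _ _
  | single a k =>
    rw [Finsupp.toMultiset_single, Multiset.map_nsmul, Multiset.prod_nsmul]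
    simp

/-- The value of the word `w` of variables in a ring. -/
def wordProd {σ 𝒜 : Type*} [Monoid 𝒜] (S : σ → 𝒜) (w : List σ) : 𝒜 := (w.map S).prod

theorem wordProd_cons {σ 𝒜 : Type*} [Monoid 𝒜] (S : σ → 𝒜) (p : σ) (w : List σ) :
    wordProd S (p :: w) = S p * wordProd S w := by
  simp [wordProd]

theorem wordProd_append {σ 𝒜 : Type*} [Monoid 𝒜] (S : σ → 𝒜) (u w : List σ) :
    wordProd S (u ++ w) = wordProd S u * wordProd S w := by
  simp [wordProd]

theorem wordProd_X {σ : Type*} {w : List σ} {α : σ →₀ ℕ} (h : (w : Multiset σ) = α.toMultiset) :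
    wordProd (fun p => (MvPolynomial.X p : MvPolynomial σ ℂ)) w = monomial α 1 := by
  rw [wordProd, ← Multiset.prod_coe, ← Multiset.map_coe, h, monomial_eq, C_1, one_mul,
    prod_map_toMultiset]

/-- A formal linear combination of words. -/
abbrev Expansion (σ : Type*) := List (ℂ × List σ)

/-- The value of an expansion in an algebra. -/
def Expansion.eval {σ 𝒜 : Type*} [Ring 𝒜] [Algebra ℂ 𝒜] (S : σ → 𝒜) (f : Expansion σ) : 𝒜 :=
  (f.map fun t => t.1 • wordProd S t.2).sum

/-- The sum of the absolute values of the coefficients of an expansion. -/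
noncomputable def Expansion.size {σ : Type*} (f : Expansion σ) : ℝ := (f.map fun t => ‖t.1‖).sum

/-- Multiplication of an expansion by words on both sides. -/
def Expansion.sandwich {σ : Type*} (a b : List σ) (f : Expansion σ) : Expansion σ :=
  f.map fun t => (t.1, a ++ t.2 ++ b)

section

variable {σ 𝒜 : Type*} [Ring 𝒜] [Algebra ℂ 𝒜] (S : σ → 𝒜)

theorem Expansion.eval_append (f g : Expansion σ) :
    Expansion.eval S (f ++ g) = Expansion.eval S f + Expansion.eval S g := by
  simp [Expansion.eval]

theorem Expansion.eval_sandwich (a b : List σ) (f : Expansion σ) :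
    Expansion.eval S (f.sandwich a b) = wordProd S a * Expansion.eval S f * wordProd S b := by
  simp only [Expansion.eval, Expansion.sandwich, List.map_map]
  rw [← List.sum_map_mul_left, ← List.sum_map_mul_right]
  congr 2
  funext t
  simp [wordProd_append, mul_assoc]

theorem Expansion.size_append (f g : Expansion σ) :
    Expansion.size (f ++ g) = f.size + g.size := by
  simp [Expansion.size]

theorem Expansion.size_sandwich (a b : List σ) (f : Expansion σ) :
    (f.sandwich a b).size = f.size := by
  simp [Expansion.size, Expansion.sandwich, Function.comp_def]

end

/-! ### Poisson brackets -/

/-- The Poisson bracket `{M_i(x), M_j(y)} = i δ(x, y) ∑_k ε̃_{ijk} M_k(x)` as an expansion. -/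
noncomputable def letterBracket [DecidableEq X] (p q : Idx × X) : Expansion (Idx × X) :=
  if p.2 = q.2 then
    [Idx.plus, Idx.z, Idx.minus].map fun k => (Complex.I * (eps p.1 q.1 k : ℂ), [(k, p.2)])
  else []

/-- The expansion of the bracket of a letter with a word by the Leibniz rule. -/
noncomputable def letterWordBracket [DecidableEq X] (p : Idx × X) :
    List (Idx × X) → Expansion (Idx × X)
  | [] => []
  | q :: w => (letterBracket p q).sandwich [] w ++ (letterWordBracket p w).sandwich [q] []

/-- The expansion of the bracket of two words by the Leibniz rule. -/
noncomputable def wordBracket [DecidableEq X] :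
    List (Idx × X) → List (Idx × X) → Expansion (Idx × X)
  | [], _ => []
  | p :: u, w => (letterWordBracket p w).sandwich [] u ++ (wordBracket u w).sandwich [p] []

/-- Any biderivation that agrees with `letterBracket` on letters is given by `wordBracket`. -/
theorem eval_wordBracket [DecidableEq X] {𝒜 : Type*} [Ring 𝒜] [Algebra ℂ 𝒜] (S : Idx × X → 𝒜)
    (B : 𝒜 → 𝒜 → 𝒜) (hl : ∀ a a' b, B (a * a') b = B a b * a' + a * B a' b)
    (hr : ∀ a b b', B a (b * b') = B a b * b' + b * B a b') (h1 : ∀ b, B 1 b = 0)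
    (h1' : ∀ a, B a 1 = 0) (hS : ∀ p q, B (S p) (S q) = (letterBracket p q).eval S)
    (u w : List (Idx × X)) :
    (wordBracket u w).eval S = B (wordProd S u) (wordProd S w) := by
  have hletter : ∀ (p : Idx × X) (w : List (Idx × X)),
      (letterWordBracket p w).eval S = B (S p) (wordProd S w) := by
    intro p w
    induction w with
    | nil => simp [letterWordBracket, Expansion.eval, wordProd, h1']
    | cons q w ih =>
      rw [letterWordBracket, Expansion.eval_append, Expansion.eval_sandwich,
        Expansion.eval_sandwich, ih, ← hS, wordProd_cons S q w, hr]
      simp [wordProd]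
  induction u with
  | nil => simp [wordBracket, Expansion.eval, wordProd, h1]
  | cons p u ih =>
    rw [wordBracket, Expansion.eval_append, Expansion.eval_sandwich, Expansion.eval_sandwich,
      ih, hletter, wordProd_cons S p u, hl]
    simp [wordProd]

/-- For given `i, j` at most one `k` has a nonzero structure constant, and that one is `±1`. -/
theorem size_letterBracket_le [DecidableEq X] (p q : Idx × X) :
    (letterBracket p q).size ≤ if p.2 = q.2 then 1 else 0 := by
  obtain ⟨i, x⟩ := p
  obtain ⟨j, y⟩ := q
  simp only [letterBracket]
  split_ifs
  · cases i <;> cases j <;> simp [Expansion.size, eps]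
  · simp [Expansion.size]

/-- The Leibniz rule produces one letter bracket for each pair of letters, and surrounding a term
with further letters leaves its coefficient unchanged. -/
theorem size_wordBracket_le [DecidableEq X] (u w : List (Idx × X)) :
    (wordBracket u w).size ≤
      (u.map fun p => (w.map fun q => if p.2 = q.2 then (1 : ℝ) else 0).sum).sum := by
  have hletter : ∀ (p : Idx × X) (w : List (Idx × X)), (letterWordBracket p w).size ≤
      (w.map fun q => if p.2 = q.2 then (1 : ℝ) else 0).sum := by
    intro p w
    induction w with
    | nil => simp [letterWordBracket, Expansion.size]
    | cons q w ih =>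
      rw [letterWordBracket, Expansion.size_append, Expansion.size_sandwich,
        Expansion.size_sandwich, List.map_cons, List.sum_cons]
      exact add_le_add (size_letterBracket_le p q) ih
  induction u with
  | nil => simp [wordBracket, Expansion.size]
  | cons p u ih =>
    rw [wordBracket, Expansion.size_append, Expansion.size_sandwich,
      Expansion.size_sandwich, List.map_cons, List.sum_cons]
    exact add_le_add (hletter p w) ih

/-- Each term replaces two letters by one. This homogeneity later lets the weight `z^|γ|` be pulled
out of a bracket. -/
theorem length_of_mem_wordBracket [DecidableEq X] {u w : List (Idx × X)} {t : ℂ × List (Idx × X)}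
    (ht : t ∈ wordBracket u w) : t.2.length + 1 = u.length + w.length := by
  have hletter : ∀ (p : Idx × X) (w : List (Idx × X)) (t : ℂ × List (Idx × X)),
      t ∈ letterWordBracket p w → t.2.length = w.length := by
    intro p w
    induction w with
    | nil => simp [letterWordBracket]
    | cons q w ih =>
      intro t ht
      rw [letterWordBracket, List.mem_append] at ht
      rcases ht with ht | ht
      · obtain ⟨t', ht', rfl⟩ := List.mem_map.1 ht
        have : t'.2.length = 1 := by
          simp only [letterBracket] at ht'
          split_ifs at ht'
          · obtain ⟨k, -, rfl⟩ := List.mem_map.1 ht'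
            rfl
          · simp at ht'
        simp [this]
        omega
      · obtain ⟨t', ht', rfl⟩ := List.mem_map.1 ht
        simp [ih t' ht']
  induction u generalizing t with
  | nil => simp [wordBracket] at ht
  | cons p u ih =>
    rw [wordBracket, List.mem_append] at ht
    rcases ht with ht | ht
    · obtain ⟨t', ht', rfl⟩ := List.mem_map.1 ht
      have := hletter p w t' ht'
      simp [this]
      omega
    · obtain ⟨t', ht', rfl⟩ := List.mem_map.1 ht
      have := ih ht'
      simp
      omega

/-- The Poisson bracket of two polynomials. -/
noncomputable def poisson [DecidableEq X] [Fintype X] (A B : MvPolynomial (Idx × X) ℂ) :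
    MvPolynomial (Idx × X) ℂ :=
  ∑ p, ∑ q, pderiv p A * pderiv q B * (letterBracket p q).eval MvPolynomial.X

/-- The Poisson bracket `{M^β, M^α}`. -/
noncomputable def monomialBracket [DecidableEq X] [Fintype X] (β α : MultiIndex X) :
    MvPolynomial (Idx × X) ℂ :=
  poisson (monomial β 1) (monomial α 1)

/-- `∑_x |β(x)| |α(x)|`. -/
def overlap [Fintype X] (β α : MultiIndex X) : ℕ := ∑ x, siteDegree β x * siteDegree α x

theorem overlap_le [Fintype X] (β α : MultiIndex X) : overlap β α ≤ β.degree * α.degree := by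
  rw [degree_eq_sum_siteDegree α, Finset.mul_sum]
  exact Finset.sum_le_sum fun x _ => Nat.mul_le_mul_right _ (siteDegree_le_degree β x)

/-! ### Size and degree of brackets of monomials -/

section

variable [DecidableEq X] [Fintype X]

theorem poisson_X_X (p q : Idx × X) :
    poisson (MvPolynomial.X p) (MvPolynomial.X q) = (letterBracket p q).eval MvPolynomial.X := by
  rw [poisson, Finset.sum_eq_single p, Finset.sum_eq_single q]
  · simp
  · intro q' _ hq'
    simp [pderiv_X_of_ne hq'.symm]
  · simp
  · intro p' _ hp'
    simp [pderiv_X_of_ne hp'.symm]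
  · simp

/-- The Poisson bracket is a biderivation because partial derivatives are derivations. This is the
commutative reading of the expansion. -/
theorem eval_wordBracket_X (u w : List (Idx × X)) :
    (wordBracket u w).eval MvPolynomial.X =
      poisson (wordProd MvPolynomial.X u) (wordProd MvPolynomial.X w) := by
  refine eval_wordBracket _ poisson ?_ ?_ ?_ ?_ poisson_X_X u w
  · intro a a' b
    simp only [poisson, Derivation.leibniz, smul_eq_mul, Finset.sum_mul, Finset.mul_sum,
      ← Finset.sum_add_distrib]
    refine Finset.sum_congr rfl fun p _ => Finset.sum_congr rfl fun q _ => ?_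
    ring
  · intro a a' b
    simp only [poisson, Derivation.leibniz, smul_eq_mul, Finset.sum_mul, Finset.mul_sum,
      ← Finset.sum_add_distrib]
    refine Finset.sum_congr rfl fun p _ => Finset.sum_congr rfl fun q _ => ?_
    ring
  · intro b
    simp [poisson]
  · intro a
    simp [poisson]

/-- Different words may give the same commutative monomial, and collecting them can only produce
cancellation. -/
theorem coeffNorm_eval_le {σ : Type*} (f : Expansion σ) :
    coeffNorm (f.eval (MvPolynomial.X : σ → MvPolynomial σ ℂ)) ≤ f.size := by
  classical
  induction f with
  | nil => simp [Expansion.eval, Expansion.size, coeffNorm]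
  | cons t f ih =>
    simp only [Expansion.eval, Expansion.size, List.map_cons, List.sum_cons]
    refine (coeffNorm_add_le _ _).trans (add_le_add ?_ ih)
    rw [wordProd_X (α := Multiset.toFinsupp (t.2 : Multiset σ)) (by simp), smul_monomial,
      smul_eq_mul, mul_one]
    exact coeffNorm_monomial_le _ _

theorem degree_of_mem_support_eval {σ : Type*} {f : Expansion σ} {N : ℕ}
    (hf : ∀ t ∈ f, t.2.length + 1 = N) {γ : σ →₀ ℕ}
    (hγ : γ ∈ (f.eval (MvPolynomial.X : σ → MvPolynomial σ ℂ)).support) : γ.degree + 1 = N := by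
  classical
  induction f with
  | nil => simp [Expansion.eval] at hγ
  | cons t f ih =>
    simp only [Expansion.eval, List.map_cons, List.sum_cons] at hγ
    rcases Finset.mem_union.1 (support_add hγ) with h | h
    · rw [wordProd_X (α := Multiset.toFinsupp (t.2 : Multiset σ)) (by simp), smul_monomial] at h
      have := Finset.mem_singleton.1 (support_monomial_subset h)
      rw [this, ← coe_toMultiset_degree]
      simpa using hf t (by simp)
    · exact ih (fun t ht => hf t (by simp [ht])) h

theorem length_of_coe_eq_toMultiset {σ : Type*} {w : List σ} {α : σ →₀ ℕ}
    (h : (w : Multiset σ) = α.toMultiset) : w.length = α.degree := by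
  rw [← coe_toMultiset_degree, ← h, Multiset.coe_card]

theorem sum_map_of_coe_eq_toMultiset {σ M : Type*} [Fintype σ] [AddCommMonoid M] {w : List σ}
    {α : σ →₀ ℕ} (h : (w : Multiset σ) = α.toMultiset) (f : σ → M) :
    (w.map f).sum = ∑ p, α p • f p := by
  rw [← Multiset.sum_coe, ← Multiset.map_coe, h, sum_map_toMultiset, Finsupp.sum_fintype]
  simp

/-- The overlap counts exactly the pairs of letters, one from each word, that sit at a common site.
-/
theorem size_wordBracket_le_overlap {u w : List (Idx × X)} {β α : MultiIndex X}
    (hu : (u : Multiset (Idx × X)) = β.toMultiset) (hw : (w : Multiset (Idx × X)) = α.toMultiset) :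
    (wordBracket u w).size ≤ overlap β α := by
  refine (size_wordBracket_le u w).trans (le_of_eq ?_)
  rw [sum_map_of_coe_eq_toMultiset hu]
  simp_rw [sum_map_of_coe_eq_toMultiset hw]
  simp only [overlap, siteDegree, nsmul_eq_mul, mul_ite, mul_one, mul_zero,
    Fintype.sum_prod_type_right]
  push_cast
  refine Finset.sum_congr rfl fun x _ => ?_
  rw [Finset.sum_mul]
  refine Finset.sum_congr rfl fun i _ => ?_
  congr 1
  rw [Finset.sum_eq_single x]
  · simp
  · intro y _ hy
    simp [hy.symm]
  · simp

theorem monomialBracket_eq_eval {u w : List (Idx × X)} {β α : MultiIndex X}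
    (hu : (u : Multiset (Idx × X)) = β.toMultiset) (hw : (w : Multiset (Idx × X)) = α.toMultiset) :
    monomialBracket β α = (wordBracket u w).eval MvPolynomial.X := by
  rw [eval_wordBracket_X, monomialBracket]
  congr 1
  · exact (wordProd_X hu).symm
  · exact (wordProd_X hw).symm

theorem coeffNorm_monomialBracket_le (β α : MultiIndex X) :
    coeffNorm (monomialBracket β α) ≤ overlap β α := by
  have hu : (β.toMultiset.toList : Multiset (Idx × X)) = β.toMultiset := Multiset.coe_toList _
  have hw : (α.toMultiset.toList : Multiset (Idx × X)) = α.toMultiset := Multiset.coe_toList _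
  rw [monomialBracket_eq_eval hu hw]
  exact (coeffNorm_eval_le _).trans (size_wordBracket_le_overlap hu hw)

theorem degree_of_mem_support_monomialBracket {β α γ : MultiIndex X}
    (hγ : γ ∈ (monomialBracket β α).support) : γ.degree + 1 = β.degree + α.degree := by
  have hu : (β.toMultiset.toList : Multiset (Idx × X)) = β.toMultiset := Multiset.coe_toList _
  have hw : (α.toMultiset.toList : Multiset (Idx × X)) = α.toMultiset := Multiset.coe_toList _
  rw [monomialBracket_eq_eval hu hw] at hγ
  refine degree_of_mem_support_eval (fun t ht => ?_) hγ
  rw [length_of_mem_wordBracket ht, length_of_coe_eq_toMultiset hu, length_of_coe_eq_toMultiset hw]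

end

end Words

end SpinEgorov

namespace SpinEgorov

open MvPolynomial Set

/-! ### Weighted coefficient norms along linear flows -/

section Weighted

/-- The modulus is not differentiable at zeros of `b`; this regularization is, and Cauchy-Schwarz
bounds its derivative by `‖b'‖` uniformly in `η`. -/
theorem hasDerivAt_sqrt_norm_sq_add {b : ℝ → ℂ} {b' : ℂ} {θ η : ℝ} (hη : 0 < η)
    (hb : HasDerivAt b b' θ) :
    ∃ y, HasDerivAt (fun θ => √(‖b θ‖ ^ 2 + η ^ 2)) y θ ∧ y ≤ ‖b'‖ := by
  have h1 := (hb.norm_sq.add_const (η ^ 2)).sqrt (by positivity)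
  refine ⟨_, h1, ?_⟩
  have hpos : 0 < √(‖b θ‖ ^ 2 + η ^ 2) := Real.sqrt_pos.2 (by positivity)
  rw [div_le_iff₀ (by positivity)]
  have h2 : inner ℝ (b θ) b' ≤ ‖b θ‖ * ‖b'‖ := real_inner_le_norm _ _
  have h3 : ‖b θ‖ ≤ √(‖b θ‖ ^ 2 + η ^ 2) := Real.le_sqrt_of_sq_le (by nlinarith [sq_nonneg η])
  nlinarith [norm_nonneg b', norm_nonneg (b θ)]

/-- If the growth of the coefficients is dominated by `ρ` times the derivative of the weighted
`ℓ¹` norm in the weight, then shrinking the weight at rate `ρ` compensates for it. -/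
theorem weighted_norm_le {ι : Type*} [Fintype ι] (k : ι → ℕ) {b b' : ℝ → ι → ℂ}
    (hb : ∀ θ γ, HasDerivAt (fun θ => b θ γ) (b' θ γ) θ) {ρ z₀ : ℝ} (hρ : 0 ≤ ρ) (hz : ρ < z₀)
    (hcol : ∀ θ, ∀ z, 0 < z → z ≤ z₀ →
      ∑ γ, ‖b' θ γ‖ * z ^ (k γ + 1) ≤ ρ * ∑ γ, ‖b θ γ‖ * (k γ * z ^ k γ))
    {θ : ℝ} (hθ : θ ∈ Icc (0 : ℝ) 1) :
    ∑ γ, ‖b θ γ‖ * (z₀ - ρ * θ) ^ k γ ≤ ∑ γ, ‖b 0 γ‖ * z₀ ^ k γ := by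
  have hzpos : ∀ θ ∈ Icc (0 : ℝ) 1, 0 < z₀ - ρ * θ := fun θ hθ => by nlinarith [hθ.1, hθ.2]
  have hzle : ∀ θ ∈ Icc (0 : ℝ) 1, z₀ - ρ * θ ≤ z₀ := fun θ hθ => by nlinarith [hθ.1]
  have hz0 : 0 < z₀ := lt_of_le_of_lt hρ hz
  -- For the regularized moduli the weighted sum is differentiable and turns out to be decreasing;
  -- `η` is made small only at the end.
  have key : ∀ η : ℝ, 0 < η → ∑ γ, √(‖b θ γ‖ ^ 2 + η ^ 2) * (z₀ - ρ * θ) ^ k γ ≤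
      ∑ γ, √(‖b 0 γ‖ ^ 2 + η ^ 2) * z₀ ^ k γ := by
    intro η hη
    choose y hy hyle using fun θ γ => hasDerivAt_sqrt_norm_sq_add hη (hb θ γ)
    have hzd : ∀ θ, HasDerivAt (fun θ => z₀ - ρ * θ) (-ρ) θ := fun θ => by
      simpa using ((hasDerivAt_id θ).const_mul ρ).const_sub z₀
    have hg : ∀ θ, HasDerivAt (fun θ => ∑ γ, √(‖b θ γ‖ ^ 2 + η ^ 2) * (z₀ - ρ * θ) ^ k γ)
        (∑ γ, (y θ γ * (z₀ - ρ * θ) ^ k γ + √(‖b θ γ‖ ^ 2 + η ^ 2) *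
          (k γ * (z₀ - ρ * θ) ^ (k γ - 1) * (-ρ)))) θ := fun θ =>
      HasDerivAt.fun_sum fun γ _ => (hy θ γ).mul ((hzd θ).pow (k γ))
    have hanti : AntitoneOn (fun θ => ∑ γ, √(‖b θ γ‖ ^ 2 + η ^ 2) * (z₀ - ρ * θ) ^ k γ)
        (Icc 0 1) := by
      refine antitoneOn_of_deriv_nonpos (convex_Icc 0 1)
        (fun θ _ => (hg θ).continuousAt.continuousWithinAt)
        (fun θ _ => (hg θ).differentiableAt.differentiableWithinAt) fun θ hθ => ?_
      rw [interior_Icc] at hθ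
      rw [(hg θ).deriv]
      have hzp := hzpos θ (Ioo_subset_Icc_self hθ)
      have hzl := hzle θ (Ioo_subset_Icc_self hθ)
      generalize z₀ - ρ * θ = z at hzp hzl
      -- Multiplication by `z > 0` turns `k z^(k-1)` into `k z^k`, matching the exponents of `hcol`
      -- and making the truncated exponent at `k = 0` irrelevant.
      refine nonpos_of_mul_nonpos_left ?_ hzp
      rw [Finset.sum_mul]
      have hterm : ∀ γ, (y θ γ * z ^ k γ + √(‖b θ γ‖ ^ 2 + η ^ 2) *
          (k γ * z ^ (k γ - 1) * (-ρ))) * z ≤ ‖b' θ γ‖ * z ^ (k γ + 1) -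
            ρ * (‖b θ γ‖ * (k γ * z ^ k γ)) := by
        intro γ
        have h1 : (k γ : ℝ) * z ^ (k γ - 1) * z = k γ * z ^ k γ := by
          rcases Nat.eq_zero_or_pos (k γ) with h | h
          · simp [h]
          · rw [mul_assoc, pow_sub_one_mul h.ne']
        have h2 : y θ γ * z ^ (k γ + 1) ≤ ‖b' θ γ‖ * z ^ (k γ + 1) :=
          mul_le_mul_of_nonneg_right (hyle θ γ) (by positivity)
        have h3 : ‖b θ γ‖ ≤ √(‖b θ γ‖ ^ 2 + η ^ 2) :=
          Real.le_sqrt_of_sq_le (by nlinarith [sq_nonneg η])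
        have h4 : ‖b θ γ‖ * (ρ * (k γ * z ^ k γ)) ≤
            √(‖b θ γ‖ ^ 2 + η ^ 2) * (ρ * (k γ * z ^ k γ)) :=
          mul_le_mul_of_nonneg_right h3 (by positivity)
        calc _ = y θ γ * z ^ (k γ + 1) -
              √(‖b θ γ‖ ^ 2 + η ^ 2) * (ρ * (k γ * z ^ (k γ - 1) * z)) := by ring
          _ ≤ _ := by rw [h1]; linarith
      refine (Finset.sum_le_sum fun γ _ => hterm γ).trans ?_
      rw [Finset.sum_sub_distrib, ← Finset.mul_sum]
      linarith [hcol θ z hzp hzl]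
    have := hanti (left_mem_Icc.2 zero_le_one) hθ hθ.1
    simpa using this
  refine le_of_forall_pos_le_add fun ε hε => ?_
  set S : ℝ := ∑ γ, z₀ ^ k γ with hS
  have hS0 : 0 ≤ S := Finset.sum_nonneg fun γ _ => by positivity
  -- Regularization raises each modulus by at most `η`, hence the initial sum by at most `η S`; this
  -- `η` keeps that below `ε`.
  have hη : 0 < ε / (S + 1) := by positivity
  have hleft : ∑ γ, ‖b θ γ‖ * (z₀ - ρ * θ) ^ k γ ≤
      ∑ γ, √(‖b θ γ‖ ^ 2 + (ε / (S + 1)) ^ 2) * (z₀ - ρ * θ) ^ k γ := by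
    refine Finset.sum_le_sum fun γ _ => ?_
    refine mul_le_mul_of_nonneg_right ?_ (pow_nonneg (hzpos θ hθ).le _)
    exact Real.le_sqrt_of_sq_le (by nlinarith [sq_nonneg (ε / (S + 1))])
  have hright : ∑ γ, √(‖b 0 γ‖ ^ 2 + (ε / (S + 1)) ^ 2) * z₀ ^ k γ ≤
      ∑ γ, ‖b 0 γ‖ * z₀ ^ k γ + ε := by
    have h1 : ∑ γ, √(‖b 0 γ‖ ^ 2 + (ε / (S + 1)) ^ 2) * z₀ ^ k γ ≤
        ∑ γ, (‖b 0 γ‖ * z₀ ^ k γ + ε / (S + 1) * z₀ ^ k γ) := by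
      refine Finset.sum_le_sum fun γ _ => ?_
      rw [← add_mul]
      refine mul_le_mul_of_nonneg_right ?_ (by positivity)
      refine Real.sqrt_le_iff.2 ⟨by positivity, ?_⟩
      nlinarith [norm_nonneg (b 0 γ)]
    refine h1.trans ?_
    rw [Finset.sum_add_distrib, ← Finset.mul_sum, ← hS]
    have : ε / (S + 1) * S ≤ ε := by
      rw [div_mul_eq_mul_div, div_le_iff₀ (by positivity)]
      nlinarith
    linarith
  linarith [key _ hη]

end Weighted

/-! ### The Liouville equation for coefficients -/

section Liouville

variable {X : Type*} [Fintype X] {W : ℝ → MultiIndex X → ℂ} {v : ℕ → ℝ}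

/-- The source of uniformity in the volume: every site contributes at most `∑ v` times `|α(x)|`, and
these weights add up to `|α|` rather than to the number of sites. -/
theorem IsBoundedPotential.hasSum_overlap_le (hW : IsBoundedPotential W v) (α : MultiIndex X)
    (t : ℝ) :
    ∃ a ≤ (α.degree : ℝ) * ∑' n, v n,
      HasSum (fun β => ‖W t β‖ * overlap β α * Real.exp β.degree) a := by
  have h1 : HasSum (fun β => ∑ x, (siteDegree α x : ℝ) *
      ((siteDegree β x : ℝ) * ‖W t β‖ * Real.exp β.degree))
      (∑ x, (siteDegree α x : ℝ) *
        ∑' β, (siteDegree β x : ℝ) * ‖W t β‖ * Real.exp β.degree) :=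
    hasSum_sum fun x _ => (hW.summable_site x t).hasSum.mul_left _
  refine ⟨∑ x, (siteDegree α x : ℝ) *
    ∑' β, (siteDegree β x : ℝ) * ‖W t β‖ * Real.exp β.degree, ?_, ?_⟩
  rotate_left
  · convert h1 using 2 with β
    rw [overlap, Nat.cast_sum, Finset.mul_sum, Finset.sum_mul]
    refine Finset.sum_congr rfl fun x _ => ?_
    push_cast
    ring
  · rw [degree_eq_sum_siteDegree, Nat.cast_sum, Finset.sum_mul]
    exact Finset.sum_le_sum fun x _ =>
      mul_le_mul_of_nonneg_left (hW.tsum_site_le x t) (by positivity)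

variable [DecidableEq X]

/-- The matrix element `({H(t), M^α})_γ` of the Liouville operator. -/
noncomputable def liouville (W : ℝ → MultiIndex X → ℂ) (t : ℝ) (γ α : MultiIndex X) : ℂ :=
  ∑' β, W t β • (monomialBracket β α).coeff γ

theorem norm_coeff_monomialBracket_le (β α γ : MultiIndex X) :
    ‖(monomialBracket β α).coeff γ‖ ≤ α.degree * Real.exp β.degree := by
  refine (norm_coeff_le_coeffNorm _ _).trans ((coeffNorm_monomialBracket_le β α).trans ?_)
  have h1 : (overlap β α : ℝ) ≤ β.degree * α.degree := by exact_mod_cast overlap_le β α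
  have h2 : (β.degree : ℝ) ≤ Real.exp β.degree := by
    linarith [Real.add_one_le_exp (β.degree : ℝ)]
  nlinarith [(Nat.cast_nonneg α.degree : (0 : ℝ) ≤ α.degree)]

theorem continuous_liouville (hW : IsBoundedPotential W v) (γ α : MultiIndex X) :
    Continuous fun t => liouville W t γ α :=
  hW.continuous_tsum_smul fun β => norm_coeff_monomialBracket_le β α γ

theorem hasSum_liouville (hW : IsBoundedPotential W v) (t : ℝ) (γ α : MultiIndex X) :
    HasSum (fun β => W t β • (monomialBracket β α).coeff γ) (liouville W t γ α) :=
  (hW.summable_smul (fun β => norm_coeff_monomialBracket_le β α γ) t).hasSum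

/-- The bracket is homogeneous, so all its monomials carry the same power of `z` and only the sum of
the coefficients remains to be bounded. -/
theorem sum_coeff_monomialBracket_mul_pow_le (β α : MultiIndex X) (s : Finset (MultiIndex X))
    {z : ℝ} (hz : 0 ≤ z) :
    ∑ γ ∈ s, ‖(monomialBracket β α).coeff γ‖ * z ^ (γ.degree + 1) ≤
      overlap β α * z ^ (β.degree + α.degree) := by
  classical
  have h1 : ∑ γ ∈ s, ‖(monomialBracket β α).coeff γ‖ * z ^ (γ.degree + 1) ≤
      ∑ γ ∈ (monomialBracket β α).support,
        ‖(monomialBracket β α).coeff γ‖ * z ^ (γ.degree + 1) := by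
    rw [← Finset.sum_filter_add_sum_filter_not s (· ∈ (monomialBracket β α).support)]
    rw [Finset.sum_eq_zero (s := s.filter (¬ · ∈ (monomialBracket β α).support)), add_zero]
    · refine Finset.sum_le_sum_of_subset_of_nonneg (fun γ hγ => (Finset.mem_filter.1 hγ).2)
        fun _ _ _ => by positivity
    · intro γ hγ
      rw [notMem_support_iff.1 (Finset.mem_filter.1 hγ).2, norm_zero, zero_mul]
  refine h1.trans ?_
  have h2 : ∑ γ ∈ (monomialBracket β α).support,
      ‖(monomialBracket β α).coeff γ‖ * z ^ (γ.degree + 1) =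
      coeffNorm (monomialBracket β α) * z ^ (β.degree + α.degree) := by
    rw [coeffNorm, Finset.sum_mul]
    refine Finset.sum_congr rfl fun γ hγ => ?_
    rw [degree_of_mem_support_monomialBracket hγ]
  rw [h2]
  exact mul_le_mul_of_nonneg_right (coeffNorm_monomialBracket_le β α) (by positivity)

/-- The Liouville operator loses one derivative in the weight. -/
theorem sum_norm_liouville_mul_pow_le (hW : IsBoundedPotential W v) (t : ℝ) (α : MultiIndex X)
    (s : Finset (MultiIndex X)) {z : ℝ} (hz : 0 ≤ z) (hz' : z ≤ Real.exp 1) :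
    ∑ γ ∈ s, ‖liouville W t γ α‖ * z ^ (γ.degree + 1) ≤
      (∑' n, v n) * (α.degree * z ^ α.degree) := by
  obtain ⟨a, ha, hsum⟩ := hW.hasSum_overlap_le α t
  have h1 : ∀ γ, ‖liouville W t γ α‖ ≤ ∑' β, ‖W t β • (monomialBracket β α).coeff γ‖ := fun γ =>
    norm_tsum_le_tsum_norm (hW.summable_norm_smul
      (fun β => norm_coeff_monomialBracket_le β α γ) t)
  have h2 : HasSum (fun β => ∑ γ ∈ s, ‖W t β • (monomialBracket β α).coeff γ‖ * z ^ (γ.degree + 1))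
      (∑ γ ∈ s, (∑' β, ‖W t β • (monomialBracket β α).coeff γ‖) * z ^ (γ.degree + 1)) :=
    hasSum_sum fun γ _ => (hW.summable_norm_smul
      (fun β => norm_coeff_monomialBracket_le β α γ) t).hasSum.mul_right _
  have h3 : ∑ γ ∈ s, (∑' β, ‖W t β • (monomialBracket β α).coeff γ‖) * z ^ (γ.degree + 1) ≤
      a * z ^ α.degree := by
    refine hasSum_le (fun β => ?_) h2 (hsum.mul_right (z ^ α.degree))
    simp_rw [norm_smul, mul_assoc]
    rw [← Finset.mul_sum]
    refine mul_le_mul_of_nonneg_left ?_ (norm_nonneg _)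
    refine (sum_coeff_monomialBracket_mul_pow_le β α s hz).trans ?_
    refine mul_le_mul_of_nonneg_left ?_ (by positivity)
    -- The factor `z^|β|` is at most `e^|β|`, which the potential norm pays for; `z^|α|` is kept.
    rw [pow_add, ← Real.exp_one_pow]
    exact mul_le_mul_of_nonneg_right (pow_le_pow_left₀ hz hz' _) (by positivity)
  calc ∑ γ ∈ s, ‖liouville W t γ α‖ * z ^ (γ.degree + 1)
      ≤ ∑ γ ∈ s, (∑' β, ‖W t β • (monomialBracket β α).coeff γ‖) * z ^ (γ.degree + 1) :=
        Finset.sum_le_sum fun γ _ => mul_le_mul_of_nonneg_right (h1 γ) (by positivity)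
    _ ≤ a * z ^ α.degree := h3
    _ ≤ (α.degree * ∑' n, v n) * z ^ α.degree :=
        mul_le_mul_of_nonneg_right ha (by positivity)
    _ = _ := by ring

end Liouville

end SpinEgorov

namespace SpinEgorov

open MvPolynomial Set

/-! ### Approximate Liouville flows -/

section Flow

/-- A family `m(t)` of values of the monomials that evolves by the Liouville equation of `W`, up to
an error of size `δ` in each commutator. -/
structure IsApproxFlow {X : Type*} [Fintype X] [DecidableEq X] {E : Type*} [NormedAddCommGroup E]
    [NormedSpace ℂ E] (W : ℝ → MultiIndex X → ℂ) (δ : ℝ) (m : ℝ → MultiIndex X → E) : Prop where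
  norm_le : ∀ t γ, ‖m t γ‖ ≤ (3 / 2 : ℝ) ^ γ.degree
  exists_deriv : ∃ D : ℝ → MultiIndex X → MultiIndex X → E,
    (∀ t α, HasDerivAt (fun t => m t α) (∑' β, W t β • D t β α) t) ∧
    ∀ t β α, ‖D t β α - observe (m t) (monomialBracket β α)‖ ≤
      δ * (overlap β α * 2 ^ (β.degree + α.degree))

theorem exp_one_gt_five_halves : (5 / 2 : ℝ) < Real.exp 1 := by
  linarith [Real.exp_one_gt_d9]

/-- This trades the derivative loss `|α|` at weight 2 for the larger weight `5/2`. The constant 4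
makes the induction close: `2 * 4 + 2 = 4 * (5 / 2)`. -/
theorem natCast_mul_two_pow_le (k : ℕ) : (k : ℝ) * 2 ^ k ≤ 4 * (5 / 2) ^ k := by
  induction k with
  | zero => simp
  | succ k ih =>
    have h : (2 : ℝ) ^ k ≤ (5 / 2) ^ k := pow_le_pow_left₀ (by norm_num) (by norm_num) k
    have h0 : (0 : ℝ) < 2 ^ k := by positivity
    rw [pow_succ, pow_succ]
    push_cast
    nlinarith

variable {X : Type*} [Fintype X] {W : ℝ → MultiIndex X → ℂ} {v : ℕ → ℝ}

/-- Multi-indices of degree at most `D`. -/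
abbrev BoundedIndex (X : Type*) (D : ℕ) := {γ : MultiIndex X // γ.degree ≤ D}

noncomputable instance (D : ℕ) : Fintype (BoundedIndex X D) :=
  have : Finite (BoundedIndex X D) := (Finsupp.finite_of_degree_le D).to_subtype
  Fintype.ofFinite _

/-- Since `(3/2)^k = (3/4)^k * 2^k`, the discarded monomials, of degree above `D`, gain the small
factor `(3/4)^D` at the price of weight 2. -/
theorem norm_observe_sub_sum_le {E : Type*} [NormedAddCommGroup E] [NormedSpace ℂ E]
    {m : MultiIndex X → E} (hm : ∀ γ, ‖m γ‖ ≤ (3 / 2 : ℝ) ^ γ.degree)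
    {A : MvPolynomial (Idx × X) ℂ} {N : ℕ} (hA : ∀ γ ∈ A.support, γ.degree + 1 = N) (D : ℕ) :
    ‖observe m A - ∑ γ : BoundedIndex X D, A.coeff γ.1 • m γ.1‖ ≤
      (3 / 4 : ℝ) ^ D * 2 ^ N * coeffNorm A := by
  classical
  have hsum : ∑ γ : BoundedIndex X D, A.coeff γ.1 • m γ.1 =
      ∑ γ ∈ A.support.filter (fun γ => γ.degree ≤ D), A.coeff γ • m γ := by
    have h1 : ∑ γ : BoundedIndex X D, A.coeff γ.1 • m γ.1 =
        ∑ γ ∈ Finset.univ.map (Function.Embedding.subtype fun γ : MultiIndex X => γ.degree ≤ D),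
          A.coeff γ • m γ := by
      rw [Finset.sum_map]
      rfl
    rw [h1]
    refine (Finset.sum_subset (fun γ hγ => ?_) fun γ hγ hγ' => ?_).symm
    · simpa using (Finset.mem_filter.1 hγ).2
    · have hd : γ.degree ≤ D := by simpa using hγ
      have : γ ∉ A.support := fun h => hγ' (Finset.mem_filter.2 ⟨h, hd⟩)
      rw [notMem_support_iff.1 this, zero_smul]
  rw [hsum, observe_apply, ← Finset.sum_filter_add_sum_filter_not A.support
    (fun γ => γ.degree ≤ D), add_sub_cancel_left, coeffNorm, Finset.mul_sum]
  refine (norm_sum_le _ _).trans ?_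
  refine (Finset.sum_le_sum (g := fun γ => (3 / 4 : ℝ) ^ D * 2 ^ N * ‖A.coeff γ‖)
    fun γ hγ => ?_).trans (Finset.sum_le_sum_of_subset_of_nonneg (Finset.filter_subset _ _)
      fun _ _ _ => by positivity)
  obtain ⟨hγA, hγD⟩ := Finset.mem_filter.1 hγ
  rw [norm_smul, mul_comm]
  refine mul_le_mul_of_nonneg_right ((hm γ).trans ?_) (norm_nonneg _)
  have h1 : (3 / 2 : ℝ) ^ γ.degree = (3 / 4) ^ γ.degree * 2 ^ γ.degree := by
    rw [← mul_pow]
    norm_num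
  rw [h1]
  refine mul_le_mul ?_ ?_ (by positivity) (by positivity)
  · exact pow_le_pow_of_le_one (by norm_num) (by norm_num) (not_le.1 hγD).le
  · exact pow_le_pow_right₀ (by norm_num) (by rw [← hA γ hγA]; omega)

variable [DecidableEq X]

/-- The truncated Liouville equation, run backwards along the segment from `t₁` to `t₁ + σ`. -/
theorem exists_truncated_flow (hW : IsBoundedPotential W v) (D : ℕ) (t₁ σ : ℝ)
    (b₀ : BoundedIndex X D → ℂ) :
    ∃ b : ℝ → BoundedIndex X D → ℂ, b 0 = b₀ ∧ ∀ θ γ, HasDerivAt (fun θ => b θ γ)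
      (-(σ : ℂ) * ∑ α : BoundedIndex X D, liouville W (t₁ + θ * σ) γ.1 α.1 * b θ α) θ := by
  set f : ℝ → (BoundedIndex X D → ℂ) → BoundedIndex X D → ℂ := fun θ b γ =>
    -(σ : ℂ) * ∑ α : BoundedIndex X D, liouville W (t₁ + θ * σ) γ.1 α.1 * b α with hf
  have hG : ∀ γ α : MultiIndex X, Continuous fun θ : ℝ => liouville W (t₁ + θ * σ) γ α :=
    fun γ α => (continuous_liouville hW γ α).comp (by fun_prop)
  have hcont : ∀ b, Continuous fun θ => f θ b := by
    intro b
    refine continuous_pi fun γ => ?_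
    refine continuous_const.mul (continuous_finsetSum _ fun α _ => ?_)
    exact (hG γ.1 α.1).mul continuous_const
  have hlip : ∀ T : ℝ, ∃ K : NNReal, ∀ θ ∈ Icc (-T) T, LipschitzWith K (f θ) := by
    intro T
    -- The sum of all matrix entries is a crude Lipschitz constant. It depends on the volume, but it
    -- serves existence only.
    have hc : Continuous fun θ : ℝ => |σ| * ∑ γ : BoundedIndex X D, ∑ α : BoundedIndex X D,
        ‖liouville W (t₁ + θ * σ) γ.1 α.1‖ := by
      refine continuous_const.mul ?_
      exact continuous_finsetSum _ fun γ _ => continuous_finsetSum _ fun α _ => (hG γ.1 α.1).norm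
    obtain ⟨C, hC⟩ := isCompact_Icc.exists_bound_of_continuousOn (s := Icc (-T) T)
      hc.continuousOn
    refine ⟨C.toNNReal, fun θ hθ => LipschitzWith.of_dist_le_mul fun b b' => ?_⟩
    have hCθ := hC θ hθ
    rw [Real.norm_of_nonneg (by positivity)] at hCθ
    have hC0 : 0 ≤ C := le_trans (by positivity) hCθ
    rw [dist_eq_norm, dist_eq_norm, Real.coe_toNNReal _ hC0]
    refine le_trans ?_ (mul_le_mul_of_nonneg_right hCθ (norm_nonneg _))
    refine (pi_norm_le_iff_of_nonneg (by positivity)).2 fun γ => ?_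
    have : (f θ b - f θ b') γ =
        -(σ : ℂ) * ∑ α : BoundedIndex X D, liouville W (t₁ + θ * σ) γ.1 α.1 * (b - b') α := by
      simp only [hf, Pi.sub_apply, mul_sub, Finset.sum_sub_distrib]
    rw [this, norm_mul, norm_neg, Complex.norm_real, Real.norm_eq_abs, mul_assoc]
    refine mul_le_mul_of_nonneg_left ?_ (abs_nonneg _)
    refine (norm_sum_le _ _).trans ?_
    refine le_trans ?_ (mul_le_mul_of_nonneg_right (Finset.single_le_sum
      (f := fun γ : BoundedIndex X D => ∑ α : BoundedIndex X D,
        ‖liouville W (t₁ + θ * σ) γ.1 α.1‖)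
      (fun γ _ => Finset.sum_nonneg fun α _ => norm_nonneg _) (Finset.mem_univ γ))
        (norm_nonneg _))
    rw [Finset.sum_mul]
    refine Finset.sum_le_sum fun α _ => ?_
    rw [norm_mul]
    exact mul_le_mul_of_nonneg_left (norm_le_pi_norm _ α) (norm_nonneg _)
  obtain ⟨b, hb0, hb⟩ := exists_global_solution hcont hlip b₀
  exact ⟨b, hb0, fun θ γ => hasDerivAt_pi.1 (hb θ) γ⟩

/-- The generator of an approximate flow differs little from the truncated Liouville operator. -/
theorem norm_deriv_sub_liouville_le {E : Type*} [NormedAddCommGroup E] [NormedSpace ℂ E]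
    [CompleteSpace E] (hW : IsBoundedPotential W v) {δ : ℝ} (hδ : 0 ≤ δ) {m : MultiIndex X → E}
    (hm : ∀ γ, ‖m γ‖ ≤ (3 / 2 : ℝ) ^ γ.degree) {t : ℝ} {α : MultiIndex X} {F : MultiIndex X → E}
    (hF : ∀ β, ‖F β - observe m (monomialBracket β α)‖ ≤
      δ * (overlap β α * 2 ^ (β.degree + α.degree))) (D : ℕ) :
    ‖∑' β, W t β • F β - ∑ γ : BoundedIndex X D, liouville W t γ.1 α • m γ.1‖ ≤
      (δ + (3 / 4) ^ D) * ((∑' n, v n) * (α.degree * 2 ^ α.degree)) := by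
  obtain ⟨a, ha, hsum⟩ := hW.hasSum_overlap_le α t
  have hG : HasSum (fun β => W t β • ∑ γ : BoundedIndex X D,
      (monomialBracket β α).coeff γ.1 • m γ.1)
      (∑ γ : BoundedIndex X D, liouville W t γ.1 α • m γ.1) := by
    simp_rw [Finset.smul_sum, ← smul_assoc]
    exact hasSum_sum fun γ _ => (hasSum_liouville hW t γ.1 α).smul_const _
  -- The bracket error and the truncation tail have the same form, a small factor times `overlap *
  -- 2^(|β| + |α|)`, and `2^|β| ≤ e^|β|` is covered by the potential norm.
  have hdiff : ∀ β, ‖W t β • (F β - ∑ γ : BoundedIndex X D,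
      (monomialBracket β α).coeff γ.1 • m γ.1)‖ ≤
      (δ + (3 / 4) ^ D) * 2 ^ α.degree * (‖W t β‖ * overlap β α * Real.exp β.degree) := by
    intro β
    have h1 := hF β
    have h2 := norm_observe_sub_sum_le hm
      (fun γ hγ => degree_of_mem_support_monomialBracket (β := β) (α := α) hγ) D
    have h3 : (3 / 4 : ℝ) ^ D * 2 ^ (β.degree + α.degree) * coeffNorm (monomialBracket β α) ≤
        (3 / 4 : ℝ) ^ D * 2 ^ (β.degree + α.degree) * overlap β α :=
      mul_le_mul_of_nonneg_left (coeffNorm_monomialBracket_le β α) (by positivity)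
    have h4 := norm_sub_le_norm_sub_add_norm_sub (F β) (observe m (monomialBracket β α))
      (∑ γ : BoundedIndex X D, (monomialBracket β α).coeff γ.1 • m γ.1)
    have h5 : (2 : ℝ) ^ β.degree ≤ Real.exp β.degree := by
      rw [← Real.exp_one_pow]
      exact pow_le_pow_left₀ (by norm_num) (by linarith [exp_one_gt_five_halves]) _
    rw [norm_smul]
    calc _ ≤ ‖W t β‖ * ((δ + (3 / 4) ^ D) * (overlap β α * 2 ^ (β.degree + α.degree))) := by
          refine mul_le_mul_of_nonneg_left ?_ (norm_nonneg _)
          linarith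
      _ = (δ + (3 / 4) ^ D) * 2 ^ α.degree * (‖W t β‖ * overlap β α * 2 ^ β.degree) := by
          rw [pow_add]
          ring
      _ ≤ _ := by gcongr
  -- Summability of the series in `F` is not assumed; it follows from that of the difference and of
  -- the truncated part.
  have hsd : Summable fun β => W t β • (F β - ∑ γ : BoundedIndex X D,
      (monomialBracket β α).coeff γ.1 • m γ.1) :=
    Summable.of_norm (Summable.of_nonneg_of_le (fun _ => norm_nonneg _) hdiff
      (hsum.summable.mul_left _))
  have hFsum : ∑' β, W t β • F β = ∑' β, W t β • (F β - ∑ γ : BoundedIndex X D,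
      (monomialBracket β α).coeff γ.1 • m γ.1) +
      ∑ γ : BoundedIndex X D, liouville W t γ.1 α • m γ.1 := by
    rw [← (hsd.hasSum.add hG).tsum_eq]
    refine tsum_congr fun β => ?_
    rw [← smul_add, sub_add_cancel]
  rw [hFsum, add_sub_cancel_right]
  refine (tsum_of_norm_bounded (hsum.mul_left _) hdiff).trans ?_
  calc (δ + (3 / 4) ^ D) * 2 ^ α.degree * a
      ≤ (δ + (3 / 4) ^ D) * 2 ^ α.degree * (α.degree * ∑' n, v n) :=
        mul_le_mul_of_nonneg_left ha (by positivity)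
    _ = _ := by ring

end Flow

end SpinEgorov

namespace SpinEgorov

open MvPolynomial Set

/-! ### Approximation of Liouville flows by polynomials -/

section Approximation

universe u

theorem coeffNorm_sum_monomial_le {σ ι : Type*} (s : Finset ι) (γ : ι → σ →₀ ℕ) (c : ι → ℂ) :
    coeffNorm (∑ i ∈ s, monomial (γ i) (c i)) ≤ ∑ i ∈ s, ‖c i‖ := by
  classical
  induction s using Finset.induction_on with
  | empty => simp [coeffNorm]
  | insert i s hi ih =>
    rw [Finset.sum_insert hi, Finset.sum_insert hi]
    exact (coeffNorm_add_le _ _).trans (add_le_add (coeffNorm_monomial_le _ _) ih)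

/-- Transport of an observable over a short time segment, by a polynomial whose degree and size are
controlled independently of the volume. -/
theorem exists_short_time_approx {h : ℝ} (hh : 0 ≤ h) (d : ℕ) {K : ℝ} (hK : 0 ≤ K) {ε : ℝ}
    (hε : 0 < ε) :
    ∃ (d' : ℕ) (K' C : ℝ), 0 ≤ K' ∧ 0 ≤ C ∧ ∀ {X : Type u} [Fintype X] [DecidableEq X]
      (W : ℝ → MultiIndex X → ℂ) (v : ℕ → ℝ), IsBoundedPotential W v → ∑' n, v n ≤ h →
      ∀ t₁ t₀ : ℝ, |t₀ - t₁| * (h + 1) ≤ 1 / 5 → ∀ B : MvPolynomial (Idx × X) ℂ,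
      (∀ γ ∈ B.support, γ.degree ≤ d) → coeffNorm B ≤ K →
      ∃ B' : MvPolynomial (Idx × X) ℂ, (∀ γ ∈ B'.support, γ.degree ≤ d') ∧ coeffNorm B' ≤ K' ∧
        ∀ (E : Type u) [NormedAddCommGroup E] [NormedSpace ℂ E] [CompleteSpace E] (δ : ℝ)
          (m : ℝ → MultiIndex X → E), 0 ≤ δ → IsApproxFlow W δ m →
          ‖observe (m t₁) B - observe (m t₀) B'‖ ≤ ε + C * δ := by
  -- This bounds the norm of `B` at weight `e`, since its degree is at most `d`.
  set K₁ : ℝ := Real.exp d * K with hK₁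
  have hK₁0 : 0 ≤ K₁ := by positivity
  -- The truncation error will be `4 K₁ (3/4)^D`; the summand 1 avoids division by zero. The later
  -- maximum with `d` ensures that `B` itself is not truncated.
  obtain ⟨D₀, hD₀⟩ : ∃ D₀ : ℕ, (3 / 4 : ℝ) ^ D₀ < ε / (4 * K₁ + 1) :=
    exists_pow_lt_of_lt_one (by positivity) (by norm_num)
  set D := max D₀ d with hD
  have hDε : 4 * K₁ * (3 / 4 : ℝ) ^ D ≤ ε := by
    have h1 : (3 / 4 : ℝ) ^ D ≤ ε / (4 * K₁ + 1) :=
      (pow_le_pow_of_le_one (by norm_num) (by norm_num) (le_max_left _ _)).trans hD₀.le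
    calc 4 * K₁ * (3 / 4 : ℝ) ^ D ≤ 4 * K₁ * (ε / (4 * K₁ + 1)) :=
          mul_le_mul_of_nonneg_left h1 (by positivity)
      _ ≤ ε := by
          rw [← mul_div_assoc, div_le_iff₀ (by positivity)]
          nlinarith
  refine ⟨D, K₁, 4 * K₁, hK₁0, by positivity, ?_⟩
  intro X _ _ W v hW hv t₁ t₀ ht B hBd hBK
  set σ := t₀ - t₁ with hσ
  obtain ⟨b, hb0, hb⟩ := exists_truncated_flow hW D t₁ σ (fun γ => B.coeff γ.1)
  have hv0 : 0 ≤ ∑' n, v n := hW.tsum_nonneg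
  set ρ := |σ| * h with hρ
  have hρ0 : 0 ≤ ρ := by positivity
  have hσ5 : |σ| * h ≤ 1 / 5 := by nlinarith [abs_nonneg σ]
  have hee := exp_one_gt_five_halves
  have hee' : (27 / 10 : ℝ) < Real.exp 1 := by linarith [Real.exp_one_gt_d9]
  have hBsupp : B.support ⊆
      Finset.univ.map (Function.Embedding.subtype fun γ : MultiIndex X => γ.degree ≤ D) := by
    intro γ hγ
    have hγD : γ.degree ≤ D := (hBd γ hγ).trans (le_max_right D₀ d)
    simpa using hγD
  have hinit : ∑ γ : BoundedIndex X D, ‖b 0 γ‖ * Real.exp 1 ^ γ.1.degree ≤ K₁ := by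
    have h1 : ∀ γ : BoundedIndex X D, ‖b 0 γ‖ * Real.exp 1 ^ γ.1.degree ≤
        Real.exp d * ‖B.coeff γ.1‖ := by
      intro γ
      rw [hb0]
      by_cases hγ : γ.1 ∈ B.support
      · rw [mul_comm, Real.exp_one_pow]
        refine mul_le_mul_of_nonneg_right (Real.exp_le_exp.2 ?_) (norm_nonneg _)
        exact_mod_cast hBd _ hγ
      · simp [notMem_support_iff.1 hγ]
    refine (Finset.sum_le_sum fun γ _ => h1 γ).trans ?_
    rw [← Finset.mul_sum]
    refine mul_le_mul_of_nonneg_left (le_trans (le_of_eq ?_) hBK) (Real.exp_pos _).le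
    rw [coeffNorm_eq_sum_of_subset hBsupp, Finset.sum_map]
    rfl
  have hcol : ∀ θ z : ℝ, 0 < z → z ≤ Real.exp 1 →
      ∑ γ : BoundedIndex X D, ‖-(σ : ℂ) * ∑ α : BoundedIndex X D,
        liouville W (t₁ + θ * σ) γ.1 α.1 * b θ α‖ * z ^ (γ.1.degree + 1) ≤
      ρ * ∑ γ : BoundedIndex X D, ‖b θ γ‖ * (γ.1.degree * z ^ γ.1.degree) := by
    intro θ z hz hz'
    have h1 : ∀ γ : BoundedIndex X D, ‖-(σ : ℂ) * ∑ α : BoundedIndex X D,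
        liouville W (t₁ + θ * σ) γ.1 α.1 * b θ α‖ * z ^ (γ.1.degree + 1) ≤
        |σ| * ∑ α : BoundedIndex X D, ‖b θ α‖ *
          (‖liouville W (t₁ + θ * σ) γ.1 α.1‖ * z ^ (γ.1.degree + 1)) := by
      intro γ
      rw [norm_mul, norm_neg, Complex.norm_real, Real.norm_eq_abs, mul_assoc]
      refine mul_le_mul_of_nonneg_left ?_ (abs_nonneg _)
      refine (mul_le_mul_of_nonneg_right (norm_sum_le _ _) (by positivity)).trans (le_of_eq ?_)
      rw [Finset.sum_mul]
      refine Finset.sum_congr rfl fun α _ => ?_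
      rw [norm_mul]
      ring
    refine (Finset.sum_le_sum fun γ _ => h1 γ).trans ?_
    rw [← Finset.mul_sum, Finset.sum_comm, hρ, mul_assoc]
    refine mul_le_mul_of_nonneg_left ?_ (abs_nonneg _)
    rw [Finset.mul_sum]
    refine Finset.sum_le_sum fun α _ => ?_
    rw [← Finset.mul_sum, mul_left_comm]
    refine mul_le_mul_of_nonneg_left ?_ (norm_nonneg _)
    have h2 := sum_norm_liouville_mul_pow_le hW (t₁ + θ * σ) α.1
      (Finset.univ.map (Function.Embedding.subtype fun γ : MultiIndex X => γ.degree ≤ D))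
      hz.le hz'
    rw [Finset.sum_map] at h2
    exact h2.trans (mul_le_mul_of_nonneg_right hv (by positivity))
  -- The weight falls from `e` by at most `1/5` and stays above `5/2`, because `e > 27/10`. This
  -- fixes the admissible length of a segment.
  have hbound : ∀ θ ∈ Icc (0 : ℝ) 1,
      ∑ γ : BoundedIndex X D, ‖b θ γ‖ * (5 / 2 : ℝ) ^ γ.1.degree ≤ K₁ := by
    intro θ hθ
    have h1 := weighted_norm_le (fun γ : BoundedIndex X D => γ.1.degree) hb hρ0
      (z₀ := Real.exp 1) (by linarith) hcol hθ
    refine le_trans (Finset.sum_le_sum fun γ _ => ?_) (h1.trans hinit)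
    refine mul_le_mul_of_nonneg_left (pow_le_pow_left₀ (by norm_num) ?_ _) (norm_nonneg _)
    nlinarith [hθ.1, hθ.2]
  refine ⟨∑ γ : BoundedIndex X D, monomial γ.1 (b 1 γ), ?_, ?_, ?_⟩
  · intro γ hγ
    classical
    obtain ⟨γ', -, hγ'⟩ := Finset.mem_biUnion.1 (support_sum hγ)
    rw [Finset.mem_singleton.1 (support_monomial_subset hγ')]
    exact γ'.2
  · refine (coeffNorm_sum_monomial_le _ _ _).trans (le_trans (Finset.sum_le_sum fun γ _ => ?_)
      (hbound 1 (right_mem_Icc.2 zero_le_one)))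
    exact le_mul_of_one_le_right (norm_nonneg _) (one_le_pow₀ (by norm_num))
  · intro E _ _ _ δ m hδ hm
    obtain ⟨F, hF, hFle⟩ := hm.exists_deriv
    have hr : ∀ θ : ℝ, HasDerivAt (fun θ : ℝ => t₁ + θ * σ) σ θ := fun θ => by
      simpa using ((hasDerivAt_id θ).mul_const σ).const_add t₁
    have hderiv : ∀ θ, HasDerivAt
        (fun θ => ∑ γ : BoundedIndex X D, b θ γ • m (t₁ + θ * σ) γ.1)
        (∑ γ : BoundedIndex X D, (b θ γ • (σ • ∑' β, W (t₁ + θ * σ) β • F (t₁ + θ * σ) β γ.1) +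
          (-(σ : ℂ) * ∑ α : BoundedIndex X D, liouville W (t₁ + θ * σ) γ.1 α.1 * b θ α) •
            m (t₁ + θ * σ) γ.1)) θ := fun θ =>
      HasDerivAt.fun_sum fun γ _ => (hb θ γ).smul (HasDerivAt.scomp
        (g₁ := fun t => m t γ.1) (h := fun θ => t₁ + θ * σ) θ (hF (t₁ + θ * σ) γ.1) (hr θ))
    have hder_le : ∀ θ ∈ Icc (0 : ℝ) 1,
        ‖∑ γ : BoundedIndex X D, (b θ γ • (σ • ∑' β, W (t₁ + θ * σ) β • F (t₁ + θ * σ) β γ.1) +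
          (-(σ : ℂ) * ∑ α : BoundedIndex X D, liouville W (t₁ + θ * σ) γ.1 α.1 * b θ α) •
            m (t₁ + θ * σ) γ.1)‖ ≤ ε + 4 * K₁ * δ := by
      intro θ hθ
      set r := t₁ + θ * σ with hrdef
      -- The coefficients evolve by minus the transpose of the evolution of the monomials, so only
      -- the defect between the true generator and the truncated one survives.
      have hident : ∑ γ : BoundedIndex X D, (b θ γ • (σ • ∑' β, W r β • F r β γ.1) +
          (-(σ : ℂ) * ∑ α : BoundedIndex X D, liouville W r γ.1 α.1 * b θ α) • m r γ.1) =
          (σ : ℂ) • ∑ α : BoundedIndex X D, b θ α • (∑' β, W r β • F r β α.1 -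
            ∑ γ : BoundedIndex X D, liouville W r γ.1 α.1 • m r γ.1) := by
        have h1 : ∑ γ : BoundedIndex X D,
            (-(σ : ℂ) * ∑ α : BoundedIndex X D, liouville W r γ.1 α.1 * b θ α) • m r γ.1 =
            -((σ : ℂ) • ∑ α : BoundedIndex X D,
              b θ α • ∑ γ : BoundedIndex X D, liouville W r γ.1 α.1 • m r γ.1) := by
          simp_rw [Finset.smul_sum, Finset.mul_sum, Finset.sum_smul]
          rw [Finset.sum_comm, ← Finset.sum_neg_distrib]
          refine Finset.sum_congr rfl fun α _ => ?_
          rw [← Finset.sum_neg_distrib]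
          refine Finset.sum_congr rfl fun γ _ => ?_
          rw [smul_smul, smul_smul, ← neg_smul]
          congr 1
          ring
        rw [Finset.sum_add_distrib, h1]
        simp_rw [smul_sub]
        rw [Finset.sum_sub_distrib, smul_sub, ← sub_eq_add_neg]
        congr 1
        rw [Finset.smul_sum]
        refine Finset.sum_congr rfl fun α _ => ?_
        rw [smul_comm, Complex.coe_smul]
      rw [hident, norm_smul, Complex.norm_real, Real.norm_eq_abs]
      have h2 : ‖∑ α : BoundedIndex X D, b θ α • (∑' β, W r β • F r β α.1 -
          ∑ γ : BoundedIndex X D, liouville W r γ.1 α.1 • m r γ.1)‖ ≤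
          (δ + (3 / 4) ^ D) * h * (4 * K₁) := by
        refine (norm_sum_le _ _).trans ?_
        refine le_trans (Finset.sum_le_sum (g := fun α : BoundedIndex X D =>
          (δ + (3 / 4) ^ D) * h * (4 * (‖b θ α‖ * (5 / 2 : ℝ) ^ α.1.degree))) fun α _ => ?_) ?_
        · rw [norm_smul]
          have h3 := norm_deriv_sub_liouville_le hW hδ (hm.norm_le r) (t := r) (α := α.1)
            (F := fun β => F r β α.1) (fun β => hFle r β α.1) D
          have h4 : (∑' n, v n) * ((α.1.degree : ℝ) * 2 ^ α.1.degree) ≤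
              h * (4 * (5 / 2) ^ α.1.degree) :=
            mul_le_mul hv (natCast_mul_two_pow_le _) (by positivity) hh
          calc _ ≤ ‖b θ α‖ * ((δ + (3 / 4) ^ D) * (h * (4 * (5 / 2) ^ α.1.degree))) := by
                refine mul_le_mul_of_nonneg_left (h3.trans ?_) (norm_nonneg _)
                exact mul_le_mul_of_nonneg_left h4 (by positivity)
            _ = _ := by ring
        · rw [← Finset.mul_sum, ← Finset.mul_sum]
          refine mul_le_mul_of_nonneg_left ?_ (by positivity)
          exact mul_le_mul_of_nonneg_left (hbound θ hθ) (by norm_num)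
      calc |σ| * ‖_‖ ≤ |σ| * ((δ + (3 / 4) ^ D) * h * (4 * K₁)) :=
            mul_le_mul_of_nonneg_left h2 (abs_nonneg _)
        _ = (|σ| * h) * ((δ + (3 / 4) ^ D) * (4 * K₁)) := by ring
        _ ≤ 1 * ((δ + (3 / 4) ^ D) * (4 * K₁)) :=
            mul_le_mul_of_nonneg_right (by linarith) (by positivity)
        _ ≤ _ := by linarith
    have hmv := (convex_Icc (0 : ℝ) 1).norm_image_sub_le_of_norm_hasDerivWithin_le
      (fun θ _ => (hderiv θ).hasDerivWithinAt) hder_le (right_mem_Icc.2 zero_le_one)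
      (left_mem_Icc.2 zero_le_one)
    have hstart : ∑ γ : BoundedIndex X D, b 0 γ • m (t₁ + 0 * σ) γ.1 = observe (m t₁) B := by
      rw [observe_eq_sum_of_subset _ _ hBsupp, Finset.sum_map, hb0, zero_mul, add_zero]
      rfl
    have hend : ∑ γ : BoundedIndex X D, b 1 γ • m (t₁ + 1 * σ) γ.1 =
        observe (m t₀) (∑ γ : BoundedIndex X D, monomial γ.1 (b 1 γ)) := by
      rw [map_sum, one_mul, hσ, add_sub_cancel]
      exact Finset.sum_congr rfl fun γ _ => (observe_monomial _ _ _).symm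
    rw [hstart, hend] at hmv
    simpa using hmv

/-- Transport of an observable over `k` short time segments. -/
theorem exists_iterated_approx {h : ℝ} (hh : 0 ≤ h) (k : ℕ) :
    ∀ (d : ℕ) (K : ℝ), 0 ≤ K → ∀ ε : ℝ, 0 < ε →
    ∃ C : ℝ, 0 ≤ C ∧ ∀ {X : Type u} [Fintype X] [DecidableEq X]
      (W : ℝ → MultiIndex X → ℂ) (v : ℕ → ℝ), IsBoundedPotential W v → ∑' n, v n ≤ h →
      ∀ t₁ t₀ : ℝ, |t₀ - t₁| * (h + 1) ≤ k * (1 / 5) → ∀ B : MvPolynomial (Idx × X) ℂ,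
      (∀ γ ∈ B.support, γ.degree ≤ d) → coeffNorm B ≤ K →
      ∃ B' : MvPolynomial (Idx × X) ℂ,
        ∀ (E : Type u) [NormedAddCommGroup E] [NormedSpace ℂ E] [CompleteSpace E] (δ : ℝ)
          (m : ℝ → MultiIndex X → E), 0 ≤ δ → IsApproxFlow W δ m →
          ‖observe (m t₁) B - observe (m t₀) B'‖ ≤ ε + C * δ := by
  induction k with
  | zero =>
    intro d K hK ε hε
    refine ⟨0, le_rfl, ?_⟩
    intro X _ _ W v hW hv t₁ t₀ ht B hBd hBK
    refine ⟨B, fun E _ _ _ δ m hδ hm => ?_⟩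
    -- Using `h + 1` instead of `h` makes this valid even when `h = 0`.
    have h0 : |t₀ - t₁| ≤ 0 := by
      have : |t₀ - t₁| * (h + 1) ≤ 0 := by simpa using ht
      nlinarith [abs_nonneg (t₀ - t₁)]
    have : t₀ = t₁ := by
      have := abs_nonpos_iff.1 h0
      linarith
    rw [this, sub_self, norm_zero, zero_mul, add_zero]
    exact hε.le
  | succ k ih =>
    intro d K hK ε hε
    -- The degree and size after one segment are fixed before the volume, the potential and the
    -- observable, so they can be fed to the induction hypothesis.
    obtain ⟨d', K', C₁, hK', hC₁, hstep⟩ :=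
      exists_short_time_approx.{u} hh d hK (half_pos hε)
    obtain ⟨C₂, hC₂, hrest⟩ := ih d' K' hK' (ε / 2) (half_pos hε)
    refine ⟨C₁ + C₂, by positivity, ?_⟩
    intro X _ _ W v hW hv t₁ t₀ ht B hBd hBK
    have hk : (0 : ℝ) < (k : ℝ) + 1 := by positivity
    push_cast at ht
    set τ := t₁ + (t₀ - t₁) / (k + 1) with hτ
    have e1 : |τ - t₁| = |t₀ - t₁| / (k + 1) := by
      rw [hτ, add_sub_cancel_left, abs_div, abs_of_pos hk]
    have e2 : |t₀ - τ| = k * (|t₀ - t₁| / (k + 1)) := by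
      have : t₀ - τ = k * ((t₀ - t₁) / (k + 1)) := by
        rw [hτ]
        field_simp
        ring
      rw [this, abs_mul, abs_div, abs_of_pos hk, Nat.abs_cast]
    have e3 : |t₀ - t₁| / (k + 1) * (h + 1) ≤ 1 / 5 := by
      rw [div_mul_eq_mul_div, div_le_iff₀ hk]
      linarith
    obtain ⟨B₁, hB₁d, hB₁K, hB₁⟩ := hstep W v hW hv t₁ τ (by rw [e1]; exact e3) B hBd hBK
    obtain ⟨B₂, hB₂⟩ := hrest W v hW hv τ t₀ (by
      rw [e2, mul_assoc]
      exact mul_le_mul_of_nonneg_left e3 (by positivity)) B₁ hB₁d hB₁K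
    refine ⟨B₂, fun E _ _ _ δ m hδ hm => ?_⟩
    have h1 := hB₁ E δ m hδ hm
    have h2 := hB₂ E δ m hδ hm
    have h3 := norm_sub_le_norm_sub_add_norm_sub (observe (m t₁) B) (observe (m τ) B₁)
      (observe (m t₀) B₂)
    linarith

end Approximation

end SpinEgorov

namespace SpinEgorov

open MvPolynomial Set

/-! ### The Hamiltonian vector field -/

section ClassicalField

variable {L : Type*} {Λ : Finset L}

/-- The potential restricted to the finite volume `Λ`. -/
noncomputable abbrev localPotential (V : ℝ → MultiIndex L → ℂ) (Λ : Finset L) :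
    ℝ → MultiIndex Λ → ℂ :=
  fun t β => V t (extendIndex Λ β)

theorem observe_monomialValue (M : Config Λ) (A : Poly Λ) :
    observe (fun γ => monomialValue γ M) A = eval (ladder M) A := by
  rw [observe_apply, eval_eq]
  rfl

/-- The vector `e` embeds the scalar classical values into a space of the universe in which
approximate flows are quantified. -/
theorem observe_monomialValue_smul {E : Type*} [NormedAddCommGroup E] [NormedSpace ℂ E] (e : E)
    (M : Config Λ) (A : Poly Λ) :
    observe (fun γ => monomialValue γ M • e) A = eval (ladder M) A • e := by
  rw [← observe_monomialValue, observe_apply, observe_apply, Finset.sum_smul]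
  exact Finset.sum_congr rfl fun γ _ => smul_assoc _ _ _ |>.symm

theorem sum_idx {M : Type*} [AddCommMonoid M] (f : Idx → M) :
    ∑ i, f i = f Idx.plus + (f Idx.z + f Idx.minus) := by
  have : (Finset.univ : Finset Idx) = {Idx.plus, Idx.z, Idx.minus} := rfl
  rw [this, Finset.sum_insert (by decide), Finset.sum_insert (by decide), Finset.sum_singleton]

theorem eval_letterBracket {X 𝒜 : Type*} [DecidableEq X] [Ring 𝒜] [Algebra ℂ 𝒜]
    (S : Idx × X → 𝒜) (p q : Idx × X) :
    (letterBracket p q).eval S =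
      if p.2 = q.2 then ∑ k, (Complex.I * (eps p.1 q.1 k : ℂ)) • S (k, p.2) else 0 := by
  rw [sum_idx]
  simp only [letterBracket]
  split_ifs <;> simp [Expansion.eval, wordProd]

theorem poisson_X {X : Type*} [DecidableEq X] [Fintype X] (A : MvPolynomial (Idx × X) ℂ)
    (q : Idx × X) : poisson A (MvPolynomial.X q) =
      ∑ p, pderiv p A * (letterBracket p q).eval MvPolynomial.X := by
  refine Finset.sum_congr rfl fun p _ => ?_
  rw [Finset.sum_eq_single q]
  · simp
  · intro q' _ hq'
    simp [pderiv_X_of_ne hq'.symm]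
  · simp

theorem poisson_eq_sum {X : Type*} [DecidableEq X] [Fintype X]
    (A B : MvPolynomial (Idx × X) ℂ) :
    poisson A B = ∑ q, pderiv q B * poisson A (MvPolynomial.X q) := by
  simp_rw [poisson_X, Finset.mul_sum]
  rw [poisson, Finset.sum_comm]
  refine Finset.sum_congr rfl fun q _ => Finset.sum_congr rfl fun p _ => ?_
  ring

/-- The coordinates `(M_+, M_z, M_-)` of a vector, as a real-linear map. -/
noncomputable def ladderVec : EuclideanSpace ℝ (Fin 3) →L[ℝ] Idx → ℂ :=
  LinearMap.toContinuousLinearMap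
    { toFun := fun v i => match i with
        | Idx.plus => ((v 0 : ℂ) + Complex.I * (v 1 : ℂ)) / (√2 : ℝ)
        | Idx.z => (v 2 : ℂ)
        | Idx.minus => ((v 0 : ℂ) - Complex.I * (v 1 : ℂ)) / (√2 : ℝ)
      map_add' := by
        intro v w
        funext i
        cases i <;> simp <;> ring
      map_smul' := by
        intro c v
        funext i
        cases i <;> simp <;> ring }

theorem ladder_eq_ladderVec (M : Config Λ) (i : Idx) (x : Λ) :
    ladder M (i, x) = ladderVec (M x) i := by
  cases i <;> rfl

theorem monomialValue_add (α β : MultiIndex Λ) (M : Config Λ) :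
    monomialValue (α + β) M = monomialValue α M * monomialValue β M :=
  Finsupp.prod_add_index' (by simp) fun _ _ _ => pow_add _ _ _

theorem monomialValue_single (p : Idx × Λ) (M : Config Λ) :
    monomialValue (Finsupp.single p 1) M = ladder M p := by
  simp [monomialValue]

variable [DecidableEq L]

theorem eval_monomialBracket_single (β : MultiIndex Λ) (M : Config Λ) (i : Idx) (x : Λ) :
    eval (ladder M) (monomialBracket β (Finsupp.single (i, x) 1)) = ∑ j : Idx, ∑ k : Idx,
      Complex.I * (eps j i k : ℂ) * (β (j, x) : ℂ) *
        (monomialValue (β - Finsupp.single (j, x) 1) M * ladder M (k, x)) := by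
  have hX : (monomial (Finsupp.single (i, x) 1) 1 : Poly Λ) = MvPolynomial.X (i, x) := rfl
  rw [monomialBracket, hX, poisson_X, map_sum, Fintype.sum_prod_type]
  refine Finset.sum_congr rfl fun j _ => ?_
  rw [Finset.sum_eq_single x]
  · rw [eval_letterBracket, if_pos rfl, pderiv_monomial, map_mul, eval_monomial, map_sum,
      Finset.mul_sum]
    refine Finset.sum_congr rfl fun k _ => ?_
    rw [smul_eval, eval_X]
    simp only [monomialValue]
    ring
  · intro y _ hy
    rw [eval_letterBracket, if_neg hy]
    simp
  · simp

/-- Recognizing the field as a sum of Poisson brackets makes the size and degree bounds available to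
it. -/
theorem hamiltonianField_eq (V : ℝ → MultiIndex L → ℂ) (t : ℝ) (M : Config Λ) (i : Idx) (x : Λ) :
    hamiltonianField V Λ t M i x = ∑' β, localPotential V Λ t β •
      eval (ladder M) (monomialBracket β (Finsupp.single (i, x) 1)) := by
  refine tsum_congr fun β => ?_
  rw [eval_monomialBracket_single, smul_eq_mul]
  simp_rw [monomialValue_add, monomialValue_single]

/-- The vector with coordinates `(M_+, M_z, M_-)`. -/
noncomputable def ofLadderVec : (Idx → ℂ) →L[ℝ] EuclideanSpace ℝ (Fin 3) :=
  LinearMap.toContinuousLinearMap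
    { toFun := fun w => !₂[√2 * (w Idx.plus).re, √2 * (w Idx.plus).im, (w Idx.z).re]
      map_add' := by
        intro v w
        ext i
        fin_cases i <;> simp <;> ring
      map_smul' := by
        intro c v
        ext i
        fin_cases i <;> simp <;> ring }

theorem ofLadderVec_ladderVec (v : EuclideanSpace ℝ (Fin 3)) : ofLadderVec (ladderVec v) = v := by
  have h2 : (√2 : ℝ) ≠ 0 := by positivity
  ext i
  fin_cases i <;> simp [ofLadderVec, ladderVec, Complex.div_ofReal_re, Complex.div_ofReal_im] <;>
    field_simp

/-- The hypothesis says that `w` comes from a real vector; without it, passing to three real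
coordinates loses information. -/
theorem ladderVec_ofLadderVec {w : Idx → ℂ} (hw : ∀ i, (starRingEnd ℂ) (w i) = w i.bar) :
    ladderVec (ofLadderVec w) = w := by
  have h2 : (√2 : ℝ) ≠ 0 := by positivity
  have hm : w Idx.minus = (starRingEnd ℂ) (w Idx.plus) := (hw Idx.plus).symm
  have hz : (w Idx.z).im = 0 := Complex.conj_eq_iff_im.1 (hw Idx.z)
  funext i
  cases i
  · apply Complex.ext <;>
      simp [ofLadderVec, ladderVec, Complex.div_ofReal_re, Complex.div_ofReal_im]
  · apply Complex.ext <;> simp [ofLadderVec, ladderVec, hz]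
  · rw [hm]
    apply Complex.ext <;>
      simp [ofLadderVec, ladderVec, Complex.div_ofReal_re, Complex.div_ofReal_im]
    field_simp

theorem inner_eq_ladderVec (v w : EuclideanSpace ℝ (Fin 3)) :
    ((inner ℝ v w : ℝ) : ℂ) = ∑ i, ladderVec v i.bar * ladderVec w i := by
  have h2 : ((√2 : ℝ) : ℂ) ^ 2 = 2 := by
    rw [← Complex.ofReal_pow, Real.sq_sqrt (by norm_num)]
    norm_num
  have h0 : ((√2 : ℝ) : ℂ) ≠ 0 := by
    exact_mod_cast (by positivity : (√2 : ℝ) ≠ 0)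
  rw [sum_idx]
  simp only [ladderVec, LinearMap.coe_toContinuousLinearMap', LinearMap.coe_mk, AddHom.coe_mk,
    Idx.bar, PiLp.inner_apply, Fin.sum_univ_three, RCLike.inner_apply, conj_trivial]
  push_cast
  field_simp
  rw [h2]
  linear_combination (2 * (v 1 : ℂ) * (w 1 : ℂ)) * Complex.I_sq

end ClassicalField

end SpinEgorov

namespace SpinEgorov

open MvPolynomial Set

/-! ### The classical dynamics -/

section ClassicalDynamics

variable {L : Type*} {Λ : Finset L}

theorem norm_ladder_le {M : Config Λ} (hM : M ∈ phaseSpace Λ) (p : Idx × Λ) :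
    ‖ladder M p‖ ≤ 1 := by
  obtain ⟨i, x⟩ := p
  have hx : ‖M x‖ ^ 2 ≤ 1 := pow_le_one₀ (norm_nonneg _) (hM x)
  rw [EuclideanSpace.norm_sq_eq, Fin.sum_univ_three] at hx
  simp only [Real.norm_eq_abs, sq_abs] at hx
  have hsq : ‖ladder M (i, x)‖ ^ 2 ≤ 1 := by
    have h2 : (√2 : ℝ) * √2 = 2 := Real.mul_self_sqrt (by norm_num)
    cases i
    · simp only [ladder]
      rw [norm_div, div_pow, Complex.norm_real, Real.norm_of_nonneg (Real.sqrt_nonneg _),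
        Real.sq_sqrt (by norm_num), ← Complex.normSq_eq_norm_sq, Complex.normSq_apply]
      simp
      nlinarith [sq_nonneg (M x 2), sq_nonneg (M x 0), sq_nonneg (M x 1)]
    · simp only [ladder]
      rw [Complex.norm_real, Real.norm_eq_abs, sq_abs]
      nlinarith [sq_nonneg (M x 0), sq_nonneg (M x 1)]
    · simp only [ladder]
      rw [norm_div, div_pow, Complex.norm_real, Real.norm_of_nonneg (Real.sqrt_nonneg _),
        Real.sq_sqrt (by norm_num), ← Complex.normSq_eq_norm_sq, Complex.normSq_apply]
      simp
      nlinarith [sq_nonneg (M x 2), sq_nonneg (M x 0), sq_nonneg (M x 1)]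
  exact (sq_le_one_iff₀ (norm_nonneg _)).1 hsq

theorem norm_wordProd_le_one {σ : Type*} {f : σ → ℂ} (hf : ∀ p, ‖f p‖ ≤ 1) (w : List σ) :
    ‖wordProd f w‖ ≤ 1 := by
  induction w with
  | nil => simp [wordProd]
  | cons p w ih =>
    rw [wordProd_cons, norm_mul]
    exact mul_le_one₀ (hf p) (norm_nonneg _) ih

/-- Telescoping: the letters are exchanged one at a time. -/
theorem norm_wordProd_sub_le {σ : Type*} {f g : σ → ℂ} (hf : ∀ p, ‖f p‖ ≤ 1)
    (hg : ∀ p, ‖g p‖ ≤ 1) {η : ℝ} (hfg : ∀ p, ‖f p - g p‖ ≤ η) (w : List σ) :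
    ‖wordProd f w - wordProd g w‖ ≤ w.length * η := by
  induction w with
  | nil => simp [wordProd]
  | cons p w ih =>
    rw [wordProd_cons, wordProd_cons]
    have h : f p * wordProd f w - g p * wordProd g w =
        (f p - g p) * wordProd f w + g p * (wordProd f w - wordProd g w) := by ring
    rw [h, List.length_cons]
    refine (norm_add_le _ _).trans ?_
    rw [norm_mul, norm_mul]
    have h1 : ‖f p - g p‖ * ‖wordProd f w‖ ≤ η :=
      (mul_le_of_le_one_right (norm_nonneg _) (norm_wordProd_le_one hf w)).trans (hfg p)
    have h2 : ‖g p‖ * ‖wordProd f w - wordProd g w‖ ≤ w.length * η :=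
      (mul_le_of_le_one_left (norm_nonneg _) (hg p)).trans ih
    push_cast
    linarith

theorem monomialValue_eq_wordProd (γ : MultiIndex Λ) (M : Config Λ) :
    monomialValue γ M = wordProd (ladder M) γ.toMultiset.toList := by
  rw [wordProd, ← Multiset.prod_coe, ← Multiset.map_coe, Multiset.coe_toList,
    prod_map_toMultiset]
  rfl

theorem norm_monomialValue_le {M : Config Λ} (hM : M ∈ phaseSpace Λ) (γ : MultiIndex Λ) :
    ‖monomialValue γ M‖ ≤ 1 := by
  rw [monomialValue_eq_wordProd]
  exact norm_wordProd_le_one (norm_ladder_le hM) _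

theorem norm_eval_le_coeffNorm {M : Config Λ} (hM : M ∈ phaseSpace Λ) (A : Poly Λ) :
    ‖eval (ladder M) A‖ ≤ coeffNorm A := by
  rw [← observe_monomialValue, observe_apply]
  refine (norm_sum_le _ _).trans (Finset.sum_le_sum fun γ _ => ?_)
  rw [norm_smul]
  exact mul_le_of_le_one_right (norm_nonneg _) (norm_monomialValue_le hM γ)

/-- The map of phase space induced by the radial retraction at each site. -/
noncomputable def retractConfig (M : Config Λ) : Config Λ := fun x => retract 1 (M x)

theorem retractConfig_mem (M : Config Λ) : retractConfig M ∈ phaseSpace Λ := fun x =>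
  norm_retract_le one_pos (M x)

theorem retractConfig_of_mem {M : Config Λ} (hM : M ∈ phaseSpace Λ) : retractConfig M = M :=
  funext fun x => retract_of_norm_le one_pos (hM x)

theorem lipschitzWith_retractConfig : LipschitzWith 2 (retractConfig : Config Λ → Config Λ) :=
  LipschitzWith.of_dist_le_mul fun M M' => (dist_pi_le_iff (by positivity)).2 fun x =>
    ((lipschitzWith_retract one_pos).dist_le_mul _ _).trans
      (mul_le_mul_of_nonneg_left (dist_le_pi_dist M M' x) (by positivity))

theorem conjIndex_apply {X : Type*} (γ : MultiIndex X) (i : Idx) (x : X) :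
    conjIndex γ (i, x) = γ (i.bar, x) := by
  have hinj : Function.Injective (Prod.map Idx.bar id : Idx × X → Idx × X) := by
    refine Function.Injective.prodMap ?_ Function.injective_id
    intro a b
    cases a <;> cases b <;> simp [Idx.bar]
  have : ((i, x) : Idx × X) = Prod.map Idx.bar id (i.bar, x) := by
    cases i <;> rfl
  rw [conjIndex, this, Finsupp.mapDomain_apply hinj]

theorem bar_bar (i : Idx) : i.bar.bar = i := by cases i <;> rfl

theorem conjIndex_conjIndex {X : Type*} (γ : MultiIndex X) : conjIndex (conjIndex γ) = γ := by
  ext ⟨i, x⟩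
  rw [conjIndex_apply, conjIndex_apply, bar_bar]

theorem conjIndex_extendIndex (γ : MultiIndex Λ) :
    conjIndex (extendIndex Λ γ) = extendIndex Λ (conjIndex γ) := by
  rw [conjIndex, conjIndex, extendIndex, extendIndex, ← Finsupp.mapDomain_comp,
    ← Finsupp.mapDomain_comp]
  rfl

theorem conj_ladder (M : Config Λ) (p : Idx × Λ) :
    (starRingEnd ℂ) (ladder M p) = ladder M (Prod.map Idx.bar id p) := by
  obtain ⟨i, x⟩ := p
  cases i <;> simp [ladder, Idx.bar, sub_eq_add_neg]

theorem conj_monomialValue (γ : MultiIndex Λ) (M : Config Λ) :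
    (starRingEnd ℂ) (monomialValue γ M) = monomialValue (conjIndex γ) M := by
  rw [monomialValue, monomialValue, conjIndex, Finsupp.prod_mapDomain_index (by simp)
    (fun _ _ _ => pow_add _ _ _), Finsupp.prod, map_prod]
  refine Finset.prod_congr rfl fun p _ => ?_
  rw [map_pow, conj_ladder]

theorem eps_bar (i j k : Idx) : eps i.bar j.bar k.bar = -eps i j k := by
  cases i <;> cases j <;> cases k <;> rfl

theorem sum_bar {M : Type*} [AddCommMonoid M] (f : Idx → M) : ∑ i : Idx, f i.bar = ∑ i, f i := by
  rw [sum_idx, sum_idx]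
  simp only [Idx.bar]
  abel

theorem conjIndex_sub_single [DecidableEq L] (β : MultiIndex Λ) (j : Idx) (x : Λ) :
    conjIndex (β - Finsupp.single (j, x) 1) = conjIndex β - Finsupp.single (j.bar, x) 1 := by
  ext ⟨i, y⟩
  simp only [conjIndex_apply, Finsupp.tsub_apply, Finsupp.single_apply, Prod.mk.injEq]
  congr 1
  have : j = i.bar ↔ j.bar = i := by
    cases i <;> cases j <;> simp [Idx.bar]
  simp [this]

variable [DecidableEq L]

/-- Conjugation changes the sign of `i`, and barring all three indices changes the sign of the
structure constants; the two signs cancel. -/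
theorem conj_eval_monomialBracket_single (β : MultiIndex Λ) (M : Config Λ) (i : Idx) (x : Λ) :
    (starRingEnd ℂ) (eval (ladder M) (monomialBracket β (Finsupp.single (i, x) 1))) =
      eval (ladder M) (monomialBracket (conjIndex β) (Finsupp.single (i.bar, x) 1)) := by
  rw [eval_monomialBracket_single, eval_monomialBracket_single, map_sum]
  conv_rhs => rw [← sum_bar]
  refine Finset.sum_congr rfl fun j _ => ?_
  rw [map_sum]
  conv_rhs => rw [← sum_bar]
  refine Finset.sum_congr rfl fun k _ => ?_
  rw [map_mul, map_mul, map_mul, map_mul, conj_monomialValue, conjIndex_sub_single, conj_ladder,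
    eps_bar, conjIndex_apply, bar_bar, Complex.conj_I, Complex.conj_natCast, map_intCast]
  simp

variable {V : ℝ → MultiIndex L → ℂ} {v : ℕ → ℝ}

theorem conj_hamiltonianField (hreal : ∀ t α, (starRingEnd ℂ) (V t α) = V t (conjIndex α))
    (t : ℝ) (M : Config Λ) (i : Idx) (x : Λ) :
    (starRingEnd ℂ) (hamiltonianField V Λ t M i x) = hamiltonianField V Λ t M i.bar x := by
  rw [hamiltonianField_eq, hamiltonianField_eq, Complex.conj_tsum]
  let e : MultiIndex Λ ≃ MultiIndex Λ :=
    ⟨conjIndex, conjIndex, conjIndex_conjIndex, conjIndex_conjIndex⟩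
  rw [← e.tsum_eq (fun β => localPotential V Λ t β •
      eval (ladder M) (monomialBracket β (Finsupp.single (i.bar, x) 1)))]
  refine tsum_congr fun β => ?_
  rw [smul_eq_mul, smul_eq_mul, map_mul, conj_eval_monomialBracket_single, hreal,
    conjIndex_extendIndex]
  rfl

theorem norm_eval_monomialBracket_le {M : Config Λ} (hM : M ∈ phaseSpace Λ) (β α : MultiIndex Λ) :
    ‖eval (ladder M) (monomialBracket β α)‖ ≤ α.degree * Real.exp β.degree := by
  refine (norm_eval_le_coeffNorm hM _).trans ((coeffNorm_monomialBracket_le β α).trans ?_)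
  have h1 : (overlap β α : ℝ) ≤ β.degree * α.degree := by exact_mod_cast overlap_le β α
  have h2 : (β.degree : ℝ) ≤ Real.exp β.degree := by
    linarith [Real.add_one_le_exp (β.degree : ℝ)]
  nlinarith [(Nat.cast_nonneg α.degree : (0 : ℝ) ≤ α.degree)]

theorem hasSum_hamiltonianField (hW : IsBoundedPotential (localPotential V Λ) v) {M : Config Λ}
    (hM : M ∈ phaseSpace Λ) (t : ℝ) (i : Idx) (x : Λ) :
    HasSum (fun β => localPotential V Λ t β •
      eval (ladder M) (monomialBracket β (Finsupp.single (i, x) 1)))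
      (hamiltonianField V Λ t M i x) := by
  rw [hamiltonianField_eq]
  exact (hW.summable_smul (fun β => norm_eval_monomialBracket_le hM β _) t).hasSum

theorem continuous_hamiltonianField (hW : IsBoundedPotential (localPotential V Λ) v)
    {M : Config Λ} (hM : M ∈ phaseSpace Λ) (i : Idx) (x : Λ) :
    Continuous fun t => hamiltonianField V Λ t M i x := by
  simp_rw [hamiltonianField_eq]
  exact hW.continuous_tsum_smul (fun β => norm_eval_monomialBracket_le hM β _)

/-- The energy is a function on the spheres: the field is tangential. -/
theorem sum_ladder_mul_hamiltonianField (hW : IsBoundedPotential (localPotential V Λ) v)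
    {M : Config Λ} (hM : M ∈ phaseSpace Λ) (t : ℝ) (x : Λ) :
    ∑ i : Idx, ladder M (i.bar, x) * hamiltonianField V Λ t M i x = 0 := by
  have h := hasSum_sum (s := Finset.univ) fun (i : Idx) _ =>
    (hasSum_hamiltonianField hW hM t i x).mul_left (ladder M (i.bar, x))
  rw [← h.tsum_eq]
  -- The sum vanishes for each `β` separately: with the index `j` fixed, the structure constants are
  -- antisymmetric with respect to the pairing of `i` and `ī`.
  refine (tsum_congr fun β => ?_).trans tsum_zero
  simp_rw [eval_monomialBracket_single, smul_eq_mul]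
  simp only [sum_idx, Idx.bar, eps]
  push_cast
  ring

/-- Bracketing `M^β` with one coordinate leaves monomials of degree `|β|`. Telescoping costs the
factor `|β| ≤ e^|β|`, which is absorbed by the potential norm, uniformly in time. -/
theorem norm_hamiltonianField_sub_le (hW : IsBoundedPotential (localPotential V Λ) v)
    {M M' : Config Λ} (hM : M ∈ phaseSpace Λ) (hM' : M' ∈ phaseSpace Λ) (t : ℝ) (i : Idx) (x : Λ)
    {η : ℝ} (hη : ∀ p, ‖ladder M p - ladder M' p‖ ≤ η) :
    ‖hamiltonianField V Λ t M i x - hamiltonianField V Λ t M' i x‖ ≤ (∑' n, v n) * η := by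
  have hη0 : 0 ≤ η := (norm_nonneg _).trans (hη (i, x))
  obtain ⟨a, ha, hsum⟩ := hW.hasSum_overlap_le (Finsupp.single (i, x) 1) t
  have h := (hasSum_hamiltonianField hW hM t i x).sub (hasSum_hamiltonianField hW hM' t i x)
  rw [← h.tsum_eq]
  have hterm : ∀ β, ‖localPotential V Λ t β •
      eval (ladder M) (monomialBracket β (Finsupp.single (i, x) 1)) -
      localPotential V Λ t β • eval (ladder M') (monomialBracket β (Finsupp.single (i, x) 1))‖ ≤
      ‖localPotential V Λ t β‖ * overlap β (Finsupp.single (i, x) 1) * Real.exp β.degree * η := by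
    intro β
    rw [← smul_sub, norm_smul, mul_assoc, mul_assoc]
    refine mul_le_mul_of_nonneg_left ?_ (norm_nonneg _)
    have h1 : ‖eval (ladder M) (monomialBracket β (Finsupp.single (i, x) 1)) -
        eval (ladder M') (monomialBracket β (Finsupp.single (i, x) 1))‖ ≤
        coeffNorm (monomialBracket β (Finsupp.single (i, x) 1)) * (β.degree * η) := by
      rw [← observe_monomialValue, ← observe_monomialValue, observe_apply, observe_apply,
        ← Finset.sum_sub_distrib, coeffNorm, Finset.sum_mul]
      refine (norm_sum_le _ _).trans (Finset.sum_le_sum fun γ hγ => ?_)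
      rw [← smul_sub, norm_smul, monomialValue_eq_wordProd, monomialValue_eq_wordProd]
      refine mul_le_mul_of_nonneg_left ?_ (norm_nonneg _)
      refine (norm_wordProd_sub_le (norm_ladder_le hM) (norm_ladder_le hM') hη _).trans
        (le_of_eq ?_)
      have hd := degree_of_mem_support_monomialBracket hγ
      rw [Finsupp.degree_single] at hd
      rw [Multiset.length_toList, coe_toMultiset_degree, Nat.succ_injective hd]
    refine h1.trans ?_
    have h2 : (β.degree : ℝ) ≤ Real.exp β.degree := by
      linarith [Real.add_one_le_exp (β.degree : ℝ)]
    exact mul_le_mul (coeffNorm_monomialBracket_le _ _)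
      (mul_le_mul_of_nonneg_right h2 hη0) (by positivity) (by positivity)
  refine (tsum_of_norm_bounded (hsum.mul_right η) hterm).trans ?_
  refine mul_le_mul_of_nonneg_right (ha.trans (le_of_eq ?_)) hη0
  simp

end ClassicalDynamics

end SpinEgorov

namespace SpinEgorov

open MvPolynomial Set

/-! ### Well-posedness of the classical flow and its Liouville equation -/

section ClassicalFlow

variable {L : Type*} [DecidableEq L] {Λ : Finset L} {V : ℝ → MultiIndex L → ℂ} {v : ℕ → ℝ}

/-- The Hamiltonian vector field, extended to all configurations by the radial retraction. -/
noncomputable def extendedField (V : ℝ → MultiIndex L → ℂ) (t : ℝ) (M : Config Λ) : Config Λ :=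
  fun x => ofLadderVec fun i => hamiltonianField V Λ t (retractConfig M) i x

theorem continuous_extendedField (hW : IsBoundedPotential (localPotential V Λ) v) (M : Config Λ) :
    Continuous fun t => extendedField V t M :=
  continuous_pi fun x => ofLadderVec.continuous.comp
    (continuous_pi fun i => continuous_hamiltonianField hW (retractConfig_mem M) i x)

theorem exists_lipschitzWith_extendedField (hW : IsBoundedPotential (localPotential V Λ) v) :
    ∃ K : NNReal, ∀ t, LipschitzWith K (extendedField (Λ := Λ) V t) := by
  refine ⟨‖ofLadderVec‖₊ * (((∑' n, v n).toNNReal * ‖ladderVec‖₊) * 2), fun t => ?_⟩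
  refine LipschitzWith.of_dist_le_mul fun M M' => ?_
  have hr := lipschitzWith_retractConfig.dist_le_mul M M'
  refine (dist_pi_le_iff (by positivity)).2 fun x => ?_
  rw [extendedField, extendedField, dist_eq_norm, ← map_sub]
  refine (ofLadderVec.le_opNorm _).trans ?_
  rw [NNReal.coe_mul, mul_assoc]
  refine mul_le_mul_of_nonneg_left ?_ (norm_nonneg _)
  refine (pi_norm_le_iff_of_nonneg (by positivity)).2 fun i => ?_
  have hη : ∀ p, ‖ladder (retractConfig M) p - ladder (retractConfig M') p‖ ≤
      ‖ladderVec‖ * (2 * dist M M') := by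
    rintro ⟨j, y⟩
    rw [ladder_eq_ladderVec, ladder_eq_ladderVec, ← Pi.sub_apply, ← map_sub]
    refine (norm_le_pi_norm _ j).trans ((ladderVec.le_opNorm _).trans ?_)
    refine mul_le_mul_of_nonneg_left ?_ (norm_nonneg _)
    rw [← dist_eq_norm]
    exact (dist_le_pi_dist (retractConfig M) (retractConfig M') y).trans hr
  refine (norm_hamiltonianField_sub_le hW (retractConfig_mem M) (retractConfig_mem M') t i x
    hη).trans (le_of_eq ?_)
  push_cast
  rw [Real.coe_toNNReal _ hW.tsum_nonneg]
  ring

theorem ladderVec_extendedField (hreal : ∀ t α, (starRingEnd ℂ) (V t α) = V t (conjIndex α))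
    (t : ℝ) (M : Config Λ) (x : Λ) :
    ladderVec (extendedField V t M x) =
      fun i => hamiltonianField V Λ t (retractConfig M) i x :=
  ladderVec_ofLadderVec fun i => conj_hamiltonianField hreal t _ i x

/-- The extended field is tangential at the retracted point, and `M x` is a multiple of that point;
hence tangentiality also holds outside phase space. -/
theorem inner_extendedField (hreal : ∀ t α, (starRingEnd ℂ) (V t α) = V t (conjIndex α))
    (hW : IsBoundedPotential (localPotential V Λ) v) (t : ℝ) (M : Config Λ) (x : Λ) :
    inner ℝ (M x) (extendedField V t M x) = 0 := by
  have hM : M x = max 1 ‖M x‖ • retractConfig M x := by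
    have h : 0 < max 1 ‖M x‖ := lt_max_of_lt_left one_pos
    rw [retractConfig, retract, smul_smul, mul_one_div_cancel h.ne', one_smul]
  have h0 : inner ℝ (retractConfig M x) (extendedField V t M x) = 0 := by
    have h1 := inner_eq_ladderVec (retractConfig M x) (extendedField V t M x)
    rw [ladderVec_extendedField hreal] at h1
    have h2 := sum_ladder_mul_hamiltonianField hW (retractConfig_mem M) t x
    simp_rw [ladder_eq_ladderVec] at h2
    rw [h2] at h1
    exact_mod_cast h1
  rw [hM, inner_smul_left, h0, mul_zero]

theorem IsClassicalSolution.hasDerivAt_config {M₀ : Config Λ} {M : ℝ → Config Λ}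
    (hM : IsClassicalSolution V Λ M₀ M) (t : ℝ) : HasDerivAt M (extendedField V t (M t)) t := by
  refine hasDerivAt_pi.2 fun x => ?_
  have h1 : HasDerivAt (fun r => ladderVec (M r x))
      (fun i => hamiltonianField V Λ t (M t) i x) t := by
    refine hasDerivAt_pi.2 fun i => ?_
    have := hM.hasDerivAt t i x
    simp_rw [ladder_eq_ladderVec] at this
    exact this
  have h2 := ofLadderVec.hasFDerivAt.comp_hasDerivAt t h1
  rw [extendedField, retractConfig_of_mem (hM.mem_phaseSpace t)]
  refine h2.congr_of_eventuallyEq (Filter.Eventually.of_forall fun r => ?_)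
  exact (ofLadderVec_ladderVec _).symm

/-- The classical equations of motion are well posed on phase space. -/
theorem existsUnique_classicalSolution
    (hreal : ∀ t α, (starRingEnd ℂ) (V t α) = V t (conjIndex α))
    (hW : IsBoundedPotential (localPotential V Λ) v) {M₀ : Config Λ} (hM₀ : M₀ ∈ phaseSpace Λ) :
    ∃! M : ℝ → Config Λ, IsClassicalSolution V Λ M₀ M := by
  obtain ⟨K, hK⟩ := exists_lipschitzWith_extendedField hW
  obtain ⟨M, hM0, hM⟩ := exists_global_solution (continuous_extendedField hW)
    (fun _ => ⟨K, fun t _ => hK t⟩) M₀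
  -- Each spin length is conserved, so the solution stays in phase space, where the extension equals
  -- the original field.
  have hmem : ∀ t, M t ∈ phaseSpace Λ := by
    intro t x
    have hd : ∀ r, HasDerivAt (fun r => ‖M r x‖ ^ 2) 0 r := by
      intro r
      have := (hasDerivAt_pi.1 (hM r) x).norm_sq
      rwa [inner_extendedField hreal hW, mul_zero] at this
    have hconst := is_const_of_deriv_eq_zero (fun r => (hd r).differentiableAt)
      (fun r => (hd r).deriv) t 0
    simp only [hM0] at hconst
    have h1 : ‖M₀ x‖ ^ 2 ≤ 1 := pow_le_one₀ (norm_nonneg _) (hM₀ x)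
    rw [← hconst] at h1
    exact (sq_le_one_iff₀ (norm_nonneg _)).1 h1
  refine ⟨M, ⟨hM0, hmem, fun t i x => ?_⟩, fun M' hM' => ?_⟩
  · have h1 := ladderVec.hasFDerivAt.comp_hasDerivAt t (hasDerivAt_pi.1 (hM t) x)
    rw [ladderVec_extendedField hreal, retractConfig_of_mem (hmem t)] at h1
    have h2 := hasDerivAt_pi.1 h1 i
    simp_rw [ladder_eq_ladderVec]
    exact h2
  · refine ODE_solution_unique_univ (v := extendedField V) (s := fun _ => univ) (K := K) (t₀ := 0)
      (fun t => (hK t).lipschitzOnWith)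
      (fun t => ⟨hM'.hasDerivAt_config t, mem_univ _⟩) (fun t => ⟨hM t, mem_univ _⟩) ?_
    rw [hM0, hM'.initial]

theorem hasDerivAt_eval {σ : Type*} [Fintype σ] {y : ℝ → σ → ℂ} {y' : σ → ℂ} {t : ℝ}
    (hy : ∀ p, HasDerivAt (fun r => y r p) (y' p) t) (A : MvPolynomial σ ℂ) :
    HasDerivAt (fun r => eval (y r) A) (∑ p, eval (y t) (pderiv p A) * y' p) t := by
  classical
  induction A using MvPolynomial.induction_on with
  | C a => simpa using hasDerivAt_const t a
  | add A B hA hB =>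
    simp only [map_add, add_mul, Finset.sum_add_distrib]
    exact hA.add hB
  | mul_X A q hA =>
    have h := hA.mul (hy q)
    simp only [map_mul, eval_X]
    refine h.congr_deriv ?_
    symm
    simp only [Derivation.leibniz, smul_eq_mul, map_add, map_mul, eval_X, add_mul,
      Finset.sum_add_distrib, Finset.sum_mul]
    rw [Finset.sum_eq_single q]
    · rw [add_comm]
      simp only [pderiv_X_self, map_one, mul_one]
      congr 1
      exact Finset.sum_congr rfl fun p _ => by ring
    · intro p _ hp
      simp [pderiv_X_of_ne hp.symm]
    · simp

/-- Monomials evaluated along a classical solution form an exact flow. -/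
theorem IsClassicalSolution.isApproxFlow (hW : IsBoundedPotential (localPotential V Λ) v)
    {M₀ : Config Λ} {M : ℝ → Config Λ} (hM : IsClassicalSolution V Λ M₀ M) {E : Type*}
    [NormedAddCommGroup E] [NormedSpace ℂ E] {e : E} (he : ‖e‖ = 1) :
    IsApproxFlow (localPotential V Λ) 0 fun t γ => monomialValue γ (M t) • e := by
  refine ⟨fun t γ => ?_, fun t β α => eval (ladder (M t)) (monomialBracket β α) • e,
    fun t α => ?_, fun t β α => ?_⟩
  · rw [norm_smul, he, mul_one]
    exact (norm_monomialValue_le (hM.mem_phaseSpace t) γ).trans (one_le_pow₀ (by norm_num))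
  · have h1 := hasDerivAt_eval (fun p : Idx × Λ => hM.hasDerivAt t p.1 p.2) (monomial α 1)
    have h2 : HasSum (fun β => localPotential V Λ t β •
        eval (ladder (M t)) (monomialBracket β α))
        (∑ p : Idx × Λ, eval (ladder (M t)) (pderiv p (monomial α 1)) *
          hamiltonianField V Λ t (M t) p.1 p.2) := by
      -- The chain rule gives a finite combination of the series for the coordinates; expanding the
      -- Poisson bracket in its second argument reassembles `{M^β, M^α}` term by term.
      have h3 := hasSum_sum (s := Finset.univ) fun (p : Idx × Λ) _ =>
        (hasSum_hamiltonianField hW (hM.mem_phaseSpace t) t p.1 p.2).mul_left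
          (eval (ladder (M t)) (pderiv p (monomial α 1)))
      refine h3.congr_fun fun β => ?_
      rw [monomialBracket, poisson_eq_sum, map_sum, Finset.smul_sum]
      refine Finset.sum_congr rfl fun p _ => ?_
      rw [map_mul, smul_eq_mul, smul_eq_mul, mul_left_comm]
      rfl
    have h4 := h2.smul_const e
    simp only [smul_assoc] at h4
    rw [h4.tsum_eq]
    refine (h1.congr_of_eventuallyEq (Filter.Eventually.of_forall fun r => ?_)).smul_const e
    simp only [eval_monomial, one_mul]
    rfl
  · rw [observe_monomialValue_smul, sub_self, norm_zero, zero_mul]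

end ClassicalFlow

end SpinEgorov

namespace SpinEgorov

open Matrix

/-! ### The spin algebra -/

section SpinAlgebra

/-! ### Operators acting at one site -/

section Site

variable {X : Type*} [Fintype X] [DecidableEq X] {n : ℕ}

theorem siteMatrix_mul_same (x : X) (S T : Matrix (Fin (n + 1)) (Fin (n + 1)) ℂ) :
    siteMatrix x S * siteMatrix x T = siteMatrix x (S * T) := by
  ext σ τ
  rw [Matrix.mul_apply]
  have hsub : ∑ ρ, siteMatrix x S σ ρ * siteMatrix x T ρ τ =
      ∑ a, siteMatrix x S σ (Function.update σ x a) *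
        siteMatrix x T (Function.update σ x a) τ := by
    refine (Finset.sum_of_injOn (fun a => Function.update σ x a)
      (fun a _ b _ hab => Function.update_injective σ x hab) (fun _ _ => Finset.mem_coe.2
        (Finset.mem_univ _)) (fun ρ _ hρ => ?_) fun _ _ => rfl).symm
    have : ¬ ∀ y, y ≠ x → σ y = ρ y := by
      intro h
      refine hρ ⟨ρ x, Finset.mem_coe.2 (Finset.mem_univ _), ?_⟩
      funext y
      by_cases hy : y = x
      · subst hy
        simp
      · simp [hy, h y hy]
    simp only [siteMatrix]
    rw [if_neg this, zero_mul]
  rw [hsub]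
  have h1 : ∀ a, siteMatrix x S σ (Function.update σ x a) = S (σ x) a := by
    intro a
    have : ∀ y, y ≠ x → σ y = Function.update σ x a y := fun y hy => by
      rw [Function.update_of_ne hy]
    simp only [siteMatrix]
    rw [if_pos this, Function.update_self]
  have h2 : ∀ a, siteMatrix x T (Function.update σ x a) τ =
      if ∀ y, y ≠ x → σ y = τ y then T a (τ x) else 0 := by
    intro a
    simp only [siteMatrix, Function.update_self]
    refine if_congr ⟨fun h y hy => ?_, fun h y hy => ?_⟩ rfl rfl
    · have := h y hy
      rwa [Function.update_of_ne hy] at this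
    · rw [Function.update_of_ne hy]
      exact h y hy
  simp only [h1, h2]
  simp only [siteMatrix, Matrix.mul_apply]
  split_ifs <;> simp

theorem siteMatrix_add (x : X) (S T : Matrix (Fin (n + 1)) (Fin (n + 1)) ℂ) :
    siteMatrix x (S + T) = siteMatrix x S + siteMatrix x T := by
  ext σ τ
  simp only [siteMatrix, Matrix.add_apply]
  split_ifs <;> simp

theorem siteMatrix_smul (x : X) (c : ℂ) (S : Matrix (Fin (n + 1)) (Fin (n + 1)) ℂ) :
    siteMatrix x (c • S) = c • siteMatrix x S := by
  ext σ τ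
  simp only [siteMatrix, Matrix.smul_apply]
  split_ifs <;> simp

theorem siteMatrix_conjTranspose (x : X) (S : Matrix (Fin (n + 1)) (Fin (n + 1)) ℂ) :
    (siteMatrix x S)ᴴ = siteMatrix x Sᴴ := by
  ext σ τ
  simp only [siteMatrix, Matrix.conjTranspose_apply]
  rw [apply_ite star, star_zero]
  exact if_congr ⟨fun h y hy => (h y hy).symm, fun h y hy => (h y hy).symm⟩ rfl rfl

theorem siteMatrix_diagonal (x : X) (d : Fin (n + 1) → ℂ) :
    siteMatrix x (Matrix.diagonal d) = Matrix.diagonal fun σ : X → Fin (n + 1) => d (σ x) := by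
  ext σ τ
  by_cases h : σ = τ
  · subst h
    simp [siteMatrix]
  · rw [Matrix.diagonal_apply_ne _ h]
    simp only [siteMatrix]
    split_ifs with h1
    · refine Matrix.diagonal_apply_ne _ fun h2 => h (funext fun y => ?_)
      by_cases hy : y = x
      · rw [hy, h2]
      · exact h1 y hy
    · rfl

end Site

theorem raising_mul_conjTranspose (n : ℕ) :
    raising n * (raising n)ᴴ =
      Matrix.diagonal fun a : Fin (n + 1) => (((a : ℕ) : ℂ) + 1) * ((n : ℂ) - (a : ℕ)) := by
  ext a a'
  rw [Matrix.mul_apply]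
  by_cases h : a = a'
  · subst h
    rw [Matrix.diagonal_apply_eq]
    by_cases ha : (a : ℕ) + 1 < n + 1
    · rw [Finset.sum_eq_single (⟨(a : ℕ) + 1, ha⟩ : Fin (n + 1))]
      · simp only [raising, Matrix.conjTranspose_apply, if_true]
        have h0 : (0 : ℝ) ≤ (((a : ℕ) + 1 : ℕ) : ℝ) * ((n : ℝ) + 1 - (((a : ℕ) + 1 : ℕ) : ℝ)) := by
          refine mul_nonneg (by positivity) ?_
          have : (((a : ℕ) + 1 : ℕ) : ℝ) ≤ n := by exact_mod_cast Nat.lt_succ_iff.1 ha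
          linarith
        rw [Complex.star_def, Complex.conj_ofReal, ← Complex.ofReal_mul, Real.mul_self_sqrt h0]
        push_cast
        ring
      · intro b _ hb
        have : (a : ℕ) + 1 ≠ b := fun h => hb (Fin.ext h.symm)
        simp [raising, this]
      · simp
    -- At `a = n` there is no higher weight: the row of `raising` is zero, and so is the factor `n -
    -- a`.
    · rw [Finset.sum_eq_zero]
      · have : (a : ℕ) = n := by omega
        simp [this]
      · intro b _
        have : (a : ℕ) + 1 ≠ b := by omega
        simp [raising, this]
  · rw [Matrix.diagonal_apply_ne _ h]
    refine Finset.sum_eq_zero fun b _ => ?_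
    simp only [raising, Matrix.conjTranspose_apply]
    by_cases h1 : (a : ℕ) + 1 = b
    · have h2 : ¬ (a' : ℕ) + 1 = b := fun h2 => h (Fin.ext (by omega))
      simp [h2]
    · simp [h1]

theorem conjTranspose_mul_raising (n : ℕ) :
    (raising n)ᴴ * raising n =
      Matrix.diagonal fun a : Fin (n + 1) => ((a : ℕ) : ℂ) * ((n : ℂ) + 1 - (a : ℕ)) := by
  ext a a'
  rw [Matrix.mul_apply]
  by_cases h : a = a'
  · subst h
    rw [Matrix.diagonal_apply_eq]
    by_cases ha : 0 < (a : ℕ)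
    · rw [Finset.sum_eq_single (⟨(a : ℕ) - 1, by omega⟩ : Fin (n + 1))]
      · have h1 : (a : ℕ) - 1 + 1 = a := by omega
        simp only [raising, Matrix.conjTranspose_apply, h1, if_true]
        have h0 : (0 : ℝ) ≤ ((a : ℕ) : ℝ) * ((n : ℝ) + 1 - ((a : ℕ) : ℝ)) := by
          refine mul_nonneg (by positivity) ?_
          have : ((a : ℕ) : ℝ) ≤ n := by exact_mod_cast Nat.lt_succ_iff.1 a.2
          linarith
        rw [Complex.star_def, Complex.conj_ofReal, ← Complex.ofReal_mul, Real.mul_self_sqrt h0]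
        push_cast
        ring
      · intro b _ hb
        have : (b : ℕ) + 1 ≠ a := fun h => hb (Fin.ext (by simp; omega))
        simp [raising, this]
      · simp
    · rw [Finset.sum_eq_zero]
      · have : (a : ℕ) = 0 := by omega
        simp [this]
      · intro b _
        have : (b : ℕ) + 1 ≠ a := by omega
        simp [raising, this]
  · rw [Matrix.diagonal_apply_ne _ h]
    refine Finset.sum_eq_zero fun b _ => ?_
    simp only [raising, Matrix.conjTranspose_apply]
    by_cases h1 : (b : ℕ) + 1 = a
    · have h2 : ¬ (b : ℕ) + 1 = a' := fun h2 => h (Fin.ext (by omega))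
      simp [h2]
    · simp [h1]

/-- The generator `S_3`. -/
theorem generator_two (n : ℕ) :
    generator n 2 = Matrix.diagonal fun a : Fin (n + 1) => ((n : ℂ) / 2 - (a : ℕ)) := rfl

theorem raising_commutator (n : ℕ) :
    raising n * (raising n)ᴴ - (raising n)ᴴ * raising n = (2 : ℂ) • generator n 2 := by
  rw [raising_mul_conjTranspose, conjTranspose_mul_raising, generator_two, Matrix.diagonal_sub,
    ← Matrix.diagonal_smul]
  congr 1
  funext a
  simp only [Pi.smul_apply, smul_eq_mul]
  ring

theorem generator_two_raising (n : ℕ) :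
    generator n 2 * raising n - raising n * generator n 2 = raising n := by
  ext a b
  rw [generator_two, Matrix.sub_apply, Matrix.diagonal_mul, Matrix.mul_diagonal]
  by_cases h : (a : ℕ) + 1 = b
  · have : ((b : ℕ) : ℂ) = (a : ℕ) + 1 := by exact_mod_cast h.symm
    rw [this]
    ring
  · simp [raising, h]

theorem generator_two_conjTranspose (n : ℕ) : (generator n 2)ᴴ = generator n 2 := by
  rw [generator_two, Matrix.diagonal_conjTranspose]
  congr 1
  funext a
  simp

theorem generator_two_lowering (n : ℕ) :
    generator n 2 * (raising n)ᴴ - (raising n)ᴴ * generator n 2 = -(raising n)ᴴ := by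
  have h := congrArg Matrix.conjTranspose (generator_two_raising n)
  rw [Matrix.conjTranspose_sub, Matrix.conjTranspose_mul, Matrix.conjTranspose_mul,
    generator_two_conjTranspose] at h
  rw [← neg_sub, h]

theorem spinMatrix_plus (n : ℕ) :
    spinMatrix n Idx.plus = (((√2 : ℝ) : ℂ)⁻¹ * ((n : ℂ) / 2)⁻¹) • raising n := by
  have h : rescaledSpin n 0 + Complex.I • rescaledSpin n 1 = ((n : ℂ) / 2)⁻¹ • raising n := by
    simp only [rescaledSpin, generator]
    rw [smul_comm Complex.I, ← smul_add]
    congr 1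
    simp only [Matrix.cons_val_zero, Matrix.cons_val_one, smul_smul]
    have : Complex.I * (1 / (2 * Complex.I)) = 1 / 2 := by
      field_simp [Complex.I_ne_zero]
    rw [this, ← smul_add]
    ext a b
    simp only [Matrix.smul_apply, Matrix.add_apply, Matrix.sub_apply, smul_eq_mul]
    ring
  rw [spinMatrix, h, smul_smul]

theorem spinMatrix_minus (n : ℕ) :
    spinMatrix n Idx.minus = (((√2 : ℝ) : ℂ)⁻¹ * ((n : ℂ) / 2)⁻¹) • (raising n)ᴴ := by
  have h : rescaledSpin n 0 - Complex.I • rescaledSpin n 1 = ((n : ℂ) / 2)⁻¹ • (raising n)ᴴ := by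
    simp only [rescaledSpin, generator]
    rw [smul_comm Complex.I, ← smul_sub]
    congr 1
    simp only [Matrix.cons_val_zero, Matrix.cons_val_one, smul_smul]
    have : Complex.I * (1 / (2 * Complex.I)) = 1 / 2 := by
      field_simp [Complex.I_ne_zero]
    rw [this, ← smul_sub]
    ext a b
    simp only [Matrix.smul_apply, Matrix.add_apply, Matrix.sub_apply, smul_eq_mul]
    ring
  rw [spinMatrix, h, smul_smul]

theorem spinMatrix_z (n : ℕ) : spinMatrix n Idx.z = ((n : ℂ) / 2)⁻¹ • generator n 2 := rfl

theorem inv_sqrt_two_mul_self : ((√2 : ℝ) : ℂ)⁻¹ * ((√2 : ℝ) : ℂ)⁻¹ = 1 / 2 := by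
  rw [← mul_inv, ← Complex.ofReal_mul, Real.mul_self_sqrt (by norm_num)]
  norm_num

/-- The commutation relations `[S_i, S_j] = s⁻¹ ∑_k ε̃_{ijk} S_k`. -/
theorem spinMatrix_commutator {n : ℕ} (hn : 1 ≤ n) (i j : Idx) :
    ((n : ℂ) / 2) • (spinMatrix n i * spinMatrix n j - spinMatrix n j * spinMatrix n i) =
      ∑ k, (eps i j k : ℂ) • spinMatrix n k := by
  have hs : ((n : ℂ) / 2) ≠ 0 := by
    have : (n : ℂ) ≠ 0 := by exact_mod_cast (by omega : n ≠ 0)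
    exact div_ne_zero this two_ne_zero
  have hpm : ((n : ℂ) / 2) • (spinMatrix n Idx.plus * spinMatrix n Idx.minus -
      spinMatrix n Idx.minus * spinMatrix n Idx.plus) = spinMatrix n Idx.z := by
    rw [spinMatrix_plus, spinMatrix_minus, spinMatrix_z]
    simp only [smul_mul_smul_comm]
    rw [← smul_sub, raising_commutator, smul_smul, smul_smul]
    congr 1
    have h2 := inv_sqrt_two_mul_self
    generalize ((√2 : ℝ) : ℂ)⁻¹ = q at h2
    calc _ = (q * q) * 2 * ((n : ℂ) / 2 * ((n : ℂ) / 2)⁻¹) * ((n : ℂ) / 2)⁻¹ := by ring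
      _ = _ := by rw [h2, mul_inv_cancel₀ hs]; ring
  have hzp : ((n : ℂ) / 2) • (spinMatrix n Idx.z * spinMatrix n Idx.plus -
      spinMatrix n Idx.plus * spinMatrix n Idx.z) = spinMatrix n Idx.plus := by
    rw [spinMatrix_plus, spinMatrix_z]
    simp only [smul_mul_smul_comm]
    rw [mul_comm (((n : ℂ) / 2)⁻¹) (_ * _), ← smul_sub, generator_two_raising, smul_smul]
    congr 1
    field_simp
  have hzm : ((n : ℂ) / 2) • (spinMatrix n Idx.z * spinMatrix n Idx.minus -
      spinMatrix n Idx.minus * spinMatrix n Idx.z) = -spinMatrix n Idx.minus := by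
    rw [spinMatrix_minus, spinMatrix_z]
    simp only [smul_mul_smul_comm]
    rw [mul_comm (((n : ℂ) / 2)⁻¹) (_ * _), ← smul_sub, generator_two_lowering, smul_smul,
      smul_neg]
    congr 2
    field_simp
  have hanti : ∀ a b : Idx, ((n : ℂ) / 2) •
      (spinMatrix n a * spinMatrix n b - spinMatrix n b * spinMatrix n a) =
      -(((n : ℂ) / 2) •
        (spinMatrix n b * spinMatrix n a - spinMatrix n a * spinMatrix n b)) := by
    intro a b
    rw [← smul_neg, neg_sub]
  rw [sum_idx]
  cases i <;> cases j <;> simp only [eps, Int.cast_zero, Int.cast_one, Int.cast_neg, zero_smul,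
    one_smul, neg_smul, add_zero, zero_add, sub_self, smul_zero]
  · rw [hanti, hzp]
  · exact hpm
  · exact hzp
  · exact hzm
  · rw [hanti, hpm]
  · rw [hanti, hzm, neg_neg]

end SpinAlgebra

end SpinEgorov

namespace SpinEgorov

open Matrix

/-! ### Spin operators -/

section SpinOperators

variable {L : Type*} [DecidableEq L] {Λ : Finset L} {n : ℕ}

/-- The factor `i s` is the one for which the commutator of letters has exactly the Poisson bracket
expansion, so `wordBracket` can be read in spin operators. -/
theorem spinOp_commutator (hn : 1 ≤ n) (p q : Idx × Λ) :
    (Complex.I * ((n : ℂ) / 2)) • (spinOp Λ n p * spinOp Λ n q - spinOp Λ n q * spinOp Λ n p) =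
      (letterBracket p q).eval (spinOp Λ n) := by
  obtain ⟨i, x⟩ := p
  obtain ⟨j, y⟩ := q
  rw [eval_letterBracket]
  by_cases hxy : x = y
  · subst hxy
    rw [if_pos rfl]
    simp only [spinOp, ← map_mul, ← map_sub, ← map_smul, ← map_sum]
    congr 1
    have hsub : siteMatrix x (spinMatrix n i) * siteMatrix x (spinMatrix n j) -
        siteMatrix x (spinMatrix n j) * siteMatrix x (spinMatrix n i) =
        siteMatrix x (spinMatrix n i * spinMatrix n j - spinMatrix n j * spinMatrix n i) := by
      rw [siteMatrix_mul_same, siteMatrix_mul_same, sub_eq_add_neg, sub_eq_add_neg,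
        siteMatrix_add, ← neg_one_smul ℂ (spinMatrix n j * spinMatrix n i), siteMatrix_smul,
        neg_one_smul]
    rw [hsub, mul_smul, ← siteMatrix_smul, spinMatrix_commutator hn, sum_idx, sum_idx,
      siteMatrix_add, siteMatrix_add]
    simp only [siteMatrix_smul, smul_add, mul_smul]
  · rw [if_neg hxy]
    have : siteMatrix x (spinMatrix n i) * siteMatrix y (spinMatrix n j) =
        siteMatrix y (spinMatrix n j) * siteMatrix x (spinMatrix n i) := by
      ext σ τ
      rw [siteMatrix_mul_apply hxy, siteMatrix_mul_apply (Ne.symm hxy)]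
      refine if_congr ⟨fun h w a b => h w b a, fun h w a b => h w b a⟩ (mul_comm _ _) rfl
    have hcomm : spinOp Λ n (i, x) * spinOp Λ n (j, y) =
        spinOp Λ n (j, y) * spinOp Λ n (i, x) := by
      simp only [spinOp, ← map_mul]
      rw [this]
    rw [hcomm, sub_self, smul_zero]

theorem spinMatrix_conjTranspose (n : ℕ) (i : Idx) :
    (spinMatrix n i)ᴴ = spinMatrix n i.bar := by
  have hc : star (((√2 : ℝ) : ℂ)⁻¹ * ((n : ℂ) / 2)⁻¹) = ((√2 : ℝ) : ℂ)⁻¹ * ((n : ℂ) / 2)⁻¹ := by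
    simp
  have hc' : star (((n : ℂ) / 2)⁻¹) = ((n : ℂ) / 2)⁻¹ := by
    simp
  cases i
  · show (spinMatrix n Idx.plus)ᴴ = spinMatrix n Idx.minus
    rw [spinMatrix_plus, spinMatrix_minus, Matrix.conjTranspose_smul, hc]
  · show (spinMatrix n Idx.z)ᴴ = spinMatrix n Idx.z
    rw [spinMatrix_z, Matrix.conjTranspose_smul, hc', generator_two_conjTranspose]
  · show (spinMatrix n Idx.minus)ᴴ = spinMatrix n Idx.plus
    rw [spinMatrix_plus, spinMatrix_minus, Matrix.conjTranspose_smul, hc,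
      Matrix.conjTranspose_conjTranspose]

theorem star_spinOp (p : Idx × Λ) :
    star (spinOp Λ n p) = spinOp Λ n (Prod.map Idx.bar id p) := by
  rw [spinOp, spinOp, ← map_star, Matrix.star_eq_conjTranspose, siteMatrix_conjTranspose,
    spinMatrix_conjTranspose]
  rfl

open scoped Matrix.Norms.L2Operator in
theorem norm_toEuclideanCLM_diagonal_le {ι : Type*} [Fintype ι] [DecidableEq ι] {d : ι → ℂ}
    {c : ℝ} (hc : 0 ≤ c) (hd : ∀ a, ‖d a‖ ≤ c) :
    ‖Matrix.toEuclideanCLM (𝕜 := ℂ) (n := ι) (Matrix.diagonal d)‖ ≤ c := by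
  rw [Matrix.l2_opNorm_toEuclideanCLM, Matrix.l2_opNorm_diagonal]
  exact (pi_norm_le_iff_of_nonneg hc).2 hd

/-- By the C*-identity it suffices to bound `S_+ S_+*`, which is diagonal with entries `(2 / n²) (a
+ 1) (n - a) ≤ 2`. -/
theorem norm_spinOp_plus_le (hn : 1 ≤ n) (x : Λ) : ‖spinOp Λ n (Idx.plus, x)‖ ≤ 3 / 2 := by
  have hn' : (1 : ℝ) ≤ n := by exact_mod_cast hn
  have h1 : spinOp Λ n (Idx.plus, x) * star (spinOp Λ n (Idx.plus, x)) =
      Matrix.toEuclideanCLM (𝕜 := ℂ) (n := Λ → Fin (n + 1)) (Matrix.diagonal fun σ =>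
        ((√2 : ℝ) : ℂ)⁻¹ * ((n : ℂ) / 2)⁻¹ * (((√2 : ℝ) : ℂ)⁻¹ * ((n : ℂ) / 2)⁻¹) *
          ((((σ x : ℕ) : ℂ) + 1) * ((n : ℂ) - (σ x : ℕ)))) := by
    rw [star_spinOp, spinOp, spinOp, ← map_mul]
    congr 1
    show siteMatrix x (spinMatrix n Idx.plus) * siteMatrix x (spinMatrix n Idx.minus) = _
    rw [siteMatrix_mul_same, spinMatrix_plus, spinMatrix_minus, smul_mul_smul_comm,
      raising_mul_conjTranspose, siteMatrix_smul, siteMatrix_diagonal, ← Matrix.diagonal_smul]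
    rfl
  have h2 : ‖spinOp Λ n (Idx.plus, x)‖ * ‖spinOp Λ n (Idx.plus, x)‖ ≤ 2 := by
    rw [← CStarRing.norm_self_mul_star, h1]
    refine norm_toEuclideanCLM_diagonal_le (by norm_num) fun σ => ?_
    have hq := inv_sqrt_two_mul_self
    have hσ : ((σ x : ℕ) : ℝ) ≤ n := by exact_mod_cast Nat.lt_succ_iff.1 (σ x).2
    have hval : ((√2 : ℝ) : ℂ)⁻¹ * ((n : ℂ) / 2)⁻¹ * (((√2 : ℝ) : ℂ)⁻¹ * ((n : ℂ) / 2)⁻¹) *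
        ((((σ x : ℕ) : ℂ) + 1) * ((n : ℂ) - (σ x : ℕ))) =
        ((2 / (n : ℝ) ^ 2 * ((((σ x : ℕ) : ℝ) + 1) * ((n : ℝ) - (σ x : ℕ))) : ℝ) : ℂ) := by
      push_cast
      generalize ((√2 : ℝ) : ℂ)⁻¹ = q at hq
      have hn0 : (n : ℂ) ≠ 0 := by exact_mod_cast (by omega : n ≠ 0)
      calc _ = (q * q) * (((n : ℂ) / 2)⁻¹ * ((n : ℂ) / 2)⁻¹) *
            ((((σ x : ℕ) : ℂ) + 1) * ((n : ℂ) - (σ x : ℕ))) := by ring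
        _ = _ := by
          rw [hq]
          field_simp
    rw [hval, Complex.norm_real, Real.norm_of_nonneg (by
      refine mul_nonneg (by positivity) (mul_nonneg (by positivity) (by linarith)))]
    have hle : (((σ x : ℕ) : ℝ) + 1) * ((n : ℝ) - (σ x : ℕ)) ≤ (n : ℝ) ^ 2 := by
      rcases Nat.lt_or_ge (σ x : ℕ) n with h | h
      · have h' : ((σ x : ℕ) : ℝ) + 1 ≤ n := by exact_mod_cast h
        have h0 : (0 : ℝ) ≤ ((σ x : ℕ) : ℝ) := by positivity
        nlinarith
      · have h' : (n : ℝ) ≤ (σ x : ℕ) := by exact_mod_cast h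
        nlinarith [sq_nonneg (n : ℝ)]
    rw [div_mul_eq_mul_div, div_le_iff₀ (by positivity)]
    linarith
  nlinarith [norm_nonneg (spinOp Λ n (Idx.plus, x))]

/-- The rescaled ladder operators have norm at most `√2`, attained for spin `1/2`. -/
theorem norm_spinOp_le (hn : 1 ≤ n) (p : Idx × Λ) : ‖spinOp Λ n p‖ ≤ 3 / 2 := by
  obtain ⟨i, x⟩ := p
  cases i
  · exact norm_spinOp_plus_le hn x
  · have hn' : (1 : ℝ) ≤ n := by exact_mod_cast hn
    rw [spinOp]
    show ‖Matrix.toEuclideanCLM (𝕜 := ℂ) (n := Λ → Fin (n + 1))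
      (siteMatrix x (spinMatrix n Idx.z))‖ ≤ _
    rw [spinMatrix_z, generator_two, siteMatrix_smul, siteMatrix_diagonal,
      ← Matrix.diagonal_smul]
    refine (norm_toEuclideanCLM_diagonal_le zero_le_one fun σ => ?_).trans (by norm_num)
    have hσ : ((σ x : ℕ) : ℝ) ≤ n := by exact_mod_cast Nat.lt_succ_iff.1 (σ x).2
    have hval : (((n : ℂ) / 2)⁻¹ • fun σ : Λ → Fin (n + 1) =>
        ((n : ℂ) / 2 - ((σ x : ℕ) : ℂ))) σ =
        ((((n : ℝ) / 2)⁻¹ * ((n : ℝ) / 2 - (σ x : ℕ)) : ℝ) : ℂ) := by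
      simp
    rw [hval, Complex.norm_real, norm_mul, norm_inv, Real.norm_of_nonneg (by positivity),
      Real.norm_eq_abs, inv_mul_le_iff₀ (by positivity), mul_one, abs_le]
    have h0 : (0 : ℝ) ≤ ((σ x : ℕ) : ℝ) := by positivity
    constructor <;> linarith
  · have h := star_spinOp (Λ := Λ) (n := n) (Idx.plus, x)
    have h' : spinOp Λ n (Idx.minus, x) = star (spinOp Λ n (Idx.plus, x)) := h.symm
    rw [h']
    exact (norm_star (E := SpinOp Λ n) _).trans_le (norm_spinOp_plus_le hn x)

end SpinOperators

/-! ### Reordering words of operators with small commutators -/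

section Reordering

variable {σ 𝒜 : Type*} [NormedRing 𝒜] [NormOneClass 𝒜] {S : σ → 𝒜} {b κ : ℝ}

theorem norm_wordProd_le (hb : ∀ p, ‖S p‖ ≤ b) (hb0 : 0 ≤ b) (w : List σ) :
    ‖wordProd S w‖ ≤ b ^ w.length := by
  induction w with
  | nil => simp [wordProd]
  | cons p w ih =>
    rw [wordProd_cons, List.length_cons, pow_succ']
    exact (norm_mul_le _ _).trans (mul_le_mul (hb p) ih (norm_nonneg _) hb0)

/-- The letter is moved through the word one step at a time. A commutator has the size `κ b` of one
letter, not two, which explains the power of `b`. -/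
theorem norm_commutator_wordProd_le (hb : ∀ p, ‖S p‖ ≤ b) (hb0 : 0 ≤ b)
    (hκ : ∀ p q, ‖S p * S q - S q * S p‖ ≤ κ * b) (a : σ) (w : List σ) :
    ‖S a * wordProd S w - wordProd S w * S a‖ ≤ w.length * (κ * b ^ w.length) := by
  induction w with
  | nil => simp [wordProd]
  | cons q w ih =>
    have h : S a * wordProd S (q :: w) - wordProd S (q :: w) * S a =
        (S a * S q - S q * S a) * wordProd S w +
          S q * (S a * wordProd S w - wordProd S w * S a) := by
      rw [wordProd_cons]
      noncomm_ring
    rw [h]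
    have h1 : ‖(S a * S q - S q * S a) * wordProd S w‖ ≤ κ * b * b ^ w.length :=
      (norm_mul_le _ _).trans (mul_le_mul (hκ a q) (norm_wordProd_le hb hb0 w) (norm_nonneg _)
        ((norm_nonneg _).trans (hκ a q)))
    have h2 : ‖S q * (S a * wordProd S w - wordProd S w * S a)‖ ≤
        b * (w.length * (κ * b ^ w.length)) :=
      (norm_mul_le _ _).trans (mul_le_mul (hb q) ih (norm_nonneg _) hb0)
    refine (norm_add_le _ _).trans ((add_le_add h1 h2).trans (le_of_eq ?_))
    rw [List.length_cons, pow_succ]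
    push_cast
    ring

/-- The leading letter is moved to its place in `w'` and the rest is treated by induction. This
takes at most `|w|²` transpositions, each costing at most `κ b^|w|`. -/
theorem norm_wordProd_sub_perm_le (hb : ∀ p, ‖S p‖ ≤ b) (hb1 : 1 ≤ b) (hκ0 : 0 ≤ κ)
    (hκ : ∀ p q, ‖S p * S q - S q * S p‖ ≤ κ * b) {w w' : List σ} (hw : w.Perm w') :
    ‖wordProd S w - wordProd S w'‖ ≤ (w.length : ℝ) ^ 2 * (κ * b ^ w.length) := by
  have hb0 : 0 ≤ b := zero_le_one.trans hb1
  induction w generalizing w' with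
  | nil =>
    rw [List.nil_perm.1 hw]
    simp
  | cons a u ih =>
    obtain ⟨l₁, l₂, rfl⟩ := List.append_of_mem (hw.subset List.mem_cons_self)
    have hu : u.Perm (l₁ ++ l₂) :=
      (List.Perm.cons_inv (hw.trans List.perm_middle))
    have hlen : u.length = l₁.length + l₂.length := by
      rw [hu.length_eq, List.length_append]
    have h : wordProd S (a :: u) - wordProd S (l₁ ++ a :: l₂) =
        S a * (wordProd S u - wordProd S (l₁ ++ l₂)) +
          (S a * wordProd S l₁ - wordProd S l₁ * S a) * wordProd S l₂ := by
      rw [wordProd_cons, wordProd_append, wordProd_append, wordProd_cons]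
      noncomm_ring
    rw [h]
    have h1 : ‖S a * (wordProd S u - wordProd S (l₁ ++ l₂))‖ ≤
        b * ((u.length : ℝ) ^ 2 * (κ * b ^ u.length)) :=
      (norm_mul_le _ _).trans (mul_le_mul (hb a) (ih hu) (norm_nonneg _) hb0)
    have h2 : ‖(S a * wordProd S l₁ - wordProd S l₁ * S a) * wordProd S l₂‖ ≤
        l₁.length * (κ * b ^ l₁.length) * b ^ l₂.length :=
      (norm_mul_le _ _).trans (mul_le_mul (norm_commutator_wordProd_le hb hb0 hκ a l₁)
        (norm_wordProd_le hb hb0 l₂) (norm_nonneg _) (by positivity))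
    have h3 : (l₁.length : ℝ) * (κ * b ^ l₁.length) * b ^ l₂.length ≤
        b * (u.length * (κ * b ^ u.length)) := by
      have hl : (l₁.length : ℝ) ≤ u.length := by exact_mod_cast (by omega)
      calc (l₁.length : ℝ) * (κ * b ^ l₁.length) * b ^ l₂.length
          = l₁.length * (κ * b ^ u.length) := by rw [hlen, pow_add]; ring
        _ ≤ u.length * (κ * b ^ u.length) := mul_le_mul_of_nonneg_right hl (by positivity)
        _ ≤ b * (u.length * (κ * b ^ u.length)) :=
            le_mul_of_one_le_left (by positivity) hb1
    refine (norm_add_le _ _).trans ((add_le_add h1 (h2.trans h3)).trans ?_)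
    have h4 : 0 ≤ κ * b ^ u.length * b := by positivity
    rw [List.length_cons, pow_succ b]
    push_cast
    nlinarith [(Nat.cast_nonneg u.length : (0 : ℝ) ≤ u.length)]

end Reordering

end SpinEgorov

namespace SpinEgorov

/-! ### Quantized monomials -/

section Quantization

variable {L : Type*} [DecidableEq L] {Λ : Finset L} {n : ℕ}

instance : Nontrivial (SpinSpace Λ n) := inferInstance

instance : NormOneClass (SpinOp Λ n) := inferInstance

theorem quantMonomial_eq_wick {w : List (Idx × Λ)} {α : MultiIndex Λ}
    (h : (w : Multiset (Idx × Λ)) = α.toMultiset) : quantMonomial Λ n α = wick Λ n w := by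
  rw [quantMonomial, ← h]
  rfl

theorem normalOrder_perm {X : Type*} (w : List (Idx × X)) : (normalOrder w).Perm w := by
  induction w with
  | nil => simp [normalOrder]
  | cons p w ih =>
    obtain ⟨i, x⟩ := p
    cases i
    · simpa [normalOrder] using ih
    · refine List.Perm.trans ?_ (ih.cons _)
      simp only [normalOrder, List.filter_cons]
      simp
    · refine List.Perm.trans ?_ (ih.cons _)
      simp only [normalOrder, List.filter_cons]
      simp [-List.append_assoc]

/-- A normal-ordered word of the factors of `M^α`. -/
noncomputable def orderedWord {X : Type*} (α : MultiIndex X) : List (Idx × X) :=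
  normalOrder α.toMultiset.toList

theorem coe_orderedWord {X : Type*} (α : MultiIndex X) :
    (orderedWord α : Multiset (Idx × X)) = α.toMultiset := by
  rw [orderedWord, Multiset.coe_eq_coe.2 (normalOrder_perm _), Multiset.coe_toList]

theorem quantMonomial_eq_wordProd (α : MultiIndex Λ) :
    quantMonomial Λ n α = wordProd (spinOp Λ n) (orderedWord α) :=
  quantMonomial_eq_wick (Multiset.coe_toList _)

theorem norm_quantMonomial_le (hn : 1 ≤ n) (α : MultiIndex Λ) :
    ‖quantMonomial Λ n α‖ ≤ (3 / 2 : ℝ) ^ α.degree := by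
  rw [quantMonomial_eq_wordProd, ← length_of_coe_eq_toMultiset (coe_orderedWord α)]
  exact norm_wordProd_le (norm_spinOp_le hn) (by norm_num) _

theorem norm_quantMonomial_le_exp (hn : 1 ≤ n) (α : MultiIndex Λ) :
    ‖quantMonomial Λ n α‖ ≤ 1 * Real.exp α.degree := by
  refine (norm_quantMonomial_le hn α).trans ?_
  rw [one_mul, ← Real.exp_one_pow]
  exact pow_le_pow_left₀ (by norm_num) (by linarith [exp_one_gt_five_halves]) _

theorem quantize_eq_observe (A : Poly Λ) : quantize n A = observe (quantMonomial Λ n) A :=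
  (observe_apply _ _).symm

theorem star_wordProd {σ 𝒜 : Type*} [Monoid 𝒜] [StarMul 𝒜] (S : σ → 𝒜) (w : List σ) :
    star (wordProd S w) = wordProd (fun p => star (S p)) w.reverse := by
  induction w with
  | nil => simp [wordProd]
  | cons p w ih =>
    rw [wordProd_cons, star_mul, ih, List.reverse_cons, wordProd_append]
    simp [wordProd]

/-- Taking adjoints reverses a word and exchanges `+` with `-`, so the outer blocks swap twice.
Normal ordering therefore respects adjoints, which makes the Hamiltonian self-adjoint. -/
theorem normalOrder_reverse_map_bar {X : Type*} (w : List (Idx × X)) :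
    normalOrder (w.reverse.map (Prod.map Idx.bar id)) =
      (normalOrder w).reverse.map (Prod.map Idx.bar id) := by
  have hf : ∀ i : Idx, (w.reverse.map (Prod.map Idx.bar id)).filter (fun p => p.1 = i) =
      ((w.filter fun p => p.1 = i.bar).reverse).map (Prod.map Idx.bar id) := by
    intro i
    rw [List.filter_map, ← List.filter_reverse]
    congr 2
    funext p
    obtain ⟨j, x⟩ := p
    cases i <;> cases j <;> simp [Idx.bar]
  simp only [normalOrder]
  rw [hf, hf, hf]
  simp only [Idx.bar, List.reverse_append, List.map_append, List.append_assoc]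
  rfl

theorem star_quantMonomial (α : MultiIndex Λ) :
    star (quantMonomial Λ n α) = quantMonomial Λ n (conjIndex α) := by
  set w := α.toMultiset.toList with hw
  have hα : (w : Multiset (Idx × Λ)) = α.toMultiset := Multiset.coe_toList _
  have hα' : ((w.reverse.map (Prod.map Idx.bar id) : List (Idx × Λ)) : Multiset (Idx × Λ)) =
      (conjIndex α).toMultiset := by
    rw [conjIndex, ← Finsupp.toMultiset_map, ← hα, Multiset.map_coe]
    exact Multiset.coe_eq_coe.2 ((List.reverse_perm w).map _)
  rw [quantMonomial_eq_wick hα, quantMonomial_eq_wick hα', wick, wick,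
    normalOrder_reverse_map_bar]
  have := star_wordProd (spinOp Λ n) (normalOrder w)
  simp only [wordProd] at this
  rw [this, List.map_map]
  congr 2
  funext p
  exact star_spinOp p

/-! ### Commutators of quantized monomials -/

theorem eval_wordBracket_commutator {X 𝒜 : Type*} [DecidableEq X] [Ring 𝒜] [Algebra ℂ 𝒜]
    (S : Idx × X → 𝒜) (c : ℂ) (hS : ∀ p q, c • (S p * S q - S q * S p) = (letterBracket p q).eval S)
    (u w : List (Idx × X)) : (wordBracket u w).eval S =
      c • (wordProd S u * wordProd S w - wordProd S w * wordProd S u) := by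
  refine eval_wordBracket S (fun A B => c • (A * B - B * A)) ?_ ?_ ?_ ?_ hS u w
  · intro a a' b
    rw [smul_mul_assoc, mul_smul_comm, ← smul_add]
    congr 1
    noncomm_ring
  · intro a b b'
    rw [smul_mul_assoc, mul_smul_comm, ← smul_add]
    congr 1
    noncomm_ring
  · intro b
    rw [one_mul, mul_one, sub_self, smul_zero]
  · intro b
    rw [one_mul, mul_one, sub_self, smul_zero]

theorem norm_spinOp_commutator_le (hn : 1 ≤ n) (p q : Idx × Λ) :
    ‖spinOp Λ n p * spinOp Λ n q - spinOp Λ n q * spinOp Λ n p‖ ≤ 2 / n * (3 / 2) := by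
  have hn' : (0 : ℝ) < n := by exact_mod_cast hn
  have h := congrArg norm (spinOp_commutator hn p q)
  have heval : ‖(letterBracket p q).eval (spinOp Λ n)‖ ≤ 3 / 2 := by
    have hterm : ∀ k, ‖(Complex.I * (eps p.1 q.1 k : ℂ)) • spinOp Λ n (k, p.2)‖ ≤
        ‖(eps p.1 q.1 k : ℂ)‖ * (3 / 2) := by
      intro k
      rw [norm_smul, norm_mul, Complex.norm_I, one_mul]
      exact mul_le_mul_of_nonneg_left (norm_spinOp_le hn _) (norm_nonneg _)
    rw [eval_letterBracket]
    split_ifs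
    · refine (norm_sum_le _ _).trans ((Finset.sum_le_sum fun k _ => hterm k).trans ?_)
      rw [sum_idx]
      cases p.1 <;> cases q.1 <;> norm_num [eps]
    · norm_num
  rw [norm_smul, norm_mul, Complex.norm_I, one_mul, norm_div, Complex.norm_natCast,
    Complex.norm_two] at h
  rw [← h] at heval
  rw [div_mul_eq_mul_div, le_div_iff₀ hn']
  linarith

/-- The quadratic reordering cost is absorbed by raising the weight from `3/2` to 2. Bernoulli gives
`N / 7 ≤ (8/7)^N`, and 7 works because `(8/7)² * (3/2) = 96/49 < 2`. -/
theorem natCast_sq_mul_pow_le (N : ℕ) : (N : ℝ) ^ 2 * (3 / 2) ^ N ≤ 49 * 2 ^ N := by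
  have h1 : 1 + (N : ℝ) * (1 / 7) ≤ (1 + 1 / 7) ^ N :=
    one_add_mul_le_pow (by norm_num) N
  have h2 : (N : ℝ) ^ 2 ≤ 49 * ((8 / 7 : ℝ) ^ N) ^ 2 := by
    have h3 : (N : ℝ) / 7 ≤ (8 / 7) ^ N := by
      have : (1 + 1 / 7 : ℝ) = 8 / 7 := by norm_num
      rw [this] at h1
      linarith
    have h4 : (0 : ℝ) ≤ (N : ℝ) / 7 := by positivity
    nlinarith [mul_self_le_mul_self h4 h3]
  calc (N : ℝ) ^ 2 * (3 / 2) ^ N ≤ 49 * ((8 / 7 : ℝ) ^ N) ^ 2 * (3 / 2) ^ N :=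
        mul_le_mul_of_nonneg_right h2 (by positivity)
    _ = 49 * (((8 / 7) ^ 2 * (3 / 2)) ^ N) := by
        rw [mul_pow, ← pow_mul, ← pow_mul, mul_comm N 2, mul_assoc]
    _ ≤ 49 * 2 ^ N := by
        refine mul_le_mul_of_nonneg_left (pow_le_pow_left₀ (by norm_num) (by norm_num) N)
          (by norm_num)

/-- Quantizing the commutative value of a word normal-orders it, so the two sides differ by one
reordering for each term. -/
theorem norm_eval_sub_observe_le (hn : 1 ≤ n) {f : Expansion (Idx × Λ)} {N : ℕ}
    (hf : ∀ t ∈ f, t.2.length ≤ N) :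
    ‖f.eval (spinOp Λ n) - observe (quantMonomial Λ n) (f.eval MvPolynomial.X)‖ ≤
      f.size * ((N : ℝ) ^ 2 * (2 / n * (3 / 2) ^ N)) := by
  induction f with
  | nil => simp [Expansion.eval, Expansion.size]
  | cons t f ih =>
    have ih' := ih fun t ht => hf t (by simp [ht])
    simp only [Expansion.eval, Expansion.size, List.map_cons, List.sum_cons] at ih' ⊢
    rw [map_add, add_sub_add_comm, add_mul]
    refine (norm_add_le _ _).trans (add_le_add ?_ ih')
    have hw : (t.2 : Multiset (Idx × Λ)) =
        (Multiset.toFinsupp (t.2 : Multiset (Idx × Λ))).toMultiset := by simp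
    rw [map_smul, wordProd_X hw, observe_monomial, one_smul, quantMonomial_eq_wick hw,
      ← smul_sub, norm_smul]
    refine mul_le_mul_of_nonneg_left ?_ (norm_nonneg _)
    have hlen : (t.2.length : ℝ) ≤ N := by exact_mod_cast hf t (by simp)
    refine (norm_wordProd_sub_perm_le (norm_spinOp_le hn) (by norm_num) (by positivity)
      (norm_spinOp_commutator_le hn) (normalOrder_perm t.2).symm).trans ?_
    refine mul_le_mul (pow_le_pow_left₀ (by positivity) hlen 2) ?_ (by positivity) (by positivity)
    exact mul_le_mul_of_nonneg_left
      (pow_le_pow_right₀ (by norm_num) (hf t (by simp))) (by positivity)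

/-- The commutator of quantized monomials is the quantized Poisson bracket up to `O(1/s)`. -/
theorem norm_commutator_sub_bracket_le (hn : 1 ≤ n) (β α : MultiIndex Λ) :
    ‖(Complex.I * ((n : ℂ) / 2)) • (quantMonomial Λ n β * quantMonomial Λ n α -
        quantMonomial Λ n α * quantMonomial Λ n β) -
      observe (quantMonomial Λ n) (monomialBracket β α)‖ ≤
      98 / n * (overlap β α * 2 ^ (β.degree + α.degree)) := by
  have hβ := coe_orderedWord β
  have hα := coe_orderedWord α
  have hcomm : (Complex.I * ((n : ℂ) / 2)) • (quantMonomial Λ n β * quantMonomial Λ n α -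
        quantMonomial Λ n α * quantMonomial Λ n β) =
      (wordBracket (orderedWord β) (orderedWord α)).eval (spinOp Λ n) := by
    rw [quantMonomial_eq_wordProd, quantMonomial_eq_wordProd]
    exact (eval_wordBracket_commutator (spinOp Λ n) _ (spinOp_commutator hn) _ _).symm
  rw [hcomm, monomialBracket_eq_eval hβ hα]
  have hlen : ∀ t ∈ wordBracket (orderedWord β) (orderedWord α),
      t.2.length ≤ β.degree + α.degree := by
    intro t ht
    have := length_of_mem_wordBracket ht
    rw [length_of_coe_eq_toMultiset hβ, length_of_coe_eq_toMultiset hα] at this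
    omega
  refine (norm_eval_sub_observe_le hn hlen).trans ?_
  have h1 := size_wordBracket_le_overlap hβ hα
  have h2 := natCast_sq_mul_pow_le (β.degree + α.degree)
  calc _ ≤ (overlap β α : ℝ) * (((β.degree + α.degree : ℕ) : ℝ) ^ 2 *
        (2 / n * (3 / 2) ^ (β.degree + α.degree))) :=
        mul_le_mul_of_nonneg_right h1 (by positivity)
    _ = (overlap β α : ℝ) * (2 / n) * (((β.degree + α.degree : ℕ) : ℝ) ^ 2 *
        (3 / 2) ^ (β.degree + α.degree)) := by ring
    _ ≤ (overlap β α : ℝ) * (2 / n) * (49 * 2 ^ (β.degree + α.degree)) :=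
        mul_le_mul_of_nonneg_left h2 (by positivity)
    _ = _ := by ring

end Quantization

end SpinEgorov

namespace SpinEgorov

open Set

/-! ### Heisenberg evolution -/

section Heisenberg

section Abstract

variable {𝒜 : Type*} [NormedRing 𝒜] [NormedAlgebra ℂ 𝒜]

theorem hasSum_smul_sandwich_commutator {ι : Type*} {w : ι → ℂ} {Q : ι → 𝒜} {H : 𝒜}
    (h : HasSum (fun β => w β • Q β) H) (k : ℂ) (a u u' : 𝒜) :
    HasSum (fun β => w β • (u * (k • (Q β * a - a * Q β)) * u'))
      (u * (k • (H * a - a * H)) * u') := by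
  have h1 := ((((h.mul_right a).sub (h.mul_left a)).const_smul k).mul_left u).mul_right u'
  refine h1.congr_fun fun β => ?_
  simp only [smul_mul_assoc, mul_smul_comm, ← smul_sub]
  rw [smul_comm]

theorem exists_linear_evolution [CompleteSpace 𝒜] {H : ℝ → 𝒜} (hH : Continuous H) (c : ℂ) :
    ∃ U : ℝ → 𝒜, U 0 = 1 ∧ ∀ t, HasDerivAt U (c • (H t * U t)) t := by
  refine exists_global_solution (f := fun t U => c • (H t * U)) (fun U => ?_) (fun T => ?_) 1
  · exact continuous_const.smul (hH.mul continuous_const)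
  · obtain ⟨C, hC⟩ := isCompact_Icc.exists_bound_of_continuousOn (s := Icc (-T) T)
      hH.continuousOn
    refine ⟨‖c‖₊ * C.toNNReal, fun t ht => LipschitzWith.of_dist_le_mul fun U U' => ?_⟩
    have hC0 : 0 ≤ C := (norm_nonneg _).trans (hC t ht)
    rw [dist_eq_norm, dist_eq_norm, ← smul_sub, ← mul_sub, norm_smul, NNReal.coe_mul,
      coe_nnnorm, Real.coe_toNNReal _ hC0, mul_assoc]
    refine mul_le_mul_of_nonneg_left ((norm_mul_le _ _).trans ?_) (norm_nonneg _)
    exact mul_le_mul_of_nonneg_right (hC t ht) (norm_nonneg _)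

theorem norm_le_one_of_star_mul_self {ℬ : Type*} [NormedRing ℬ] [StarRing ℬ] [CStarRing ℬ]
    {u : ℬ} (h1 : ‖(1 : ℬ)‖ ≤ 1) (hu : star u * u = 1) : ‖u‖ ≤ 1 := by
  have h2 : ‖star u * u‖ = ‖u‖ * ‖u‖ := CStarRing.norm_star_mul_self
  rw [hu] at h2
  nlinarith [norm_nonneg u]

variable [StarRing 𝒜] [ContinuousStar 𝒜] [StarModule ℂ 𝒜]

theorem hasDerivAt_sandwich {c : ℂ} (hc : star c = -c) {H : 𝒜} (hH : star H = H) {U₁ U₂ : ℝ → 𝒜}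
    {t : ℝ} (h₁ : HasDerivAt U₁ (c • (H * U₁ t)) t) (h₂ : HasDerivAt U₂ (c • (H * U₂ t)) t)
    (a : 𝒜) :
    HasDerivAt (fun t => star (U₁ t) * a * U₂ t)
      (star (U₁ t) * ((-c) • (H * a - a * H)) * U₂ t) t := by
  have h := (h₁.star.mul_const a).mul h₂
  refine h.congr_deriv ?_
  rw [star_smul, star_mul, hH, hc]
  simp only [neg_smul, neg_mul, mul_neg, mul_smul_comm, smul_mul_assoc, mul_sub, sub_mul,
    smul_sub, mul_assoc]
  abel

/-- The product has zero derivative. Allowing two different solutions gives both isometry (`U₁ =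
U₂`) and uniqueness. -/
theorem star_mul_eq_one_of_hasDerivAt {c : ℂ} (hc : star c = -c) {H : ℝ → 𝒜}
    (hH : ∀ t, star (H t) = H t) {U₁ U₂ : ℝ → 𝒜}
    (h₁ : ∀ t, HasDerivAt U₁ (c • (H t * U₁ t)) t) (h₂ : ∀ t, HasDerivAt U₂ (c • (H t * U₂ t)) t)
    (h₁0 : U₁ 0 = 1) (h₂0 : U₂ 0 = 1) (t : ℝ) : star (U₁ t) * U₂ t = 1 := by
  have hd : ∀ t, HasDerivAt (fun t => star (U₁ t) * U₂ t) 0 t := by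
    intro t
    have h := hasDerivAt_sandwich hc (hH t) (h₁ t) (h₂ t) 1
    simpa using h
  have := is_const_of_deriv_eq_zero (fun r => (hd r).differentiableAt) (fun r => (hd r).deriv) t 0
  simpa [h₁0, h₂0] using this

end Abstract

variable {L : Type*} [DecidableEq L] {Λ : Finset L} {n : ℕ} {V : ℝ → MultiIndex L → ℂ}
  {v : ℕ → ℝ}

theorem hasSum_quantumHamiltonian (hW : IsBoundedPotential (localPotential V Λ) v) (hn : 1 ≤ n)
    (t : ℝ) : HasSum (fun β => localPotential V Λ t β • quantMonomial Λ n β)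
      (quantumHamiltonian V Λ n t) :=
  (hW.summable_smul (norm_quantMonomial_le_exp hn) t).hasSum

theorem continuous_quantumHamiltonian (hW : IsBoundedPotential (localPotential V Λ) v)
    (hn : 1 ≤ n) : Continuous fun t => quantumHamiltonian V Λ n t :=
  hW.continuous_tsum_smul (norm_quantMonomial_le_exp hn)

theorem star_quantumHamiltonian (hreal : ∀ t α, (starRingEnd ℂ) (V t α) = V t (conjIndex α))
    (hW : IsBoundedPotential (localPotential V Λ) v) (hn : 1 ≤ n) (t : ℝ) :
    star (quantumHamiltonian V Λ n t) = quantumHamiltonian V Λ n t := by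
  have h := hasSum_quantumHamiltonian hW hn t
  let e : MultiIndex Λ ≃ MultiIndex Λ :=
    ⟨conjIndex, conjIndex, conjIndex_conjIndex, conjIndex_conjIndex⟩
  have h1 := h.star
  have h2 := e.hasSum_iff.2 h
  refine h1.unique (h2.congr_fun fun β => ?_)
  rw [star_smul, star_quantMonomial]
  congr 1
  show (starRingEnd ℂ) (V t (extendIndex Λ β)) = V t (extendIndex Λ (conjIndex β))
  rw [hreal, conjIndex_extendIndex]

theorem star_I_mul_half (n : ℕ) :
    star (-(Complex.I * ((n : ℂ) / 2))) = -(-(Complex.I * ((n : ℂ) / 2))) := by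
  simp

/-- The Schrödinger equation is well posed. -/
theorem existsUnique_propagator (hreal : ∀ t α, (starRingEnd ℂ) (V t α) = V t (conjIndex α))
    (hW : IsBoundedPotential (localPotential V Λ) v) (hn : 1 ≤ n) :
    ∃! U : ℝ → SpinOp Λ n, IsPropagator V Λ n U := by
  obtain ⟨U, hU0, hU⟩ := exists_linear_evolution (continuous_quantumHamiltonian hW hn)
    (-(Complex.I * ((n : ℂ) / 2)))
  refine ⟨U, ⟨hU0, hU⟩, fun U' hU' => funext fun t => ?_⟩
  have hstar := star_quantumHamiltonian hreal hW hn
  have h1 : star (U t) * U t = 1 :=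
    star_mul_eq_one_of_hasDerivAt (star_I_mul_half n) hstar hU hU hU0 hU0 t
  have h2 : star (U t) * U' t = 1 :=
    star_mul_eq_one_of_hasDerivAt (star_I_mul_half n) hstar hU hU'.hasDerivAt hU0 hU'.initial t
  -- In finite dimension a left inverse is also a right inverse, so the isometry is unitary.
  have h3 : U t * star (U t) = 1 := by
    have h4 : (star (U t)).toLinearMap * (U t).toLinearMap = 1 :=
      LinearMap.ext fun w => congrArg (fun T : SpinOp Λ n => T w) h1
    have h5 := mul_eq_one_comm.1 h4
    exact ContinuousLinearMap.ext fun w =>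
      congrArg (fun T : SpinSpace Λ n →ₗ[ℂ] SpinSpace Λ n => T w) h5
  calc U' t = (U t * star (U t)) * U' t := by rw [h3, one_mul]
    _ = U t := by rw [mul_assoc, h2, mul_one]

theorem IsPropagator.norm_le_one (hreal : ∀ t α, (starRingEnd ℂ) (V t α) = V t (conjIndex α))
    (hW : IsBoundedPotential (localPotential V Λ) v) (hn : 1 ≤ n) {U : ℝ → SpinOp Λ n}
    (hU : IsPropagator V Λ n U) (t : ℝ) : ‖U t‖ ≤ 1 := by
  have h1 : star (U t) * U t = 1 := star_mul_eq_one_of_hasDerivAt (star_I_mul_half n)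
    (star_quantumHamiltonian hreal hW hn) hU.hasDerivAt hU.hasDerivAt hU.initial hU.initial t
  exact norm_le_one_of_star_mul_self ContinuousLinearMap.norm_id_le h1

theorem norm_star_mul_mul_le {U : SpinOp Λ n} (hU : ‖U‖ ≤ 1) (A : SpinOp Λ n) :
    ‖star U * A * U‖ ≤ ‖A‖ := by
  have hU' : ‖star U‖ ≤ 1 := (norm_star (E := SpinOp Λ n) U).trans_le hU
  calc ‖star U * A * U‖ ≤ ‖star U‖ * ‖A‖ * ‖U‖ :=
        (norm_mul_le _ _).trans (mul_le_mul_of_nonneg_right (norm_mul_le _ _) (norm_nonneg _))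
    _ ≤ 1 * ‖A‖ * 1 := by gcongr
    _ = ‖A‖ := by ring

theorem observe_sandwich (u u' : SpinOp Λ n) (A : Poly Λ) :
    observe (fun γ => u * quantMonomial Λ n γ * u') A = u * quantize n A * u' := by
  rw [quantize_eq_observe, observe_apply, observe_apply, Finset.mul_sum, Finset.sum_mul]
  refine Finset.sum_congr rfl fun γ _ => ?_
  rw [mul_smul_comm, smul_mul_assoc]

/-- The Heisenberg evolution of the quantized monomials is an approximate Liouville flow. -/
theorem IsPropagator.isApproxFlow (hreal : ∀ t α, (starRingEnd ℂ) (V t α) = V t (conjIndex α))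
    (hW : IsBoundedPotential (localPotential V Λ) v) (hn : 1 ≤ n) {U : ℝ → SpinOp Λ n}
    (hU : IsPropagator V Λ n U) :
    IsApproxFlow (localPotential V Λ) (98 / n)
      fun t γ => star (U t) * quantMonomial Λ n γ * U t := by
  have hU1 := hU.norm_le_one hreal hW hn
  refine ⟨fun t γ => (norm_star_mul_mul_le (hU1 t) _).trans (norm_quantMonomial_le hn γ),
    fun t β α => star (U t) * ((Complex.I * ((n : ℂ) / 2)) •
      (quantMonomial Λ n β * quantMonomial Λ n α -
        quantMonomial Λ n α * quantMonomial Λ n β)) * U t, fun t α => ?_, fun t β α => ?_⟩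
  · have h1 := hasDerivAt_sandwich (star_I_mul_half n) (star_quantumHamiltonian hreal hW hn t)
      (hU.hasDerivAt t) (hU.hasDerivAt t) (quantMonomial Λ n α)
    rw [neg_neg] at h1
    have h2 := hasSum_smul_sandwich_commutator (hasSum_quantumHamiltonian hW hn t)
      (Complex.I * ((n : ℂ) / 2)) (quantMonomial Λ n α) (star (U t)) (U t)
    rw [← h2.tsum_eq] at h1
    exact h1
  · rw [observe_sandwich, ← sub_mul, ← mul_sub, quantize_eq_observe]
    exact (norm_star_mul_mul_le (hU1 t) _).trans (norm_commutator_sub_bracket_le hn β α)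

end Heisenberg

end SpinEgorov

namespace SpinEgorov

open MvPolynomial

universe u

/-! ### The Egorov estimate -/

section Egorov

variable {L : Type u}

theorem Poly.extend_eq_sum {Λ₀ Λ : Finset L} (h : Λ₀ ⊆ Λ) (A : Poly Λ₀) :
    A.extend h = ∑ γ ∈ A.support, monomial
      (γ.mapDomain (Prod.map id fun x : Λ₀ => (⟨x.1, h x.2⟩ : Λ))) (A.coeff γ) := by
  conv_lhs => rw [Poly.extend, A.as_sum, map_sum]
  exact Finset.sum_congr rfl fun γ _ => rename_monomial _ _ _

/-- Together with the degree bound this lets all constants be chosen from `A` before the volume is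
known. -/
theorem Poly.coeffNorm_extend_le {Λ₀ Λ : Finset L} (h : Λ₀ ⊆ Λ) (A : Poly Λ₀) :
    coeffNorm (A.extend h) ≤ coeffNorm A := by
  rw [A.extend_eq_sum h]
  exact coeffNorm_sum_monomial_le _ _ _

theorem Poly.degree_le_of_mem_support_extend {Λ₀ Λ : Finset L} (h : Λ₀ ⊆ Λ) (A : Poly Λ₀)
    {γ : MultiIndex Λ} (hγ : γ ∈ (A.extend h).support) :
    γ.degree ≤ A.support.sup Finsupp.degree := by
  obtain ⟨β, rfl, hβ⟩ := coeff_rename_ne_zero _ _ _ (mem_support_iff.1 hγ)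
  rw [Finsupp.degree_mapDomain]
  exact Finset.le_sup (f := Finsupp.degree) (mem_support_iff.2 hβ)

variable [DecidableEq L] {V : ℝ → MultiIndex L → ℂ} {v : ℕ → ℝ} {Λ : Finset L}

theorem isClassicalSolution_classicalFlow
    (hreal : ∀ t α, (starRingEnd ℂ) (V t α) = V t (conjIndex α))
    (hW : IsBoundedPotential (localPotential V Λ) v) {M₀ : Config Λ} (hM₀ : M₀ ∈ phaseSpace Λ) :
    IsClassicalSolution V Λ M₀ fun t => classicalFlow V Λ t M₀ := by
  have h := (existsUnique_classicalSolution hreal hW hM₀).exists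
  simp only [classicalFlow, dif_pos h]
  exact h.choose_spec

theorem isPropagator_propagator {n : ℕ}
    (hreal : ∀ t α, (starRingEnd ℂ) (V t α) = V t (conjIndex α))
    (hW : IsBoundedPotential (localPotential V Λ) v) (hn : 1 ≤ n) :
    IsPropagator V Λ n (propagator V Λ n) := by
  have h := (existsUnique_propagator hreal hW hn).exists
  rw [propagator, dif_pos h]
  exact h.choose_spec

/-- A polynomial which transports approximately along every approximate flow approximates the
classical evolution. -/
theorem norm_classicalEvolution_sub_le
    (hreal : ∀ t α, (starRingEnd ℂ) (V t α) = V t (conjIndex α))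
    (hW : IsBoundedPotential (localPotential V Λ) v) {B B' : Poly Λ} {t ε C : ℝ}
    (hB : ∀ (E : Type u) [NormedAddCommGroup E] [NormedSpace ℂ E] [CompleteSpace E] (δ : ℝ)
      (m : ℝ → MultiIndex Λ → E), 0 ≤ δ → IsApproxFlow (localPotential V Λ) δ m →
      ‖observe (m t) B - observe (m 0) B'‖ ≤ ε + C * δ)
    {M : Config Λ} (hM : M ∈ phaseSpace Λ) :
    ‖classicalEvolution V Λ t B.value M - B'.value M‖ ≤ ε := by
  have hsol := isClassicalSolution_classicalFlow hreal hW hM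
  -- The scalars are lifted to the universe of `L`, where the spin operators live, so that one
  -- quantifier over `E` covers both evolutions.
  have he : ‖(ULift.up 1 : ULift.{u} ℂ)‖ = 1 := norm_one
  have h := hB (ULift.{u} ℂ) 0 _ le_rfl (hsol.isApproxFlow hW he)
  rw [observe_monomialValue_smul, observe_monomialValue_smul, hsol.initial, ← sub_smul, norm_smul,
    he, mul_one, mul_zero, add_zero] at h
  exact h

/-- A polynomial which transports approximately along every approximate flow approximates, after
quantization, the Heisenberg evolution. -/
theorem norm_quantumEvolution_sub_le {n : ℕ}
    (hreal : ∀ t α, (starRingEnd ℂ) (V t α) = V t (conjIndex α))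
    (hW : IsBoundedPotential (localPotential V Λ) v) (hn : 1 ≤ n) {B B' : Poly Λ} {t ε C : ℝ}
    (hB : ∀ (E : Type u) [NormedAddCommGroup E] [NormedSpace ℂ E] [CompleteSpace E] (δ : ℝ)
      (m : ℝ → MultiIndex Λ → E), 0 ≤ δ → IsApproxFlow (localPotential V Λ) δ m →
      ‖observe (m t) B - observe (m 0) B'‖ ≤ ε + C * δ) :
    ‖quantumEvolution V Λ n t (quantize n B) - quantize n B'‖ ≤ ε + C * (98 / n) := by
  have hU := isPropagator_propagator hreal hW hn
  have h := hB (SpinOp Λ n) (98 / n) _ (by positivity) (hU.isApproxFlow hreal hW hn)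
  rw [observe_sandwich, observe_sandwich, hU.initial, star_one, one_mul, mul_one] at h
  exact h

end Egorov

end SpinEgorov

/-! ### The main theorem -/

theorem mainTheorem1 {L : Type*} [DecidableEq L]
    (V : ℝ → SpinEgorov.MultiIndex L → ℂ)
    (hreal : ∀ t α, (starRingEnd ℂ) (V t α) = V t (SpinEgorov.conjIndex α))
    (hnorm : SpinEgorov.potentialNorm V < ⊤)
    (hcont : ∀ α, Continuous fun t => V t α) :
    -- the classical and the quantum dynamics are well defined
    (∀ Λ : Finset L, ∀ M₀ ∈ SpinEgorov.phaseSpace Λ,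
      ∃! M : ℝ → SpinEgorov.Config Λ, SpinEgorov.IsClassicalSolution V Λ M₀ M) ∧
    (∀ (Λ : Finset L) (n : ℕ), 1 ≤ n →
      ∃! U : ℝ → SpinEgorov.SpinOp Λ n, SpinEgorov.IsPropagator V Λ n U) ∧
    -- the Egorov estimate
    ∀ (Λ₀ : Finset L) (A : SpinEgorov.Poly Λ₀) (ε : ℝ), 0 < ε →
      ∃ C : ℝ → ℝ, ∀ (Λ : Finset L) (hΛ : Λ₀ ⊆ Λ),
        ∃ At : ℝ → SpinEgorov.Poly Λ,
          (∀ t : ℝ, ∀ M ∈ SpinEgorov.phaseSpace Λ,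
            ‖SpinEgorov.classicalEvolution V Λ t (A.extend hΛ).value M - (At t).value M‖ ≤ ε) ∧
          ∀ (n : ℕ), 1 ≤ n → ∀ t : ℝ,
            ‖SpinEgorov.quantumEvolution V Λ n t (SpinEgorov.quantize n (A.extend hΛ)) -
                SpinEgorov.quantize n (At t)‖ ≤ ε + C t / ((n : ℝ) / 2) := by
  obtain ⟨v, hv⟩ := SpinEgorov.exists_isBoundedPotential hnorm hcont
  refine ⟨fun Λ M₀ hM₀ => SpinEgorov.existsUnique_classicalSolution hreal (hv Λ) hM₀,
    fun Λ n hn => SpinEgorov.existsUnique_propagator hreal (hv Λ) hn, fun Λ₀ A ε hε => ?_⟩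
  have hh : 0 ≤ ∑' n, v n := (hv ∅).tsum_nonneg
  -- The ceiling is the number of segments with `|σ| (h + 1) ≤ 1/5` that suffice to get from `t`
  -- back to `0`, where observing means evaluating or quantizing without evolution.
  choose C _ hC using fun t : ℝ => SpinEgorov.exists_iterated_approx hh
    ⌈5 * (|t| * (∑' n, v n + 1))⌉₊ (A.support.sup Finsupp.degree) (SpinEgorov.coeffNorm A)
    (SpinEgorov.coeffNorm_nonneg A) ε hε
  -- The quantum flow has error `98 / n = 49 / s` with `s = n / 2`.
  refine ⟨fun t => 49 * C t, fun Λ hΛ => ?_⟩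
  have ht : ∀ t : ℝ, |0 - t| * (∑' n, v n + 1) ≤
      (⌈5 * (|t| * (∑' n, v n + 1))⌉₊ : ℝ) * (1 / 5) := by
    intro t
    rw [zero_sub, abs_neg]
    linarith [Nat.le_ceil (5 * (|t| * (∑' n, v n + 1)))]
  choose At hAt using fun t : ℝ => hC t (SpinEgorov.localPotential V Λ) v (hv Λ) le_rfl t 0 (ht t)
    (A.extend hΛ) (fun γ hγ => A.degree_le_of_mem_support_extend hΛ hγ)
    (A.coeffNorm_extend_le hΛ)
  refine ⟨At, fun t M hM => SpinEgorov.norm_classicalEvolution_sub_le hreal (hv Λ) (hAt t) hM,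
    fun n hn t => (SpinEgorov.norm_quantumEvolution_sub_le hreal (hv Λ) hn (hAt t)).trans_eq ?_⟩
  have hn0 : (n : ℝ) ≠ 0 := by positivity
  field_simp
  ring
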